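/- Let $\mathbb K\in\{\mathbb R,\mathbb C\}$ and let $\mathfrak g$ be a locally convex Lie algebra over $\mathbb K$ (a locally convex space with a jointly continuous Lie bracket) that is nilpotent of step $N\ge 1$, i.e. all iterated brackets of $N+1$ elements vanish. Let $\mathrm{Sym}(\mathfrak g)\subseteq \mathrm T(\mathfrak g)$ be the symmetric algebra, viewed as the space of symmetric tensors, and let $\mathfrak q:\mathrm{Sym}(\mathfrak g)\to U(\mathfrak g)$, $\xi_1\cdots\xi_n\mapsto\frac1{n!}\sum_{\sigma\in S_n}\xi_{\sigma(1)}\odot\cdots\odot\xi_{\sigma(n)}$, be the (bijective) Poincaré–Birkhoff–Witt map. For $x\in\mathrm{Sym}^k$, $y\in\mathrm{Sym}^\ell$ let $C_n(x,y)$ be the part of degree $k+\ell-n$ of $\mathfrak q^{-1}(\mathfrak q(x)\odot\mathfrak q(y))$, extend $C_n$ bilinearly, and let $x\star_z y=\sum_n z^nC_n(x,y)$, $z\in\mathbb K$, be the Gutt star product. For a continuous seminorm $p$ on $\mathfrak g$ and $R\in\mathbb R$ put $p_R=\sum_n n!^R\,p^{\otimes n}$ (projective tensor powers, $p^{\otimes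 0}=|\cdot|$). Let $\mathrm{Sym}_R(\mathfrak g)$ be $\mathrm{Sym}(\mathfrak g)$ with the locally convex topology given by all $p_R$, and $\mathrm{Sym}_{1^-}(\mathfrak g)$ the projective limit of the $\mathrm{Sym}_{1-\epsilon}(\mathfrak g)$ for $\epsilon\to0^+$. A continuous seminorm $q$ is an asymptotic estimate for $p$ if $p(w(x_1,\dots,x_n))\le q(x_1)\cdots q(x_n)$ for every $n\ge1$ and every arbitrarily bracketed Lie word $w$ in $x_1,\dots,x_n\in\mathfrak g$, each occurring once; every continuous seminorm on $\mathfrak g$ has one. (1) Let $0\le R<1$ and $\epsilon=\frac{N-1}{N}(1-R)$. Every $C_n$ is continuous on $\mathrm{Sym}_R(\mathfrak g)$. If $q$ is an asymptotic estimate for $p$, then for $x,y\in\mathrm{Sym}(\mathfrak g)$ $$p_R(C_n(x,y))\le\frac1{2\cdot8^n}\,(32e\,q)_{R+\epsilon}(x)\,(32e\,q)_{R+\epsilon}(y)$$ whenever $n\ge1$, and also for $n=0$ if $x$ or $y$ has vanishing degree-zero part; for $n=0$ and arbitrary $x,y$ the estimate holds without the factor $\frac12$. Moreover, for all $z\in\mathbb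 K$, $$p_R(x\star_z y)\le(c\,q)_{R+\epsilon}(x)\,(c\,q)_{R+\epsilon}(y),\qquad c=32e(|z|+1).$$ (2) For each of the topologies $\mathrm{Sym}_R$ with $R\ge1$, and for the topology $\mathrm{Sym}_{1^-}$, write $\widehat{\mathrm{Sym}}(\mathfrak g)$ for the completion. Then: (a) $\star_z$ is continuous for every $z\in\mathbb K$. (b) For every $z\in\mathbb K$, $\widehat{\mathrm{Sym}}(\mathfrak g)$ is a complete locally convex Hopf algebra (with respect to completed projective tensor products) whose structure maps are the continuous extensions of $\star_z$ and of the undeformed unit, coproduct, counit and antipode of $\mathrm{Sym}(\mathfrak g)$. (c) The $C_n$ extend to continuous bilinear maps on $\widehat{\mathrm{Sym}}(\mathfrak g)$, and for all $x,y\in\widehat{\mathrm{Sym}}(\mathfrak g)$ and all $z\in\mathbb K$ the series $\sum_n z^nC_n(x,y)$ converges absolutely (with respect to every continuous seminorm) to $x\star_z y$. (d) The construction is functorial: every continuous homomorphism $\phi:\mathfrak g\to\mathfrak h$ into a nilpotent locally convex Lie algebra $\mathfrak h$ induces, by $\xi_1\cdots\xi_n\mapsto\phi(\xi_1)\cdots\phi(\xi_n)$,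 a continuous linear map $\widehat{\mathrm{Sym}}(\mathfrak g)\to\widehat{\mathrm{Sym}}(\mathfrak h)$ extending $\phi$, which for every $z\in\mathbb K$ is a homomorphism of the locally convex Hopf algebras of (b); identities and compositions are preserved. -/

import Mathlib

open scoped TensorProduct DirectSum Nat NNReal

noncomputable section

namespace GuttStar

/-! ## The symmetric algebra inside the tensor algebra -/

section Algebra

variable (𝕜 : Type*) [RCLike 𝕜] (V : Type*) [AddCommGroup V] [Module 𝕜 V]

/-- The component of degree `n` of an element of the tensor algebra. -/
def component (n : ℕ) : TensorAlgebra 𝕜 V →ₗ[𝕜] ⨂[𝕜]^n V :=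
  DirectSum.component 𝕜 ℕ (fun n => ⨂[𝕜]^n V) n ∘ₗ
    (TensorAlgebra.equivDirectSum (R := 𝕜) (M := V)).toLinearMap

/-- The symmetrizer `v₁ ⊗ ⋯ ⊗ vₙ ↦ (1 / n!) ∑_σ v_σ(1) ⊗ ⋯ ⊗ v_σ(n)` of the `n`-th tensor power. -/
def symmetrizerPower (n : ℕ) : ⨂[𝕜]^n V →ₗ[𝕜] ⨂[𝕜]^n V :=
  ((n ! : 𝕜)⁻¹) • ∑ σ : Equiv.Perm (Fin n), (PiTensorProduct.reindex 𝕜 (fun _ => V) σ).toLinearMap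

/-- The symmetrizer of the tensor algebra. -/
def symmetrizer : TensorAlgebra 𝕜 V →ₗ[𝕜] TensorAlgebra 𝕜 V :=
  (TensorAlgebra.equivDirectSum (R := 𝕜) (M := V)).symm.toLinearMap ∘ₗ
    DirectSum.lmap (symmetrizerPower 𝕜 V) ∘ₗ
    (TensorAlgebra.equivDirectSum (R := 𝕜) (M := V)).toLinearMap

/-- The symmetric algebra, as the subspace of symmetric tensors of the tensor algebra. -/
abbrev SymAlg : Submodule 𝕜 (TensorAlgebra 𝕜 V) := LinearMap.range (symmetrizer 𝕜 V)

/-- The symmetrizer as a map onto the symmetric algebra;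
the symmetric product of `x` and `y` is `sym (x * y)`. -/
def sym : TensorAlgebra 𝕜 V →ₗ[𝕜] SymAlg 𝕜 V := (symmetrizer 𝕜 V).rangeRestrict

/-- The projection of the symmetric algebra onto its homogeneous part of degree `n`. -/
def symProj (n : ℕ) : SymAlg 𝕜 V →ₗ[𝕜] SymAlg 𝕜 V :=
  sym 𝕜 V ∘ₗ TensorPower.toTensorAlgebra ∘ₗ component 𝕜 V n ∘ₗ (SymAlg 𝕜 V).subtype

/-- The inclusion of the degree one part. -/
def symι : V →ₗ[𝕜] SymAlg 𝕜 V := sym 𝕜 V ∘ₗ TensorAlgebra.ι 𝕜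

/-- The unit of the symmetric algebra. -/
def symOne : SymAlg 𝕜 V := sym 𝕜 V 1

/-- The counit of the symmetric algebra: the projection onto degree zero. -/
def symCounit : SymAlg 𝕜 V →ₗ[𝕜] 𝕜 :=
  (TensorAlgebra.algebraMapInv (R := 𝕜) (M := V)).toLinearMap ∘ₗ (SymAlg 𝕜 V).subtype

/-- The antipode of the symmetric algebra, `ξ₁ ⋯ ξₙ ↦ (-1)ⁿ ξ₁ ⋯ ξₙ`. -/
def symAntipode : SymAlg 𝕜 V →ₗ[𝕜] SymAlg 𝕜 V :=
  sym 𝕜 V ∘ₗ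
    (TensorAlgebra.lift 𝕜 (-(TensorAlgebra.ι 𝕜 : V →ₗ[𝕜] TensorAlgebra 𝕜 V))).toLinearMap ∘ₗ
    (SymAlg 𝕜 V).subtype

/-- The shuffle coproduct of the tensor algebra: `ξ₁ ⊗ ⋯ ⊗ ξₙ` is mapped to
`∏ᵢ (ξᵢ ⊗ 1 + 1 ⊗ ξᵢ) = ∑_I ξ_I ⊗ ξ_{Iᶜ}`. -/
def tensorComul : TensorAlgebra 𝕜 V →ₐ[𝕜] TensorAlgebra 𝕜 V ⊗[𝕜] TensorAlgebra 𝕜 V :=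
  TensorAlgebra.lift 𝕜
    ((Algebra.TensorProduct.includeLeft (R := 𝕜) (S := 𝕜) (A := TensorAlgebra 𝕜 V)
        (B := TensorAlgebra 𝕜 V)).toLinearMap ∘ₗ TensorAlgebra.ι 𝕜 +
      (Algebra.TensorProduct.includeRight (R := 𝕜) (A := TensorAlgebra 𝕜 V)
        (B := TensorAlgebra 𝕜 V)).toLinearMap ∘ₗ TensorAlgebra.ι 𝕜)

/-- The coproduct of the symmetric algebra, `ξ₁ ⋯ ξₙ ↦ ∑_I ξ_I ⊗ ξ_{Iᶜ}`
with symmetric products on the right-hand side. -/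
def symComul : SymAlg 𝕜 V →ₗ[𝕜] SymAlg 𝕜 V ⊗[𝕜] SymAlg 𝕜 V :=
  TensorProduct.map (sym 𝕜 V) (sym 𝕜 V) ∘ₗ (tensorComul 𝕜 V).toLinearMap ∘ₗ (SymAlg 𝕜 V).subtype

variable {V} in
/-- The map `ξ₁ ⋯ ξₙ ↦ f(ξ₁) ⋯ f(ξₙ)` between symmetric algebras induced by a linear map `f`. -/
def symMap {W : Type*} [AddCommGroup W] [Module 𝕜 W] (f : V →ₗ[𝕜] W) : SymAlg 𝕜 V →ₗ[𝕜] SymAlg 𝕜 W :=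
  sym 𝕜 W ∘ₗ (TensorAlgebra.lift 𝕜 (TensorAlgebra.ι 𝕜 ∘ₗ f)).toLinearMap ∘ₗ (SymAlg 𝕜 V).subtype

end Algebra

/-! ## The Gutt star product -/

section Gutt

variable (𝕜 : Type*) [RCLike 𝕜] (𝔤 : Type*) [LieRing 𝔤] [LieAlgebra 𝕜 𝔤]

/-- The Poincaré-Birkhoff-Witt map from the symmetric algebra to the universal enveloping algebra,
`ξ₁ ⋯ ξₙ ↦ (1 / n!) ∑_σ ξ_σ(1) ⊙ ⋯ ⊙ ξ_σ(n)`: since elements of the symmetric algebra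
are symmetric tensors already, it is the restriction of the canonical projection of the tensor
algebra onto the universal enveloping algebra. -/
def pbw : SymAlg 𝕜 𝔤 →ₗ[𝕜] UniversalEnvelopingAlgebra 𝕜 𝔤 :=
  (UniversalEnvelopingAlgebra.mkAlgHom 𝕜 𝔤).toLinearMap ∘ₗ (SymAlg 𝕜 𝔤).subtype

open Classical in
/-- The inverse of the map `pbw` (with the value `0` if `pbw` were not bijective). -/
def pbwInv : UniversalEnvelopingAlgebra 𝕜 𝔤 →ₗ[𝕜] SymAlg 𝕜 𝔤 :=
  if h : Function.Bijective (pbw 𝕜 𝔤) then (LinearEquiv.ofBijective (pbw 𝕜 𝔤) h).symm.toLinearMap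
  else 0

variable {𝔤}

/-- The bilinear operators `Cₙ`: for `x` homogeneous of degree `k` and `y` homogeneous of
degree `l`, `Cₙ(x, y)` is the part of degree `k + l - n` of the product of `x` and `y` that is
pulled back from the universal enveloping algebra (and `0` if `n > k + l`). -/
def guttC (n : ℕ) (x y : SymAlg 𝕜 𝔤) : SymAlg 𝕜 𝔤 :=
  ∑ᶠ (k : ℕ) (l : ℕ), if n ≤ k + l then
    symProj 𝕜 𝔤 (k + l - n)
      (pbwInv 𝕜 𝔤 (pbw 𝕜 𝔤 (symProj 𝕜 𝔤 k x) * pbw 𝕜 𝔤 (symProj 𝕜 𝔤 l y)))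
    else 0

variable {𝕜}

/-- The Gutt star product `x ⋆_z y = ∑ₙ zⁿ Cₙ(x, y)`; only finitely many terms are nonzero. -/
def guttStar (z : 𝕜) (x y : SymAlg 𝕜 𝔤) : SymAlg 𝕜 𝔤 := ∑ᶠ n : ℕ, z ^ n • guttC 𝕜 n x y

/-- The value of a bracket expression: an arbitrarily bracketed word `w` in elements of `𝔤`. -/
def bracketWord : FreeMagma 𝔤 → 𝔤
  | .of x => x
  | .mul a b => ⁅bracketWord a, bracketWord b⁆

/-- The product `q x₁ ⋯ q xₙ` over the letters `x₁, …, xₙ` of a bracketed word. -/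
def letterProd (q : Seminorm 𝕜 𝔤) : FreeMagma 𝔤 → ℝ
  | .of x => q x
  | .mul a b => letterProd q a * letterProd q b

/-- `q` is an asymptotic estimate for `p`: `p (w(x₁, …, xₙ)) ≤ q x₁ ⋯ q xₙ` for all bracketed
words `w`, of any length `n ≥ 1`. -/
def IsAsymptoticEstimate (p q : Seminorm 𝕜 𝔤) : Prop :=
  ∀ w : FreeMagma 𝔤, p (bracketWord w) ≤ letterProd q w

end Gutt

/-! ## Topologies -/

section SeminormTopology

variable {𝕜 : Type*} [NormedField 𝕜] {E : Type*} [AddCommGroup E] [Module 𝕜 E]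

/-- The uniform structure on `E` induced by a family of seminorms. -/
@[reducible] def seminormUniformSpace {ι : Type*} (p : ι → Seminorm 𝕜 E) : UniformSpace E :=
  ⨅ i, (p i).toSeminormedAddCommGroup.toUniformSpace

theorem isUniformAddGroup_seminorm {ι : Type*} (p : ι → Seminorm 𝕜 E) :
    @IsUniformAddGroup E (seminormUniformSpace p) _ :=
  isUniformAddGroup_iInf fun i => by
    let := (p i).toSeminormedAddCommGroup
    infer_instance

theorem withSeminorms_seminorm {ι : Type*} (p : ι → Seminorm 𝕜 E) :
    let := seminormUniformSpace p
    WithSeminorms (𝕜 := 𝕜) (E := E) p := by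
  let := seminormUniformSpace p
  have := isUniformAddGroup_seminorm p
  exact (SeminormFamily.withSeminorms_iff_uniformSpace_eq_iInf (𝕜 := 𝕜) p).2 rfl

end SeminormTopology

section SymTopology

variable {𝕜 : Type*} [RCLike 𝕜] {V : Type*} [AddCommGroup V] [Module 𝕜 V]

/-- The projective tensor power `pⁿ = p ⊗ ⋯ ⊗ p` of a seminorm: the infimum of
`∑ⱼ |cⱼ| p(vⱼ₁) ⋯ p(vⱼₙ)` over all representations `∑ⱼ cⱼ vⱼ₁ ⊗ ⋯ ⊗ vⱼₙ` of a tensor.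
For `n = 0` it is the absolute value. -/
def seminormPower (p : Seminorm 𝕜 V) (n : ℕ) : Seminorm 𝕜 (⨂[𝕜]^n V) :=
  letI := p.toSeminormedAddCommGroup
  letI : NormedSpace 𝕜 V := ⟨fun a b => (map_smul_eq_mul p a b).le⟩
  PiTensorProduct.projectiveSeminorm (𝕜 := 𝕜) (E := fun _ : Fin n => V)

/-- The seminorm `p_R = ∑ₙ n!^R pⁿ` on the tensor algebra. -/
def tensorSeminorm (p : Seminorm 𝕜 V) (R : ℝ) : Seminorm 𝕜 (TensorAlgebra 𝕜 V) :=
  have hfin : ∀ x : TensorAlgebra 𝕜 V, (Function.support fun n : ℕ =>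
      ((n ! : ℕ) : ℝ) ^ R * seminormPower p n (component 𝕜 V n x)).Finite := by
    classical
    intro x
    refine (DFinsupp.support (TensorAlgebra.equivDirectSum x)).finite_toSet.subset fun n hn => ?_
    simp only [Finset.mem_coe, DFinsupp.mem_support_iff]
    intro h0
    apply hn
    have : component 𝕜 V n x = 0 := h0
    simp [this]
  Seminorm.of
    (fun x => ∑ᶠ n : ℕ, ((n ! : ℕ) : ℝ) ^ R * seminormPower p n (component 𝕜 V n x))
    (fun x y => by
      rw [← finsum_add_distrib (hfin x) (hfin y),
        finsum_eq_sum_of_support_subset _ (s := (hfin (x + y)).toFinset ∪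
          ((hfin x).toFinset ∪ (hfin y).toFinset)) (by simp [Set.subset_union_left]),
        finsum_eq_sum_of_support_subset _ (s := (hfin (x + y)).toFinset ∪
          ((hfin x).toFinset ∪ (hfin y).toFinset)) (by
            refine (Function.support_add _ _).trans ?_
            simp)]
      refine Finset.sum_le_sum fun n _ => ?_
      rw [map_add, ← mul_add]
      exact mul_le_mul_of_nonneg_left (map_add_le_add _ _ _) (by positivity))
    (fun a x => by
      rw [mul_finsum]
      refine finsum_congr fun n => ?_
      rw [map_smul, map_smul_eq_mul]
      ring)

/-- The seminorm `p_R` on the symmetric algebra. -/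
def symSeminorm (p : Seminorm 𝕜 V) (R : ℝ) : Seminorm 𝕜 (SymAlg 𝕜 V) :=
  (tensorSeminorm p R).comp (SymAlg 𝕜 V).subtype

end SymTopology

section SymT

variable (𝕜 : Type*) [RCLike 𝕜]

/-- The symmetric algebra, with the locally convex topology given by the seminorms `p_R`
for all `R ∈ _I` and all continuous seminorms `p` of `V`. For `_I = {R}` this is the `Sym_R`-topology.
For `_I = {R | R < 1}` this is the projective limit of the `Sym_{1-ε}`-topologies
for `ε → 0`, i.e. the coarsest topology finer than all of them: the `Sym_{1⁻}`-topology. -/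
def SymT (_I : Set ℝ) (V : Type*) [AddCommGroup V] [Module 𝕜 V] : Type _ := SymAlg 𝕜 V

variable (I : Set ℝ) (V : Type*) [AddCommGroup V] [Module 𝕜 V]

instance : AddCommGroup (SymT 𝕜 I V) := inferInstanceAs (AddCommGroup (SymAlg 𝕜 V))

instance : Module 𝕜 (SymT 𝕜 I V) := inferInstanceAs (Module 𝕜 (SymAlg 𝕜 V))

/-- The identity map from the symmetric algebra to the topologized symmetric algebra. -/
def toSymT : SymAlg 𝕜 V ≃ₗ[𝕜] SymT 𝕜 I V := LinearEquiv.refl 𝕜 (SymAlg 𝕜 V)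

variable [TopologicalSpace V]

/-- The seminorms defining the topology of `SymT 𝕜 I V`. -/
def symTSeminorms (i : I × {p : Seminorm 𝕜 V // Continuous p}) : Seminorm 𝕜 (SymT 𝕜 I V) :=
  (symSeminorm i.2.1 i.1).comp (toSymT 𝕜 I V).symm.toLinearMap

instance : UniformSpace (SymT 𝕜 I V) := seminormUniformSpace (symTSeminorms 𝕜 I V)

instance : IsUniformAddGroup (SymT 𝕜 I V) := isUniformAddGroup_seminorm _

instance : ContinuousSMul 𝕜 (SymT 𝕜 I V) :=
  WithSeminorms.continuousSMul (withSeminorms_seminorm (symTSeminorms 𝕜 I V))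

instance : UniformContinuousConstSMul 𝕜 (SymT 𝕜 I V) :=
  uniformContinuousConstSMul_of_continuousConstSMul _ _

/-- The (Hausdorff) completion of the topologized symmetric algebra. -/
abbrev SymHat : Type _ := UniformSpace.Completion (SymT 𝕜 I V)

/-- The canonical map of the symmetric algebra into its completion. -/
def toSymHat : SymAlg 𝕜 V →ₗ[𝕜] SymHat 𝕜 I V where
  toFun x := ((toSymT 𝕜 I V x : SymT 𝕜 I V) : SymHat 𝕜 I V)
  map_add' x y := by rw [map_add, UniformSpace.Completion.coe_add]
  map_smul' a x := by rw [map_smul, UniformSpace.Completion.coe_smul, RingHom.id_apply]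

end SymT

/-! ## Completed projective tensor products and locally convex Hopf algebras -/

section ProjTensor

variable (𝕜 : Type*) [RCLike 𝕜]
variable (E : Type*) [AddCommGroup E] [Module 𝕜 E] [TopologicalSpace E]
variable (F : Type*) [AddCommGroup F] [Module 𝕜 F] [TopologicalSpace F]

/-- The projective tensor product of two locally convex spaces: the algebraic tensor product with
the finest locally convex topology for which `(e, f) ↦ e ⊗ f` is jointly continuous. -/
def ProjTensor (𝕜 : Type*) [RCLike 𝕜] (E : Type*) [AddCommGroup E] [Module 𝕜 E]
    [TopologicalSpace E] (F : Type*) [AddCommGroup F] [Module 𝕜 F] [TopologicalSpace F] :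
    Type _ := E ⊗[𝕜] F

instance : AddCommGroup (ProjTensor 𝕜 E F) := inferInstanceAs (AddCommGroup (E ⊗[𝕜] F))

instance : Module 𝕜 (ProjTensor 𝕜 E F) := inferInstanceAs (Module 𝕜 (E ⊗[𝕜] F))

/-- The identity map from the tensor product to the topologized tensor product. -/
def toProjTensor : E ⊗[𝕜] F ≃ₗ[𝕜] ProjTensor 𝕜 E F := LinearEquiv.refl 𝕜 (E ⊗[𝕜] F)

/-- The seminorms on a projective tensor product: all seminorms `s` for which
`(e, f) ↦ s (e ⊗ f)` is continuous. -/
def projSeminorms (s : {s : Seminorm 𝕜 (ProjTensor 𝕜 E F) //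
    Continuous fun x : E × F => s (toProjTensor 𝕜 E F (x.1 ⊗ₜ[𝕜] x.2))}) :
    Seminorm 𝕜 (ProjTensor 𝕜 E F) := s.1

instance : UniformSpace (ProjTensor 𝕜 E F) := seminormUniformSpace (projSeminorms 𝕜 E F)

instance : IsUniformAddGroup (ProjTensor 𝕜 E F) := isUniformAddGroup_seminorm _

instance : ContinuousSMul 𝕜 (ProjTensor 𝕜 E F) :=
  WithSeminorms.continuousSMul (withSeminorms_seminorm (projSeminorms 𝕜 E F))

instance : UniformContinuousConstSMul 𝕜 (ProjTensor 𝕜 E F) :=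
  uniformContinuousConstSMul_of_continuousConstSMul _ _

/-- The completed projective tensor product. -/
abbrev CTensor : Type _ := UniformSpace.Completion (ProjTensor 𝕜 E F)

/-- The canonical map of the algebraic into the completed tensor product. -/
def toCTensor : E ⊗[𝕜] F →ₗ[𝕜] CTensor 𝕜 E F where
  toFun x := ((toProjTensor 𝕜 E F x : ProjTensor 𝕜 E F) : CTensor 𝕜 E F)
  map_add' x y := by rw [map_add, UniformSpace.Completion.coe_add]
  map_smul' a x := by rw [map_smul, UniformSpace.Completion.coe_smul, RingHom.id_apply]

variable {E F}

/-- The elementary tensor `a ⊗ b` in the completed tensor product. -/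
def ctmul (a : E) (b : F) : CTensor 𝕜 E F := toCTensor 𝕜 E F (a ⊗ₜ[𝕜] b)

variable {𝕜}
variable {E' : Type*} [AddCommGroup E'] [Module 𝕜 E'] [TopologicalSpace E']
variable {F' : Type*} [AddCommGroup F'] [Module 𝕜 F'] [TopologicalSpace F']

/-- The tensor product of continuous linear maps. -/
def projMap (f : E →L[𝕜] E') (g : F →L[𝕜] F') : ProjTensor 𝕜 E F →L[𝕜] ProjTensor 𝕜 E' F' where
  toLinearMap := (toProjTensor 𝕜 E' F').toLinearMap ∘ₗ
    TensorProduct.map f.toLinearMap g.toLinearMap ∘ₗ (toProjTensor 𝕜 E F).symm.toLinearMap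
  cont := by
    refine WithSeminorms.continuous_of_isBounded (withSeminorms_seminorm (projSeminorms 𝕜 E F))
      (withSeminorms_seminorm (projSeminorms 𝕜 E' F')) _ fun s => ?_
    have hs : Continuous fun x : E × F => (s.1.comp ((toProjTensor 𝕜 E' F').toLinearMap ∘ₗ
        TensorProduct.map f.toLinearMap g.toLinearMap ∘ₗ (toProjTensor 𝕜 E F).symm.toLinearMap))
        (toProjTensor 𝕜 E F (x.1 ⊗ₜ[𝕜] x.2)) :=
      s.2.comp (f.continuous.prodMap g.continuous)
    refine ⟨{⟨_, hs⟩}, 1, ?_⟩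
    simp [projSeminorms]

/-- The completed tensor product of continuous linear maps. -/
def ctMap (f : E →L[𝕜] E') (g : F →L[𝕜] F') : CTensor 𝕜 E F →L[𝕜] CTensor 𝕜 E' F' :=
  (projMap f g).completion

end ProjTensor

section Hopf

/-- A locally convex Hopf algebra: a complete Hausdorff locally convex space `H` with continuous
linear structure maps (on completed projective tensor products) satisfying the axioms of a
Hopf algebra. The rearrangement maps in the coassociativity and in the compatibility of
product and coproduct are uniquely determined by their values on elementary tensors, whose span
is dense. -/
structure LCHopfAlgebra (𝕜 : Type*) [RCLike 𝕜] (H : Type*) [AddCommGroup H] [Module 𝕜 H]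
    [UniformSpace H] where
  complete : CompleteSpace H
  hausdorff : T2Space H
  locallyConvex : PolynormableSpace 𝕜 H
  mul : CTensor 𝕜 H H →L[𝕜] H
  one : H
  comul : H →L[𝕜] CTensor 𝕜 H H
  counit : H →L[𝕜] 𝕜
  antipode : H →L[𝕜] H
  mul_assoc : ∀ a b c, mul (ctmul 𝕜 (mul (ctmul 𝕜 a b)) c) = mul (ctmul 𝕜 a (mul (ctmul 𝕜 b c)))
  one_mul : ∀ a, mul (ctmul 𝕜 one a) = a
  mul_one : ∀ a, mul (ctmul 𝕜 a one) = a
  coassoc : ∃ α : CTensor 𝕜 (CTensor 𝕜 H H) H →L[𝕜] CTensor 𝕜 H (CTensor 𝕜 H H),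
    (∀ a b c, α (ctmul 𝕜 (ctmul 𝕜 a b) c) = ctmul 𝕜 a (ctmul 𝕜 b c)) ∧
    ∀ a, α (ctMap comul (ContinuousLinearMap.id 𝕜 H) (comul a)) =
      ctMap (ContinuousLinearMap.id 𝕜 H) comul (comul a)
  counit_comul : ∀ a, ctMap counit (ContinuousLinearMap.id 𝕜 H) (comul a) = ctmul 𝕜 (1 : 𝕜) a
  comul_counit : ∀ a, ctMap (ContinuousLinearMap.id 𝕜 H) counit (comul a) = ctmul 𝕜 a (1 : 𝕜)
  comul_mul : ∃ τ : CTensor 𝕜 (CTensor 𝕜 H H) (CTensor 𝕜 H H) →L[𝕜]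
      CTensor 𝕜 (CTensor 𝕜 H H) (CTensor 𝕜 H H),
    (∀ a b c d, τ (ctmul 𝕜 (ctmul 𝕜 a b) (ctmul 𝕜 c d)) =
      ctmul 𝕜 (ctmul 𝕜 a c) (ctmul 𝕜 b d)) ∧
    ∀ a b, comul (mul (ctmul 𝕜 a b)) = ctMap mul mul (τ (ctmul 𝕜 (comul a) (comul b)))
  comul_one : comul one = ctmul 𝕜 one one
  counit_mul : ∀ a b, counit (mul (ctmul 𝕜 a b)) = counit a * counit b
  counit_one : counit one = 1
  antipode_left : ∀ a, mul (ctMap antipode (ContinuousLinearMap.id 𝕜 H) (comul a)) = counit a • one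
  antipode_right : ∀ a, mul (ctMap (ContinuousLinearMap.id 𝕜 H) antipode (comul a)) = counit a • one

variable {𝕜 : Type*} [RCLike 𝕜]

/-- Continuous linear maps that respect all structure maps of locally convex Hopf algebras. -/
structure IsHopfHom {H K : Type*} [AddCommGroup H] [Module 𝕜 H] [UniformSpace H]
    [AddCommGroup K] [Module 𝕜 K] [UniformSpace K]
    (A : LCHopfAlgebra 𝕜 H) (B : LCHopfAlgebra 𝕜 K) (Φ : H →L[𝕜] K) : Prop where
  map_mul : ∀ a b, Φ (A.mul (ctmul 𝕜 a b)) = B.mul (ctmul 𝕜 (Φ a) (Φ b))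
  map_one : Φ A.one = B.one
  map_comul : ∀ a, B.comul (Φ a) = ctMap Φ Φ (A.comul a)
  map_counit : ∀ a, B.counit (Φ a) = A.counit a
  map_antipode : ∀ a, B.antipode (Φ a) = Φ (A.antipode a)

variable {I : Set ℝ} {𝔤 : Type*} [LieRing 𝔤] [LieAlgebra 𝕜 𝔤] [TopologicalSpace 𝔤]

/-- The Hopf algebra structure `A` on the completed symmetric algebra extends the Gutt star product
`⋆_z` and the undeformed unit, coproduct, counit and antipode of the symmetric algebra. -/
structure ExtendsGutt (z : 𝕜) (A : LCHopfAlgebra 𝕜 (SymHat 𝕜 I 𝔤)) : Prop where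
  mul : ∀ x y : SymAlg 𝕜 𝔤,
    A.mul (ctmul 𝕜 (toSymHat 𝕜 I 𝔤 x) (toSymHat 𝕜 I 𝔤 y)) = toSymHat 𝕜 I 𝔤 (guttStar z x y)
  one : A.one = toSymHat 𝕜 I 𝔤 (symOne 𝕜 𝔤)
  comul : ∀ x : SymAlg 𝕜 𝔤, A.comul (toSymHat 𝕜 I 𝔤 x) =
    toCTensor 𝕜 (SymHat 𝕜 I 𝔤) (SymHat 𝕜 I 𝔤)
      (TensorProduct.map (toSymHat 𝕜 I 𝔤) (toSymHat 𝕜 I 𝔤) (symComul 𝕜 𝔤 x))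
  counit : ∀ x : SymAlg 𝕜 𝔤, A.counit (toSymHat 𝕜 I 𝔤 x) = symCounit 𝕜 𝔤 x
  antipode : ∀ x : SymAlg 𝕜 𝔤, A.antipode (toSymHat 𝕜 I 𝔤 x) = toSymHat 𝕜 I 𝔤 (symAntipode 𝕜 𝔤 x)

variable (I) in
/-- The map between the completed symmetric algebras induced by a linear map `f`. -/
def symHatMap {𝔥 : Type*} [LieRing 𝔥] [LieAlgebra 𝕜 𝔥] [TopologicalSpace 𝔥]
    (f : 𝔤 →ₗ⁅𝕜⁆ 𝔥) : SymHat 𝕜 I 𝔤 → SymHat 𝕜 I 𝔥 :=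
  UniformSpace.Completion.map fun x : SymT 𝕜 I 𝔤 =>
    toSymT 𝕜 I 𝔥 (symMap 𝕜 f.toLinearMap ((toSymT 𝕜 I 𝔤).symm x))

end Hopf

end GuttStar

end

open GuttStar

/-! The symmetric algebra is spanned by powers, so a linear identity on it need only be checked on
(divided) powers. The star product is built by hand: `leftMul 𝔤 z ξ` is the Bernoulli operator
sending `η ^ k / k!` to the sum over `r` of `z ^ r (B_r / r!) (η ^ (k - r) / (k - r)!) (ad η) ^ r
ξ`. Two facts about these operators carry the algebra. By `leftMul_lie` they satisfy the commutation
relations of `𝔤` with bracket rescaled by `z`; this is a polynomial identity between Bernoulli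
numbers, read off from the generating function `x / (exp x - 1)`. By `symLift_leftMul`, whenever a
linear map `j` into an associative algebra satisfies the same relations, its symmetrized extension
turns `leftMul 𝔤 z ξ` into left multiplication by `j ξ`. With `j = leftMul 𝔤 z` this gives
associativity, and with the inclusion into `U(𝔤)` at `z = 1` it identifies the product with the one
pulled back from `U(𝔤)`. Letting `U(𝔤)` act on `1` proves the Poincaré-Birkhoff-Witt theorem. The
resulting universal property `starLift` shows that counit, coproduct and induced maps respect the
star product. On powers of a single element the star product is undeformed, which is why the
classical antipode still works.

For the estimates, multiply `l` letters from the left by `k` further letters, one after the other.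
The part `C_n` is a combination of products of `k + l - n` bracket words that use each of the `k +
l` letters once, with total weight at most `2 ^ k (k + l)! / (k + l - n)!`: every contraction may
hit any remaining factor, which produces falling factorials, and the coefficients `B_r / r!` have
absolute sum at most `2` (`leftMulPart_eq_zero_and_hull`). An asymptotic estimate bounds each word
by its letters. Nilpotency enters because words longer than `N` vanish, so only `k + l ≤ N (k + l -
n)` matters, and then `(k + l)!` is at most `(k + l - n)! ^ N` up to a geometric factor.
Interpolating gives the exponent `R + ε` (`descFactorial_mul_rpow_le_of_nilpotent`). For `R ≥ 1` no
exponent is lost, and for `R < 1` the exponent `R + ε` is again below `1`, so the family defining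
`Sym_{1⁻}` absorbs the loss.

The resulting property `GuttBound` is uniform in `n` and geometric in `k + l`. Since `C_n` vanishes
for `n > k + l`, any factor `M ^ n` can be absorbed by rescaling `q`; this gives the factor `8 ^
(-n)`, the continuity of the star product, and absolute convergence for every `z`. All remaining
statements on completions are closed conditions that hold on the dense algebraic part. -/

noncomputable section

namespace GuttStar

open scoped TensorProduct DirectSum Nat NNReal
open Finset.HasAntidiagonal (antidiagonal)
open UniformSpace Topology

/-! ### Polarization: coefficients of vector-valued polynomial functions. -/

section Polarization

variable {𝕜 : Type*} [Field 𝕜] [CharZero 𝕜]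

/-- The coefficients of a polynomial function with values in a submodule lie in the submodule. -/
theorem mem_of_sum_pow_smul_mem {M : Type*} [AddCommGroup M] [Module 𝕜 M] (W : Submodule 𝕜 M)
    (n : ℕ) (w : ℕ → M) (h : ∀ ε : 𝕜, ∑ i ∈ Finset.range n, ε ^ i • w i ∈ W) :
    ∀ i < n, w i ∈ W := by
  induction n generalizing w with
  | zero => intro i hi; omega
  | succ n ih =>
    -- Subtracting `2 ^ n` times the value at `ε` from the value at `2 ε` removes the top
    -- coefficient; the lower ones are multiplied by numbers that are nonzero in characteristic
    -- zero.
    have key : ∀ i < n, ((2 : 𝕜) ^ i - 2 ^ n) • w i ∈ W := by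
      refine ih _ fun ε => ?_
      have h1 := W.sub_mem (h (2 * ε)) (W.smul_mem ((2 : 𝕜) ^ n) (h ε))
      convert h1 using 1
      rw [Finset.smul_sum, ← Finset.sum_sub_distrib, Finset.sum_range_succ]
      simp only [mul_pow, smul_smul, sub_self, add_zero]
      refine Finset.sum_congr rfl fun i _ => ?_
      rw [← sub_smul]
      congr 1
      ring
    have hlt : ∀ i < n, w i ∈ W := fun i hi => by
      have hne : ((2 : 𝕜) ^ i - 2 ^ n) ≠ 0 := by
        rw [sub_ne_zero]
        exact_mod_cast (Nat.pow_lt_pow_right one_lt_two hi).ne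
      exact (W.smul_mem_iff hne).1 (key i hi)
    intro i hi
    rcases Nat.lt_succ_iff_lt_or_eq.1 hi with hi | rfl
    · exact hlt i hi
    · have h1 := h 1
      rw [Finset.sum_range_succ] at h1
      simpa using (W.add_mem_iff_right (W.sum_mem fun j hj =>
        W.smul_mem _ (hlt j (Finset.mem_range.1 hj)))).1 h1

theorem eq_of_sum_pow_smul_eq {M : Type*} [AddCommGroup M] [Module 𝕜 M]
    (n : ℕ) (w w' : ℕ → M) (h : ∀ ε : 𝕜, ∑ i ∈ Finset.range n, ε ^ i • w i =
      ∑ i ∈ Finset.range n, ε ^ i • w' i) (i : ℕ) (hi : i < n) : w i = w' i := by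
  have := mem_of_sum_pow_smul_mem (⊥ : Submodule 𝕜 M) n (fun i => w i - w' i) (fun ε => by
    simp only [smul_sub, Finset.sum_sub_distrib, h ε, sub_self, Submodule.zero_mem]) i hi
  simpa [sub_eq_zero] using this

/-- The expansion of `(b + ε a)ⁿ` in a noncommutative algebra, with its linear coefficient. -/
theorem exists_add_smul_pow {𝕜 : Type*} [Field 𝕜] {A : Type*} [Ring A] [Algebra 𝕜 A]
    (a b : A) (n : ℕ) :
    ∃ f : ℕ → A, (∀ ε : 𝕜, (b + ε • a) ^ n = ∑ i ∈ Finset.range (n + 1), ε ^ i • f i) ∧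
      f 0 = b ^ n ∧ (∀ i, n < i → f i = 0) ∧
      f 1 = ∑ i ∈ Finset.range n, b ^ i * a * b ^ (n - 1 - i) := by
  induction n with
  | zero => exact ⟨fun i => if i = 0 then 1 else 0, by simp, by simp, fun i hi => by simp [hi.ne'],
      by simp⟩
  | succ n ih =>
    obtain ⟨f, hf, hf0, hfn, hf1⟩ := ih
    refine ⟨fun i => b * f i + if i = 0 then 0 else a * f (i - 1), fun ε => ?_, ?_, ?_, ?_⟩
    · simp only [smul_add, Finset.sum_add_distrib]
      rw [pow_succ', hf ε, add_mul, Finset.sum_range_succ _ (n + 1), hfn (n + 1) (by omega),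
        Finset.sum_range_succ' _ (n + 1), Finset.mul_sum, Finset.mul_sum]
      simp [pow_succ, mul_smul]
    · simp [hf0, pow_succ']
    · intro i hi
      simp [hfn i (by omega), hfn (i - 1) (by omega), show i ≠ 0 by omega]
    · rw [Finset.sum_range_succ']
      simp only [hf1, hf0, Finset.mul_sum]
      congr 1
      · refine Finset.sum_congr rfl fun i _ => ?_
        rw [pow_succ', show n + 1 - 1 - (i + 1) = n - 1 - i by omega]
        simp only [mul_assoc]
      · simp

end Polarization

/-! ### Derivations, divided powers and spanning by powers in the symmetric algebra. -/

section Symmetric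

open SymmetricAlgebra

/-- A derivation is the second component of an algebra section into the trivial square-zero
extension, and such a section is supplied by the universal property of the symmetric algebra. The
required right action is the left one, by commutativity. -/
theorem exists_derivation {R : Type*} [CommRing R] {V : Type*} [AddCommGroup V] [Module R V]
    {M : Type*} [AddCommGroup M] [Module R M]
    [Module (SymmetricAlgebra R V) M] [IsScalarTower R (SymmetricAlgebra R V) M] (f : V →ₗ[R] M) :
    ∃ D : Derivation R (SymmetricAlgebra R V) M, ∀ v, D (ι R V v) = f v := by
  let : Module (SymmetricAlgebra R V)ᵐᵒᵖ M :=
    Module.compHom _ ((RingHom.id (SymmetricAlgebra R V)).fromOpposite mul_comm)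
  have : IsCentralScalar (SymmetricAlgebra R V) M := ⟨fun r m => rfl⟩
  let F : SymmetricAlgebra R V →ₐ[R] TrivSqZeroExt (SymmetricAlgebra R V) M :=
    SymmetricAlgebra.lift ((TrivSqZeroExt.inlAlgHom R (SymmetricAlgebra R V) M).toLinearMap ∘ₗ
      ι R V + (TrivSqZeroExt.inrHom (SymmetricAlgebra R V) M).restrictScalars R ∘ₗ f)
  have hF : ∀ x, (F x).fst = x := by
    intro x
    have : (TrivSqZeroExt.fstHom R (SymmetricAlgebra R V) M).comp F = AlgHom.id R _ := by
      apply SymmetricAlgebra.algHom_ext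
      ext v
      simp [F]
    exact congr($this x)
  refine ⟨Derivation.mk' (((TrivSqZeroExt.sndHom (SymmetricAlgebra R V) M).restrictScalars R) ∘ₗ
    F.toLinearMap) fun a b => ?_, fun v => ?_⟩
  · simp [hF]
  · simp [F]

variable (𝕜 : Type*) [Field 𝕜] (V : Type*) [AddCommGroup V] [Module 𝕜 V]

/-- The universal derivation `v₁ ⋯ vₙ ↦ ∑ᵢ (v₁ ⋯ v̂ᵢ ⋯ vₙ) ⊗ vᵢ` of the symmetric algebra. -/
def univDeriv : Derivation 𝕜 (SymmetricAlgebra 𝕜 V) (SymmetricAlgebra 𝕜 V ⊗[𝕜] V) :=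
  (exists_derivation (TensorProduct.mk 𝕜 (SymmetricAlgebra 𝕜 V) V 1)).choose

variable {V}

theorem univDeriv_ι (v : V) : univDeriv 𝕜 V (ι 𝕜 V v) = 1 ⊗ₜ v :=
  (exists_derivation (TensorProduct.mk 𝕜 (SymmetricAlgebra 𝕜 V) V 1)).choose_spec v

/-- The divided power `vᵏ / k!`, which is zero for negative exponents. -/
def dpow (v : V) (k : ℤ) : SymmetricAlgebra 𝕜 V :=
  if 0 ≤ k then ((k.toNat ! : ℕ) : 𝕜)⁻¹ • ι 𝕜 V v ^ k.toNat else 0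

variable {𝕜}

theorem dpow_natCast (v : V) (k : ℕ) : dpow 𝕜 v k = ((k ! : ℕ) : 𝕜)⁻¹ • ι 𝕜 V v ^ k := by
  simp [dpow]

theorem dpow_of_neg (v : V) {k : ℤ} (hk : k < 0) : dpow 𝕜 v k = 0 := by
  simp [dpow, hk]

theorem pow_eq_smul_dpow [CharZero 𝕜] (v : V) (k : ℕ) :
    ι 𝕜 V v ^ k = ((k ! : ℕ) : 𝕜) • dpow 𝕜 v k := by
  rw [dpow_natCast, smul_smul, mul_inv_cancel₀ (Nat.cast_ne_zero.2 k.factorial_ne_zero), one_smul]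

/-- Integer exponents, with value zero on negative ones, are used so that this rule has no boundary
case; all later index shifts rely on it. -/
theorem univDeriv_dpow [CharZero 𝕜] (v : V) (k : ℤ) :
    univDeriv 𝕜 V (dpow 𝕜 v k) = dpow 𝕜 v (k - 1) ⊗ₜ v := by
  rcases lt_trichotomy k 0 with hk | rfl | hk
  · rw [dpow_of_neg v hk, dpow_of_neg v (by omega)]; simp
  · rw [dpow_of_neg v (k := 0 - 1) (by omega), show (0 : ℤ) = (0 : ℕ) by rfl, dpow_natCast]
    simp
  · obtain ⟨n, rfl⟩ : ∃ n : ℕ, k = (n + 1 : ℕ) := ⟨k.toNat - 1, by omega⟩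
    rw [show ((n + 1 : ℕ) : ℤ) - 1 = (n : ℕ) by push_cast; ring, dpow_natCast, dpow_natCast,
      Derivation.map_smul, Derivation.leibniz_pow, univDeriv_ι, TensorProduct.smul_tmul',
      smul_eq_mul, mul_one, Nat.add_sub_cancel, ← Nat.cast_smul_eq_nsmul 𝕜, smul_smul,
      TensorProduct.smul_tmul', Nat.factorial_succ]
    congr 2
    push_cast
    have : (n : 𝕜) + 1 ≠ 0 := by exact_mod_cast n.succ_ne_zero
    field_simp

/-- The symmetric algebra is spanned by powers. -/
theorem span_pow [CharZero 𝕜] :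
    Submodule.span 𝕜 (Set.range fun p : V × ℕ => ι 𝕜 V p.1 ^ p.2) = ⊤ := by
  set P := Submodule.span 𝕜 (Set.range fun p : V × ℕ => ι 𝕜 V p.1 ^ p.2) with hP
  have hι : ∀ v : V, ∀ y ∈ P, ι 𝕜 V v * y ∈ P := by
    intro v y hy
    induction hy using Submodule.span_induction with
    | mem y hy =>
      obtain ⟨⟨η, m⟩, rfl⟩ := hy
      -- All powers `(η + ε v) ^ (m + 1)` lie in the span, hence so does their coefficient of `ε`,
      -- which is `(m + 1) v η ^ m`.
      obtain ⟨f, hf, -, -, hf1⟩ := exists_add_smul_pow (𝕜 := 𝕜) (ι 𝕜 V v) (ι 𝕜 V η) (m + 1)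
      have h1 := mem_of_sum_pow_smul_mem P (m + 2) f (fun ε => by
        rw [← hf ε, ← map_smul, ← map_add]
        exact Submodule.subset_span ⟨(_, m + 1), rfl⟩) 1 (by omega)
      have h2 : f 1 = ((m : 𝕜) + 1) • (ι 𝕜 V v * ι 𝕜 V η ^ m) := by
        rw [hf1, Finset.sum_congr rfl (g := fun _ => ι 𝕜 V v * ι 𝕜 V η ^ m)]
        · rw [Finset.sum_const, Finset.card_range, ← Nat.cast_smul_eq_nsmul 𝕜]
          push_cast
          rfl
        · intro i hi
          have hi := Finset.mem_range.1 hi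
          rw [mul_right_comm, ← pow_add, mul_comm]
          congr 2
          omega
      rw [h2] at h1
      exact (P.smul_mem_iff (by exact_mod_cast m.succ_ne_zero)).1 h1
    | zero => simp
    | add x y _ _ hx hy => rw [mul_add]; exact P.add_mem hx hy
    | smul a x _ hx => rw [mul_smul_comm]; exact P.smul_mem a hx
  have hmul : ∀ x : SymmetricAlgebra 𝕜 V, ∀ y ∈ P, x * y ∈ P := by
    intro x
    induction x using SymmetricAlgebra.induction with
    | algebraMap r => intro y hy; rw [← Algebra.smul_def]; exact P.smul_mem r hy
    | ι v => exact hι v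
    | mul a b ha hb => intro y hy; rw [mul_assoc]; exact ha _ (hb _ hy)
    | add a b ha hb => intro y hy; rw [add_mul]; exact P.add_mem (ha _ hy) (hb _ hy)
  rw [eq_top_iff]
  intro x _
  simpa using hmul x 1 (Submodule.subset_span ⟨(0, 0), by simp⟩)

theorem linearMap_ext_pow [CharZero 𝕜] {M : Type*} [AddCommGroup M] [Module 𝕜 M]
    {f g : SymmetricAlgebra 𝕜 V →ₗ[𝕜] M}
    (h : ∀ (v : V) (k : ℕ), f (ι 𝕜 V v ^ k) = g (ι 𝕜 V v ^ k)) : f = g :=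
  LinearMap.ext_on_range span_pow fun p => h p.1 p.2

theorem linearMap_ext_dpow [CharZero 𝕜] {M : Type*} [AddCommGroup M] [Module 𝕜 M]
    {f g : SymmetricAlgebra 𝕜 V →ₗ[𝕜] M}
    (h : ∀ (v : V) (k : ℕ), f (dpow 𝕜 v k) = g (dpow 𝕜 v k)) : f = g :=
  linearMap_ext_pow fun v k => by rw [pow_eq_smul_dpow, map_smul, map_smul, h]

end Symmetric

/-! ### Symmetric tensors and the quotient model of the symmetric algebra. -/

section Symmetrizer

variable {𝕜 : Type*} [RCLike 𝕜] {V : Type*} [AddCommGroup V] [Module 𝕜 V]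

theorem tensorAlgebra_ext {M : Type*} [AddCommGroup M] [Module 𝕜 M]
    {f g : TensorAlgebra 𝕜 V →ₗ[𝕜] M}
    (h : ∀ (n : ℕ) (v : Fin n → V), f (TensorAlgebra.tprod 𝕜 V n v) =
      g (TensorAlgebra.tprod 𝕜 V n v)) : f = g := by
  have : f ∘ₗ (TensorAlgebra.equivDirectSum (R := 𝕜) (M := V)).symm.toLinearMap =
      g ∘ₗ (TensorAlgebra.equivDirectSum (R := 𝕜) (M := V)).symm.toLinearMap := by
    refine DirectSum.linearMap_ext _ fun n => PiTensorProduct.ext ?_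
    ext v
    simpa [DirectSum.lof_eq_of, -TensorAlgebra.tprod_apply] using h n v
  ext x
  simpa using congr($this (TensorAlgebra.equivDirectSum x))

theorem equivDirectSum_tprod {n : ℕ} (v : Fin n → V) :
    TensorAlgebra.equivDirectSum (TensorAlgebra.tprod 𝕜 V n v) =
      DirectSum.of (fun n => ⨂[𝕜]^n V) n (PiTensorProduct.tprod 𝕜 v) := by
  simpa [-TensorAlgebra.tprod_apply] using TensorAlgebra.toDirectSum_tensorPower_tprod v

theorem component_tprod_self {n : ℕ} (v : Fin n → V) :
    component 𝕜 V n (TensorAlgebra.tprod 𝕜 V n v) = PiTensorProduct.tprod 𝕜 v := by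
  simp only [component, LinearMap.comp_apply, AlgEquiv.toLinearMap_apply, equivDirectSum_tprod,
    ← DirectSum.lof_eq_of 𝕜]
  exact DirectSum.component.lof_self ..

theorem component_tprod_of_ne {n m : ℕ} (h : n ≠ m) (v : Fin n → V) :
    component 𝕜 V m (TensorAlgebra.tprod 𝕜 V n v) = 0 := by
  simp only [component, LinearMap.comp_apply, AlgEquiv.toLinearMap_apply, equivDirectSum_tprod,
    ← DirectSum.lof_eq_of 𝕜, DirectSum.component.of, dif_neg h]

theorem symmetrizer_tprod {n : ℕ} (v : Fin n → V) :
    symmetrizer 𝕜 V (TensorAlgebra.tprod 𝕜 V n v) =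
      ((n ! : ℕ) : 𝕜)⁻¹ • ∑ σ : Equiv.Perm (Fin n), TensorAlgebra.tprod 𝕜 V n (v ∘ σ) := by
  simp only [symmetrizer, LinearMap.comp_apply, AlgEquiv.toLinearMap_apply, equivDirectSum_tprod,
    ← DirectSum.lof_eq_of 𝕜, DirectSum.lmap_lof, symmetrizerPower, LinearMap.smul_apply,
    LinearMap.sum_apply, LinearEquiv.coe_coe, PiTensorProduct.reindex_tprod, map_smul, map_sum]
  congr 1
  refine Fintype.sum_equiv (Equiv.inv _) _ _ fun σ => ?_
  simp [DirectSum.lof_eq_of, -TensorAlgebra.tprod_apply]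
  rfl

theorem symmetrizer_tprod_comp {n : ℕ} (v : Fin n → V) (τ : Equiv.Perm (Fin n)) :
    symmetrizer 𝕜 V (TensorAlgebra.tprod 𝕜 V n (v ∘ τ)) =
      symmetrizer 𝕜 V (TensorAlgebra.tprod 𝕜 V n v) := by
  rw [symmetrizer_tprod, symmetrizer_tprod]
  congr 1
  exact Fintype.sum_equiv (Equiv.mulLeft τ) _ _ fun σ => rfl

theorem symmetrizer_symmetrizer (x : TensorAlgebra 𝕜 V) :
    symmetrizer 𝕜 V (symmetrizer 𝕜 V x) = symmetrizer 𝕜 V x := by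
  have : symmetrizer 𝕜 V ∘ₗ symmetrizer 𝕜 V = symmetrizer 𝕜 V := by
    refine tensorAlgebra_ext fun n v => ?_
    rw [LinearMap.comp_apply]
    conv_lhs => rw [symmetrizer_tprod, map_smul, map_sum]
    simp only [symmetrizer_tprod_comp]
    rw [Finset.sum_const, Finset.card_univ, Fintype.card_perm, Fintype.card_fin,
      ← Nat.cast_smul_eq_nsmul 𝕜, smul_smul,
      inv_mul_cancel₀ (Nat.cast_ne_zero.2 n.factorial_ne_zero), one_smul]
  exact congr($this x)

theorem sym_coe (x : SymAlg 𝕜 V) : sym 𝕜 V x = x := by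
  obtain ⟨_, y, rfl⟩ := x
  exact Subtype.ext (symmetrizer_symmetrizer y)

theorem symmetrizer_list_perm {l l' : List V} (h : l.Perm l') :
    symmetrizer 𝕜 V (l.map (TensorAlgebra.ι 𝕜)).prod =
      symmetrizer 𝕜 V (l'.map (TensorAlgebra.ι 𝕜)).prod := by
  obtain ⟨n, v, rfl⟩ : ∃ (n : ℕ) (v : Fin n → V), l = List.ofFn v :=
    ⟨l.length, l.get, (List.ofFn_get l).symm⟩
  obtain ⟨w, rfl⟩ : ∃ w : Fin n → V, l' = List.ofFn w := by
    have hn : n = l'.length := by rw [← h.length_eq, List.length_ofFn]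
    subst hn
    exact ⟨l'.get, (List.ofFn_get l').symm⟩
  -- Sorting both tuples for an auxiliary well-order gives the same tuple; the permutation compares
  -- the two sortings.
  obtain ⟨σ, hσ⟩ : ∃ σ : Equiv.Perm (Fin n), List.ofFn w = List.ofFn (v ∘ σ) := by
    let : LinearOrder V := IsWellOrder.linearOrder WellOrderingRel
    refine ⟨(Tuple.sort w)⁻¹.trans (Tuple.sort v), ?_⟩
    have h1 : v ∘ Tuple.sort v = w ∘ Tuple.sort w :=
      List.ofFn_injective ((((Tuple.sort v).ofFn_comp_perm v).trans
        (h.trans ((Tuple.sort w).ofFn_comp_perm w).symm)).eq_of_pairwise'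
          (Tuple.monotone_sort v).sortedLE_ofFn.pairwise
          (Tuple.monotone_sort w).sortedLE_ofFn.pairwise)
    congr 1
    ext i
    have := congrFun h1 ((Tuple.sort w)⁻¹ i)
    simpa using this.symm
  rw [hσ, List.map_ofFn, List.map_ofFn]
  have := symmetrizer_tprod_comp (𝕜 := 𝕜) v σ
  rw [TensorAlgebra.tprod_apply, TensorAlgebra.tprod_apply] at this
  exact this.symm

theorem algHom_tprod {n : ℕ} (v : Fin n → V) :
    SymmetricAlgebra.algHom 𝕜 V (TensorAlgebra.tprod 𝕜 V n v) =
      ∏ i, SymmetricAlgebra.ι 𝕜 V (v i) := by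
  rw [TensorAlgebra.tprod_apply, map_list_prod, List.map_ofFn, List.prod_ofFn]
  rfl

theorem algHom_symmetrizer (x : TensorAlgebra 𝕜 V) :
    SymmetricAlgebra.algHom 𝕜 V (symmetrizer 𝕜 V x) = SymmetricAlgebra.algHom 𝕜 V x := by
  have : (SymmetricAlgebra.algHom 𝕜 V).toLinearMap ∘ₗ symmetrizer 𝕜 V =
      (SymmetricAlgebra.algHom 𝕜 V).toLinearMap := by
    refine tensorAlgebra_ext fun n v => ?_
    rw [LinearMap.comp_apply, symmetrizer_tprod, map_smul, map_sum]
    simp only [AlgHom.toLinearMap_apply, algHom_tprod]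
    have : ∀ σ : Equiv.Perm (Fin n), ∏ i, SymmetricAlgebra.ι 𝕜 V ((v ∘ σ) i) =
        ∏ i, SymmetricAlgebra.ι 𝕜 V (v i) := fun σ =>
      Equiv.prod_comp σ fun i => SymmetricAlgebra.ι 𝕜 V (v i)
    rw [Finset.sum_congr rfl fun σ _ => this σ, Finset.sum_const, Finset.card_univ,
      Fintype.card_perm, Fintype.card_fin,
      ← Nat.cast_smul_eq_nsmul 𝕜, smul_smul,
      inv_mul_cancel₀ (Nat.cast_ne_zero.2 n.factorial_ne_zero), one_smul]
  exact congr($this x)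

theorem symmetrizer_mul_swap (x y : TensorAlgebra 𝕜 V) (v w : V) :
    symmetrizer 𝕜 V (x * (TensorAlgebra.ι 𝕜 v * TensorAlgebra.ι 𝕜 w) * y) =
      symmetrizer 𝕜 V (x * (TensorAlgebra.ι 𝕜 w * TensorAlgebra.ι 𝕜 v) * y) := by
  let F (v w : V) : TensorAlgebra 𝕜 V →ₗ[𝕜] TensorAlgebra 𝕜 V →ₗ[𝕜] TensorAlgebra 𝕜 V :=
    ((LinearMap.mul 𝕜 _).compr₂ (symmetrizer 𝕜 V)) ∘ₗ
      LinearMap.mulRight 𝕜 (TensorAlgebra.ι 𝕜 v * TensorAlgebra.ι 𝕜 w)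
  suffices h : F v w = F w v from congr($h x y)
  refine tensorAlgebra_ext fun n a => tensorAlgebra_ext fun m b => ?_
  change symmetrizer 𝕜 V _ = symmetrizer 𝕜 V _
  simp only [LinearMap.mulRight_apply, TensorAlgebra.tprod_apply]
  have hl : ∀ (n : ℕ) (a : Fin n → V), List.ofFn (fun i => TensorAlgebra.ι 𝕜 (a i)) =
      (List.ofFn a).map (TensorAlgebra.ι 𝕜) := fun n a => by rw [List.map_ofFn]; rfl
  rw [hl, hl]
  have := symmetrizer_list_perm (𝕜 := 𝕜) (l := List.ofFn a ++ [v, w] ++ List.ofFn b)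
    (l' := List.ofFn a ++ [w, v] ++ List.ofFn b)
    ((List.Perm.append_left _ (List.Perm.swap _ _ _)).append_right _)
  simpa [mul_assoc] using this

/-- Being indistinguishable by the symmetrizer inside every product `x * _ * y` is a ring
congruence. It contains the generators `v w ~ w v`, hence the whole congruence that defines the
quotient. -/
theorem symmetrizer_eq_of_algHom_eq {x y : TensorAlgebra 𝕜 V}
    (h : SymmetricAlgebra.algHom 𝕜 V x = SymmetricAlgebra.algHom 𝕜 V y) :
    symmetrizer 𝕜 V x = symmetrizer 𝕜 V y := by
  let c : RingCon (TensorAlgebra 𝕜 V) :=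
    { r := fun a b => ∀ x y, symmetrizer 𝕜 V (x * a * y) = symmetrizer 𝕜 V (x * b * y)
      iseqv := ⟨fun _ _ _ => rfl, fun h x y => (h x y).symm, fun h h' x y =>
        (h x y).trans (h' x y)⟩
      add' := fun h h' x y => by simp only [mul_add, add_mul, map_add, h x y, h' x y]
      mul' := fun {a b c d} h h' x y => by
        have h1 := h x (c * y)
        have h2 := h' (x * b) y
        simp only [mul_assoc] at h1 h2 ⊢
        rw [h1, h2] }
  have hle : TensorAlgebra.symRingCon 𝕜 V ≤ c := by
    unfold TensorAlgebra.symRingCon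
    refine RingCon.ringConGen_le.2 fun a b hab => ?_
    obtain ⟨v, w⟩ := hab
    exact fun x y => symmetrizer_mul_swap x y v w
  have := hle ((RingCon.eq _).1 h) 1 1
  simpa using this

variable (𝕜 V) in
/-- The symmetric algebra as a quotient is isomorphic to the space of symmetric tensors. -/
def symEquiv : SymmetricAlgebra 𝕜 V ≃ₗ[𝕜] SymAlg 𝕜 V :=
  (LinearEquiv.ofBijective ((SymmetricAlgebra.algHom 𝕜 V).toLinearMap ∘ₗ (SymAlg 𝕜 V).subtype)
    ⟨fun x y h => by
      have := symmetrizer_eq_of_algHom_eq (x := (x : TensorAlgebra 𝕜 V)) (y := y) h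
      rw [← sym_coe x, ← sym_coe y]
      exact Subtype.ext this,
    fun x => by
      obtain ⟨t, rfl⟩ := SymmetricAlgebra.algHom_surjective 𝕜 V x
      exact ⟨sym 𝕜 V t, algHom_symmetrizer t⟩⟩).symm

theorem symEquiv_symm_apply (x : SymAlg 𝕜 V) :
    (symEquiv 𝕜 V).symm x = SymmetricAlgebra.algHom 𝕜 V x := rfl

theorem symEquiv_algHom (t : TensorAlgebra 𝕜 V) :
    symEquiv 𝕜 V (SymmetricAlgebra.algHom 𝕜 V t) = sym 𝕜 V t := by
  rw [← LinearEquiv.eq_symm_apply, symEquiv_symm_apply]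
  exact (algHom_symmetrizer t).symm

theorem symmetrizer_ι_pow (v : V) (n : ℕ) :
    symmetrizer 𝕜 V (TensorAlgebra.ι 𝕜 v ^ n) = TensorAlgebra.ι 𝕜 v ^ n := by
  have h : TensorAlgebra.ι 𝕜 v ^ n = TensorAlgebra.tprod 𝕜 V n fun _ => v := by
    simp [TensorAlgebra.tprod_apply]
  have h1 : ∀ σ : Equiv.Perm (Fin n), (fun _ => v) ∘ σ = fun _ => v := fun σ => rfl
  simp only [h, symmetrizer_tprod, h1]
  rw [Finset.sum_const, Finset.card_univ, Fintype.card_perm, Fintype.card_fin,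
      ← Nat.cast_smul_eq_nsmul 𝕜, smul_smul,
      inv_mul_cancel₀ (Nat.cast_ne_zero.2 n.factorial_ne_zero), one_smul]

theorem coe_symEquiv_pow (v : V) (n : ℕ) :
    (symEquiv 𝕜 V (SymmetricAlgebra.ι 𝕜 V v ^ n) : TensorAlgebra 𝕜 V) =
      TensorAlgebra.ι 𝕜 v ^ n := by
  have : SymmetricAlgebra.ι 𝕜 V v ^ n =
      SymmetricAlgebra.algHom 𝕜 V (TensorAlgebra.ι 𝕜 v ^ n) := by
    rw [map_pow]; rfl
  rw [this, symEquiv_algHom]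
  exact symmetrizer_ι_pow v n

theorem sym_ι_pow (v : V) (n : ℕ) :
    sym 𝕜 V (TensorAlgebra.ι 𝕜 v ^ n) = symEquiv 𝕜 V (SymmetricAlgebra.ι 𝕜 V v ^ n) :=
  Subtype.ext ((symmetrizer_ι_pow v n).trans (coe_symEquiv_pow v n).symm)

theorem symAlg_ext {M : Type*} [AddCommGroup M] [Module 𝕜 M] {f g : SymAlg 𝕜 V →ₗ[𝕜] M}
    (h : ∀ (v : V) (k : ℕ), f (symEquiv 𝕜 V (SymmetricAlgebra.ι 𝕜 V v ^ k)) =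
      g (symEquiv 𝕜 V (SymmetricAlgebra.ι 𝕜 V v ^ k))) : f = g := by
  have : f ∘ₗ (symEquiv 𝕜 V).toLinearMap = g ∘ₗ (symEquiv 𝕜 V).toLinearMap :=
    linearMap_ext_pow h
  ext x
  simpa using congr($this ((symEquiv 𝕜 V).symm x))

end Symmetrizer

/-! ### Bernoulli numbers and the identity behind the commutation relations. -/

section Bernoulli

variable (𝕜 : Type*) [Field 𝕜] [CharZero 𝕜]

/-- The Taylor coefficients `Bᵣ / r!` of `x / (exp x - 1)`. -/
def bern (r : ℕ) : 𝕜 := algebraMap ℚ 𝕜 (bernoulli r / (r ! : ℕ))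

/-- The series `∑ᵣ Bᵣ / r! xʳ Xʳ`. -/
def bernSeries {R : Type*} [CommRing R] [Algebra 𝕜 R] (x : R) : PowerSeries R :=
  PowerSeries.mk fun r => algebraMap 𝕜 R (bern 𝕜 r) * x ^ r

theorem bernSeries_mul {R : Type*} [CommRing R] [Algebra 𝕜 R] [Algebra ℚ R] (x : R) :
    bernSeries 𝕜 x * (PowerSeries.rescale x (PowerSeries.exp R) - 1) =
      PowerSeries.C x * PowerSeries.X := by
  have h := congrArg (PowerSeries.rescale x) (bernoulliPowerSeries_mul_exp_sub_one R)
  rw [map_mul, map_sub, map_one, PowerSeries.rescale_X] at h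
  rw [← h]
  congr 1
  ext r
  simp only [bernSeries, bernoulliPowerSeries, PowerSeries.coeff_mk, PowerSeries.coeff_rescale, bern]
  have : IsScalarTower ℚ 𝕜 R := inferInstance
  rw [← IsScalarTower.algebraMap_apply ℚ 𝕜 R, mul_comm]

theorem bern_zero : bern 𝕜 0 = 1 := by simp [bern]

/-- The defining recursion of the Bernoulli numbers. -/
theorem sum_bern_div (n : ℕ) :
    ∑ p ∈ antidiagonal n, bern 𝕜 p.1 * (((p.2 + 1) ! : ℕ) : 𝕜)⁻¹ = if n = 0 then 1 else 0 := by
  have h := congrArg (PowerSeries.coeff (n + 1)) (bernSeries_mul 𝕜 (1 : 𝕜))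
  rw [PowerSeries.coeff_mul, Finset.Nat.sum_antidiagonal_succ'] at h
  simp only [map_one, one_mul, PowerSeries.coeff_X, map_sub, PowerSeries.coeff_rescale, one_pow,
    PowerSeries.coeff_exp, bernSeries, PowerSeries.coeff_mk, mul_one, PowerSeries.coeff_one,
    Algebra.algebraMap_self, RingHom.id_apply] at h
  simpa using h

open MvPolynomial in
-- With `b(x) = x X / (exp (x X) - 1)`, this is the coefficient of `X ^ (n + 1)` in `t b(s) (b(s+t)
-- - b(t)) + s b(t) (b(s+t) - b(s)) = - s t X b(s+t)`, divided by `s t`. The geometric sums are the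
-- divided differences of `r`-th powers.
theorem bern_polynomial_identity (n : ℕ) :
    ∑ p ∈ antidiagonal (n + 1), C (bern 𝕜 p.1 * bern 𝕜 p.2) *
        ((X 0 : MvPolynomial (Fin 2) 𝕜) ^ p.1 *
          (∑ i ∈ Finset.range p.2, (X 0 + X 1) ^ i * X 1 ^ (p.2 - 1 - i)) +
        X 1 ^ p.1 * (∑ i ∈ Finset.range p.2, (X 0 + X 1) ^ i * X 0 ^ (p.2 - 1 - i))) =
      - (C (bern 𝕜 n) * (X 0 + X 1) ^ n) := by
  set s : MvPolynomial (Fin 2) 𝕜 := X 0 with hs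
  set t : MvPolynomial (Fin 2) 𝕜 := X 1 with ht
  have hs0 : s ≠ 0 := X_ne_zero 0
  have ht0 : t ≠ 0 := X_ne_zero 1
  have hst0 : s + t ≠ 0 := by
    intro h
    have := congrArg (MvPolynomial.eval (fun _ => (1 : 𝕜))) h
    simp [hs, ht] at this
  have he : ∀ x : MvPolynomial (Fin 2) 𝕜, x ≠ 0 →
      PowerSeries.rescale x (PowerSeries.exp (MvPolynomial (Fin 2) 𝕜)) - 1 ≠ 0 := by
    intro x hx h
    have := congrArg (PowerSeries.coeff 1) h
    simp [PowerSeries.coeff_one] at this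
    exact hx this
  have key : PowerSeries.C t * (bernSeries 𝕜 s * (bernSeries 𝕜 (s + t) - bernSeries 𝕜 t)) +
      PowerSeries.C s * (bernSeries 𝕜 t * (bernSeries 𝕜 (s + t) - bernSeries 𝕜 s)) =
      -(PowerSeries.C (s * t) * bernSeries 𝕜 (s + t) * PowerSeries.X) := by
    have h1 := bernSeries_mul 𝕜 s
    have h2 := bernSeries_mul 𝕜 t
    have h3 := bernSeries_mul 𝕜 (s + t)
    have e1 := he s hs0
    have e2 := he t ht0
    have e3 := he (s + t) hst0
    rw [← PowerSeries.exp_mul_exp_eq_exp_add] at h3 e3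
    generalize PowerSeries.rescale s (PowerSeries.exp (MvPolynomial (Fin 2) 𝕜)) = es at *
    generalize PowerSeries.rescale t (PowerSeries.exp (MvPolynomial (Fin 2) 𝕜)) = et at *
    generalize bernSeries 𝕜 s = bs at *
    generalize bernSeries 𝕜 t = bt at *
    generalize bernSeries 𝕜 (s + t) = bst at *
    rw [map_add] at h3
    rw [map_mul]
    generalize PowerSeries.C s = cs at *
    generalize PowerSeries.C t = ct at *
    -- After multiplication by the three nonzero denominators, the claim is a consequence of the
    -- relations `b(x) (exp (x X) - 1) = x X` and of `exp ((s+t) X) = exp (s X) exp (t X)`.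
    refine mul_right_cancel₀ (mul_ne_zero (mul_ne_zero e1 e2) e3) ?_
    have a1 : bs * (es - 1) * (bst * (es * et - 1)) = cs * PowerSeries.X * ((cs + ct) * PowerSeries.X) := by
      rw [h1, h3]
    have a2 : bs * (es - 1) * (bt * (et - 1)) = cs * PowerSeries.X * (ct * PowerSeries.X) := by
      rw [h1, h2]
    have a3 : bt * (et - 1) * (bst * (es * et - 1)) = ct * PowerSeries.X * ((cs + ct) * PowerSeries.X) := by
      rw [h2, h3]
    linear_combination ct * (et - 1) * a1 - (cs + ct) * (es * et - 1) * a2 + cs * (es - 1) * a3 +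
      cs * ct * PowerSeries.X * (es - 1) * (et - 1) * h3
  have hc := congrArg (PowerSeries.coeff (n + 1)) key
  have hgeom : ∀ (x : MvPolynomial (Fin 2) 𝕜) (r : ℕ),
      PowerSeries.coeff r (bernSeries 𝕜 (s + t) - bernSeries 𝕜 x) = C (bern 𝕜 r) *
        ((∑ i ∈ Finset.range r, (s + t) ^ i * x ^ (r - 1 - i)) * (s + t - x)) := by
    intro x r
    rw [(Commute.all _ _).geom_sum₂_mul, mul_sub, map_sub]
    simp only [bernSeries, PowerSeries.coeff_mk, MvPolynomial.algebraMap_eq]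
  refine mul_left_cancel₀ (mul_ne_zero hs0 ht0) ?_
  rw [map_add, map_neg, PowerSeries.coeff_C_mul, PowerSeries.coeff_C_mul, PowerSeries.coeff_mul,
    PowerSeries.coeff_mul, PowerSeries.coeff_succ_mul_X, PowerSeries.coeff_C_mul] at hc
  simp only [hgeom] at hc
  simp only [bernSeries, PowerSeries.coeff_mk, MvPolynomial.algebraMap_eq, add_sub_cancel_left,
    add_sub_cancel_right] at hc
  trans ∑ p ∈ antidiagonal (n + 1), t * (C (bern 𝕜 p.1) * s ^ p.1 * (C (bern 𝕜 p.2) *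
      ((∑ i ∈ Finset.range p.2, (s + t) ^ i * t ^ (p.2 - 1 - i)) * s))) +
    ∑ p ∈ antidiagonal (n + 1), s * (C (bern 𝕜 p.1) * t ^ p.1 * (C (bern 𝕜 p.2) *
      ((∑ i ∈ Finset.range p.2, (s + t) ^ i * s ^ (p.2 - 1 - i)) * t)))
  · rw [Finset.mul_sum, ← Finset.sum_add_distrib]
    refine Finset.sum_congr rfl fun p _ => ?_
    rw [C_mul]
    ring
  · rw [← Finset.mul_sum, ← Finset.mul_sum, hc]
    ring

end Bernoulli

/-! ### Left multiplication by Lie algebra elements through Bernoulli numbers. -/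

section LeftMul

open SymmetricAlgebra

variable (𝕜 : Type*) [Field 𝕜] (𝔤 : Type*) [LieRing 𝔤] [LieAlgebra 𝕜 𝔤]

/-- The linear map `a ↦ (v ↦ [v, a])`. -/
def bracketRight : 𝔤 →ₗ[𝕜] 𝔤 →ₗ[𝕜] 𝔤 :=
  LinearMap.mk₂ 𝕜 (fun a v => ⁅v, a⁆) (fun _ _ _ => lie_add _ _ _) (fun _ _ _ => lie_smul _ _ _)
    (fun _ _ _ => add_lie _ _ _) (fun _ _ _ => smul_lie _ _ _)

/-- The map `v₁ ⋯ vₙ ⊗ a ↦ ∑ᵢ (v₁ ⋯ v̂ᵢ ⋯ vₙ) ⊗ [vᵢ, a]`. -/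
def contract : SymmetricAlgebra 𝕜 𝔤 ⊗[𝕜] 𝔤 →ₗ[𝕜] SymmetricAlgebra 𝕜 𝔤 ⊗[𝕜] 𝔤 :=
  TensorProduct.lift (LinearMap.mk₂ 𝕜
    (fun x a => (bracketRight 𝕜 𝔤 a).baseChange (SymmetricAlgebra 𝕜 𝔤)
      (univDeriv 𝕜 𝔤 x))
    (fun x y a => by simp only [map_add])
    (fun c x a => by rw [Derivation.map_smul, LinearMap.map_smul_of_tower])
    (fun x a b => by rw [map_add, LinearMap.baseChange_add, LinearMap.add_apply])
    (fun c x a => by rw [map_smul, LinearMap.baseChange_smul, LinearMap.smul_apply]))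

/-- The map `x ⊗ a ↦ x a` of the symmetric algebra. -/
def mulι : SymmetricAlgebra 𝕜 𝔤 ⊗[𝕜] 𝔤 →ₗ[𝕜] SymmetricAlgebra 𝕜 𝔤 :=
  LinearMap.mul' 𝕜 _ ∘ₗ (ι 𝕜 𝔤).lTensor (SymmetricAlgebra 𝕜 𝔤)

variable {𝕜 𝔤}

theorem bracketRight_apply (a v : 𝔤) : bracketRight 𝕜 𝔤 a v = ⁅v, a⁆ := rfl

theorem mulι_tmul (x : SymmetricAlgebra 𝕜 𝔤) (a : 𝔤) : mulι 𝕜 𝔤 (x ⊗ₜ a) = x * ι 𝕜 𝔤 a := rfl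

theorem contract_tmul (x : SymmetricAlgebra 𝕜 𝔤) (a : 𝔤) : contract 𝕜 𝔤 (x ⊗ₜ a) =
    (bracketRight 𝕜 𝔤 a).baseChange (SymmetricAlgebra 𝕜 𝔤)
      (univDeriv 𝕜 𝔤 x) := rfl

theorem contract_one_tmul (a : 𝔤) : contract 𝕜 𝔤 (1 ⊗ₜ a) = 0 := by
  rw [contract_tmul, Derivation.map_one_eq_zero, map_zero]

theorem contract_ι_mul_tmul (v : 𝔤) (x : SymmetricAlgebra 𝕜 𝔤) (a : 𝔤) :
    contract 𝕜 𝔤 ((ι 𝕜 𝔤 v * x) ⊗ₜ a) = x ⊗ₜ ⁅v, a⁆ + ι 𝕜 𝔤 v • contract 𝕜 𝔤 (x ⊗ₜ a) := by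
  simp [contract_tmul, bracketRight_apply, univDeriv_ι, TensorProduct.smul_tmul', add_comm]

theorem contract_dpow [CharZero 𝕜] (η a : 𝔤) (k : ℤ) :
    contract 𝕜 𝔤 (dpow 𝕜 η k ⊗ₜ a) = dpow 𝕜 η (k - 1) ⊗ₜ ⁅η, a⁆ := by
  simp [contract_tmul, bracketRight_apply, univDeriv_dpow]

theorem contract_pow_dpow [CharZero 𝕜] (η a : 𝔤) (k : ℤ) (r : ℕ) :
    (contract 𝕜 𝔤 ^ r) (dpow 𝕜 η k ⊗ₜ a) = dpow 𝕜 η (k - r) ⊗ₜ (LieAlgebra.ad 𝕜 𝔤 η ^ r) a := by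
  induction r generalizing k a with
  | zero => simp
  | succ r ih =>
    rw [pow_succ, Module.End.mul_apply, contract_dpow, ih, pow_succ, Module.End.mul_apply,
      LieAlgebra.ad_apply]
    congr 2
    push_cast
    ring

/-- Each contraction hits a factor `η` or the factor `v`, and `v` at most once. The index `i` counts
the contractions with `η` that come after the one with `v`; in the last term `v` survives. -/
theorem contract_pow_ι_mul_dpow [CharZero 𝕜] (η v a : 𝔤) (k : ℤ) (r : ℕ) :
    (contract 𝕜 𝔤 ^ r) ((ι 𝕜 𝔤 v * dpow 𝕜 η k) ⊗ₜ a) =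
      dpow 𝕜 η (k + 1 - r) ⊗ₜ (∑ i ∈ Finset.range r,
        (LieAlgebra.ad 𝕜 𝔤 η ^ i) ⁅v, (LieAlgebra.ad 𝕜 𝔤 η ^ (r - 1 - i)) a⁆) +
      (ι 𝕜 𝔤 v * dpow 𝕜 η (k - r)) ⊗ₜ (LieAlgebra.ad 𝕜 𝔤 η ^ r) a := by
  induction r generalizing k a with
  | zero => simp
  | succ r ih =>
    rw [pow_succ, Module.End.mul_apply, contract_ι_mul_tmul, contract_dpow, map_add,
      contract_pow_dpow, TensorProduct.smul_tmul', smul_eq_mul, ih, Finset.sum_range_succ,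
      TensorProduct.tmul_add]
    have h1 : ∑ i ∈ Finset.range r, (LieAlgebra.ad 𝕜 𝔤 η ^ i)
        ⁅v, (LieAlgebra.ad 𝕜 𝔤 η ^ (r - 1 - i)) ⁅η, a⁆⁆ = ∑ i ∈ Finset.range r,
        (LieAlgebra.ad 𝕜 𝔤 η ^ i) ⁅v, (LieAlgebra.ad 𝕜 𝔤 η ^ (r + 1 - 1 - i)) a⁆ := by
      refine Finset.sum_congr rfl fun i hi => ?_
      have hi := Finset.mem_range.1 hi
      rw [show r + 1 - 1 - i = (r - 1 - i) + 1 by omega, pow_succ, Module.End.mul_apply,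
        LieAlgebra.ad_apply]
    rw [h1, pow_succ _ r, Module.End.mul_apply, LieAlgebra.ad_apply,
      show k - 1 + 1 - (r : ℤ) = k + 1 - (r + 1 : ℕ) by push_cast; ring,
      show k - 1 - (r : ℤ) = k - (r + 1 : ℕ) by push_cast; ring,
      show k + 1 - ((r + 1 : ℕ) : ℤ) = k - r by push_cast; ring]
    simp only [Nat.add_sub_cancel, Nat.sub_self, pow_zero, Module.End.one_apply]
    abel

/-- Each contraction removes a symmetric factor, so `contract` is locally nilpotent. This makes the
`finsum` in `leftMulAux` finite and hence linear. -/
theorem exists_contract_pow_eq_zero [CharZero 𝕜] (t : SymmetricAlgebra 𝕜 𝔤 ⊗[𝕜] 𝔤) :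
    ∃ M : ℕ, ∀ r, M ≤ r → (contract 𝕜 𝔤 ^ r) t = 0 := by
  have hadd : ∀ s t : SymmetricAlgebra 𝕜 𝔤 ⊗[𝕜] 𝔤,
      (∃ M : ℕ, ∀ r, M ≤ r → (contract 𝕜 𝔤 ^ r) s = 0) →
      (∃ M : ℕ, ∀ r, M ≤ r → (contract 𝕜 𝔤 ^ r) t = 0) →
      ∃ M : ℕ, ∀ r, M ≤ r → (contract 𝕜 𝔤 ^ r) (s + t) = 0 := by
    rintro s t ⟨M, hM⟩ ⟨M', hM'⟩
    exact ⟨max M M', fun r hr => by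
      rw [map_add, hM r (le_of_max_le_left hr), hM' r (le_of_max_le_right hr), add_zero]⟩
  induction t using TensorProduct.induction_on with
  | zero => exact ⟨0, fun r _ => map_zero _⟩
  | add s t hs ht => exact hadd s t hs ht
  | tmul x a =>
    have hx : x ∈ Submodule.span 𝕜 (Set.range fun p : 𝔤 × ℕ => ι 𝕜 𝔤 p.1 ^ p.2) := by
      rw [span_pow]; trivial
    induction hx using Submodule.span_induction with
    | mem x hx =>
      obtain ⟨⟨η, k⟩, rfl⟩ := hx
      refine ⟨k + 1, fun r hr => ?_⟩
      dsimp only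
      rw [pow_eq_smul_dpow, ← TensorProduct.smul_tmul', map_smul, contract_pow_dpow,
        dpow_of_neg _ (by omega), TensorProduct.zero_tmul, smul_zero]
    | zero => exact ⟨0, fun r _ => by rw [TensorProduct.zero_tmul, map_zero]⟩
    | add x y _ _ hx hy => rw [TensorProduct.add_tmul]; exact hadd _ _ hx hy
    | smul c x _ hx =>
      obtain ⟨M, hM⟩ := hx
      exact ⟨M, fun r hr => by rw [← TensorProduct.smul_tmul', map_smul, hM r hr, smul_zero]⟩

theorem finite_support_contract [CharZero 𝕜] (z : 𝕜) (t : SymmetricAlgebra 𝕜 𝔤 ⊗[𝕜] 𝔤) :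
    (Function.support fun r : ℕ => (bern 𝕜 r * z ^ r) • mulι 𝕜 𝔤 ((contract 𝕜 𝔤 ^ r) t)).Finite := by
  obtain ⟨M, hM⟩ := exists_contract_pow_eq_zero t
  refine (Finset.range M).finite_toSet.subset fun r hr => ?_
  by_contra h
  refine hr ?_
  dsimp only
  rw [hM r (by simpa using h), map_zero, smul_zero]

variable (𝔤) in
/-- The map `x ⊗ ξ ↦ ξ ⋆_z x`. -/
def leftMulAux [CharZero 𝕜] (z : 𝕜) : SymmetricAlgebra 𝕜 𝔤 ⊗[𝕜] 𝔤 →ₗ[𝕜] SymmetricAlgebra 𝕜 𝔤 where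
  toFun t := ∑ᶠ r : ℕ, (bern 𝕜 r * z ^ r) • mulι 𝕜 𝔤 ((contract 𝕜 𝔤 ^ r) t)
  map_add' s t := by
    rw [← finsum_add_distrib (finite_support_contract z s) (finite_support_contract z t)]
    simp only [map_add, smul_add]
  map_smul' c t := by
    rw [RingHom.id_apply, smul_finsum' _ (finite_support_contract z t)]
    simp only [map_smul, smul_comm c]

variable (𝔤) in
/-- Left multiplication `ξ ⋆_z x = ∑ᵣ zʳ Bᵣ / r! ∑ [v_{i₁}, …, [v_{iᵣ}, ξ]] ∏_{j ≠ i₁, …, iᵣ} v_j`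
with elements of the Lie algebra, where `x = v₁ ⋯ vₙ`. -/
def leftMul [CharZero 𝕜] (z : 𝕜) : 𝔤 →ₗ[𝕜] Module.End 𝕜 (SymmetricAlgebra 𝕜 𝔤) :=
  ((TensorProduct.mk 𝕜 (SymmetricAlgebra 𝕜 𝔤) 𝔤).compr₂ (leftMulAux 𝔤 z)).flip

theorem leftMul_apply_eq_sum [CharZero 𝕜] (z : 𝕜) (ξ : 𝔤) (x : SymmetricAlgebra 𝕜 𝔤) (M : ℕ)
    (hM : ∀ r, M ≤ r → (contract 𝕜 𝔤 ^ r) (x ⊗ₜ ξ) = 0) :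
    leftMul 𝔤 z ξ x =
      ∑ r ∈ Finset.range M, (bern 𝕜 r * z ^ r) • mulι 𝕜 𝔤 ((contract 𝕜 𝔤 ^ r) (x ⊗ₜ ξ)) := by
  change ∑ᶠ r : ℕ, (bern 𝕜 r * z ^ r) • mulι 𝕜 𝔤 ((contract 𝕜 𝔤 ^ r) (x ⊗ₜ ξ)) = _
  refine finsum_eq_sum_of_support_subset _ fun r hr => ?_
  by_contra h
  refine hr ?_
  dsimp only
  rw [hM r (by simpa using h), map_zero, smul_zero]

theorem leftMul_dpow [CharZero 𝕜] (z : 𝕜) (ξ η : 𝔤) (k : ℤ) (M : ℕ) (hM : k < M) :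
    leftMul 𝔤 z ξ (dpow 𝕜 η k) = ∑ r ∈ Finset.range M, (bern 𝕜 r * z ^ r) •
      (dpow 𝕜 η (k - r) * ι 𝕜 𝔤 ((LieAlgebra.ad 𝕜 𝔤 η ^ r) ξ)) := by
  rw [leftMul_apply_eq_sum z ξ _ M fun r hr => ?_]
  · simp only [contract_pow_dpow, mulι_tmul]
  · rw [contract_pow_dpow, dpow_of_neg _ (by omega), TensorProduct.zero_tmul]

theorem leftMul_ι_mul_dpow [CharZero 𝕜] (z : 𝕜) (ζ v η : 𝔤) (k : ℤ) (M : ℕ) (hM : k + 1 < M) :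
    leftMul 𝔤 z ζ (ι 𝕜 𝔤 v * dpow 𝕜 η k) = ∑ r ∈ Finset.range M, (bern 𝕜 r * z ^ r) •
      (dpow 𝕜 η (k + 1 - r) * ι 𝕜 𝔤 (∑ i ∈ Finset.range r,
        (LieAlgebra.ad 𝕜 𝔤 η ^ i) ⁅v, (LieAlgebra.ad 𝕜 𝔤 η ^ (r - 1 - i)) ζ⁆) +
      ι 𝕜 𝔤 v * dpow 𝕜 η (k - r) * ι 𝕜 𝔤 ((LieAlgebra.ad 𝕜 𝔤 η ^ r) ζ)) := by
  rw [leftMul_apply_eq_sum z ζ _ M fun r hr => ?_]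
  · simp only [contract_pow_ι_mul_dpow, mulι_tmul, map_add]
  · rw [contract_pow_ι_mul_dpow, dpow_of_neg _ (by omega), dpow_of_neg _ (by omega), mul_zero,
      TensorProduct.zero_tmul, TensorProduct.zero_tmul, add_zero]

/-- Evaluation of polynomials in two variables at `ad η` acting on `ξ` and on `ζ`, inside
the bracket of `ξ` and `ζ`. -/
theorem exists_bracket_eval (η ξ ζ : 𝔤) : ∃ E : MvPolynomial (Fin 2) 𝕜 →ₗ[𝕜] 𝔤, ∀ i a b : ℕ,
    E ((MvPolynomial.X 0 + MvPolynomial.X 1) ^ i *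
        (MvPolynomial.X 0 ^ a * MvPolynomial.X 1 ^ b)) =
      (LieAlgebra.ad 𝕜 𝔤 η ^ i) ⁅(LieAlgebra.ad 𝕜 𝔤 η ^ a) ξ, (LieAlgebra.ad 𝕜 𝔤 η ^ b) ζ⁆ := by
  let E : MvPolynomial (Fin 2) 𝕜 →ₗ[𝕜] 𝔤 := (MvPolynomial.basisMonomials (Fin 2) 𝕜).constr 𝕜
    fun m => ⁅(LieAlgebra.ad 𝕜 𝔤 η ^ m 0) ξ, (LieAlgebra.ad 𝕜 𝔤 η ^ m 1) ζ⁆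
  have hE : ∀ m : Fin 2 →₀ ℕ, E (MvPolynomial.monomial m 1) =
      ⁅(LieAlgebra.ad 𝕜 𝔤 η ^ m 0) ξ, (LieAlgebra.ad 𝕜 𝔤 η ^ m 1) ζ⁆ := fun m => by
    have := (MvPolynomial.basisMonomials (Fin 2) 𝕜).constr_basis 𝕜
      (fun m => ⁅(LieAlgebra.ad 𝕜 𝔤 η ^ m 0) ξ, (LieAlgebra.ad 𝕜 𝔤 η ^ m 1) ζ⁆) m
    rwa [MvPolynomial.coe_basisMonomials] at this
  -- The sum of the variables acts as `ad η` on the whole bracket because `ad η` is a derivation.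
  have hmul : ∀ p, E ((MvPolynomial.X 0 + MvPolynomial.X 1) * p) = LieAlgebra.ad 𝕜 𝔤 η (E p) := by
    intro p
    have : E ∘ₗ LinearMap.mulLeft 𝕜 (MvPolynomial.X 0 + MvPolynomial.X 1) =
        LieAlgebra.ad 𝕜 𝔤 η ∘ₗ E := by
      refine MvPolynomial.basisMonomials (Fin 2) 𝕜 |>.ext fun m => ?_
      simp only [MvPolynomial.coe_basisMonomials, LinearMap.comp_apply, LinearMap.mulLeft_apply, hE,
        add_mul, map_add, MvPolynomial.X, MvPolynomial.monomial_mul, mul_one]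
      simp [pow_add, Module.End.mul_apply, add_comm]
    exact congr($this p)
  refine ⟨E, fun i a b => ?_⟩
  induction i with
  | zero =>
    rw [pow_zero, one_mul, pow_zero, Module.End.one_apply, MvPolynomial.X_pow_eq_monomial,
      MvPolynomial.X_pow_eq_monomial, MvPolynomial.monomial_mul, mul_one, hE]
    simp
  | succ i ih => rw [pow_succ', mul_assoc, hmul, ih, pow_succ', Module.End.mul_apply]

/-- This is `bern_polynomial_identity` with `X 0` read as `ad η` acting on `ξ` and `X 1` as `ad η`
acting on `ζ`. Antisymmetry of the bracket turns the plus sign between the two sums into a minus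
sign. -/
theorem sum_bern_bracket [CharZero 𝕜] (η ξ ζ : 𝔤) (n : ℕ) :
    ∑ p ∈ antidiagonal (n + 1), (bern 𝕜 p.1 * bern 𝕜 p.2) •
      (∑ i ∈ Finset.range p.2, (LieAlgebra.ad 𝕜 𝔤 η ^ i)
          ⁅(LieAlgebra.ad 𝕜 𝔤 η ^ p.1) ξ, (LieAlgebra.ad 𝕜 𝔤 η ^ (p.2 - 1 - i)) ζ⁆ -
        ∑ i ∈ Finset.range p.2, (LieAlgebra.ad 𝕜 𝔤 η ^ i)
          ⁅(LieAlgebra.ad 𝕜 𝔤 η ^ p.1) ζ, (LieAlgebra.ad 𝕜 𝔤 η ^ (p.2 - 1 - i)) ξ⁆) =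
      -(bern 𝕜 n • (LieAlgebra.ad 𝕜 𝔤 η ^ n) ⁅ξ, ζ⁆) := by
  obtain ⟨E, hE⟩ := exists_bracket_eval (𝕜 := 𝕜) η ξ ζ
  have h := congrArg E (bern_polynomial_identity 𝕜 n)
  rw [map_sum, map_neg, ← MvPolynomial.smul_eq_C_mul, map_smul] at h
  have h0 := hE n 0 0
  simp only [pow_zero, mul_one, Module.End.one_apply] at h0
  rw [h0] at h
  rw [← h]
  refine Finset.sum_congr rfl fun p _ => ?_
  rw [← MvPolynomial.smul_eq_C_mul, map_smul, map_add, Finset.mul_sum, Finset.mul_sum, map_sum,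
    map_sum, sub_eq_add_neg, ← Finset.sum_neg_distrib]
  congr 2
  · refine Finset.sum_congr rfl fun i _ => ?_
    rw [← hE, mul_left_comm]
  · refine Finset.sum_congr rfl fun i _ => ?_
    rw [← map_neg, lie_skew, ← hE]
    congr 1
    ring

end LeftMul

theorem sum_range_sum_range_eq_sum_antidiagonal {M : Type*} [AddCommMonoid M] (n : ℕ)
    (f : ℕ → ℕ → M) (hf : ∀ a b, n ≤ a + b → f a b = 0) :
    ∑ a ∈ Finset.range n, ∑ b ∈ Finset.range n, f a b =
      ∑ m ∈ Finset.range n, ∑ p ∈ antidiagonal m, f p.1 p.2 := by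
  simp only [Finset.Nat.sum_antidiagonal_eq_sum_range_succ f]
  rw [Finset.sum_range_diag_flip]
  refine Finset.sum_congr rfl fun a _ => (Finset.sum_subset ?_ fun b _ hb => ?_).symm
  · exact Finset.range_subset_range.2 (Nat.sub_le _ _)
  · exact hf a b (by rw [Finset.mem_range] at hb; omega)

/-! ### Left multiplications represent the rescaled Lie algebra. -/

section Representation

open SymmetricAlgebra

variable {𝕜 : Type*} [Field 𝕜] [CharZero 𝕜] {𝔤 : Type*} [LieRing 𝔤] [LieAlgebra 𝕜 𝔤]

/-- The first sum collects the terms in which `ζ` is contracted with the factor containing `ξ`,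
ordered by total degree in `z`. In the second sum `ξ` and `ζ` end up in different factors; it is
symmetric in the two and disappears from commutators. -/
theorem leftMul_leftMul_dpow (z : 𝕜) (ξ ζ η : 𝔤) (k M : ℕ) (hM : k + 1 < M) :
    leftMul 𝔤 z ζ (leftMul 𝔤 z ξ (dpow 𝕜 η k)) =
      ∑ n ∈ Finset.range M, z ^ n • (dpow 𝕜 η (k + 1 - n) * ι 𝕜 𝔤 (∑ p ∈ antidiagonal n,
        (bern 𝕜 p.1 * bern 𝕜 p.2) • ∑ i ∈ Finset.range p.2, (LieAlgebra.ad 𝕜 𝔤 η ^ i)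
          ⁅(LieAlgebra.ad 𝕜 𝔤 η ^ p.1) ξ, (LieAlgebra.ad 𝕜 𝔤 η ^ (p.2 - 1 - i)) ζ⁆)) +
      ∑ a ∈ Finset.range M, ∑ r ∈ Finset.range M, (bern 𝕜 a * bern 𝕜 r * z ^ (a + r)) •
        (dpow 𝕜 η (k - a - r) * (ι 𝕜 𝔤 ((LieAlgebra.ad 𝕜 𝔤 η ^ a) ξ) *
          ι 𝕜 𝔤 ((LieAlgebra.ad 𝕜 𝔤 η ^ r) ζ))) := by
  rw [leftMul_dpow z ξ η k M (by omega), map_sum]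
  have h : ∀ a ∈ Finset.range M, leftMul 𝔤 z ζ ((bern 𝕜 a * z ^ a) •
        (dpow 𝕜 η (k - a) * ι 𝕜 𝔤 ((LieAlgebra.ad 𝕜 𝔤 η ^ a) ξ))) =
      ∑ r ∈ Finset.range M, (bern 𝕜 a * bern 𝕜 r * z ^ (a + r)) •
        (dpow 𝕜 η (k + 1 - (a + r : ℕ)) * ι 𝕜 𝔤 (∑ i ∈ Finset.range r,
        (LieAlgebra.ad 𝕜 𝔤 η ^ i) ⁅(LieAlgebra.ad 𝕜 𝔤 η ^ a) ξ,
          (LieAlgebra.ad 𝕜 𝔤 η ^ (r - 1 - i)) ζ⁆)) +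
      ∑ r ∈ Finset.range M, (bern 𝕜 a * bern 𝕜 r * z ^ (a + r)) •
        (dpow 𝕜 η (k - a - r) * (ι 𝕜 𝔤 ((LieAlgebra.ad 𝕜 𝔤 η ^ a) ξ) *
          ι 𝕜 𝔤 ((LieAlgebra.ad 𝕜 𝔤 η ^ r) ζ))) := by
    intro a ha
    rw [map_smul, mul_comm (dpow 𝕜 η _), leftMul_ι_mul_dpow z ζ _ η _ M (by omega),
      Finset.smul_sum, ← Finset.sum_add_distrib]
    refine Finset.sum_congr rfl fun r _ => ?_
    rw [smul_smul, ← smul_add]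
    congr 1
    · ring
    · congr 1
      · congr 2
        push_cast
        ring
      · ring
  rw [Finset.sum_congr rfl h, Finset.sum_add_distrib]
  congr 1
  rw [sum_range_sum_range_eq_sum_antidiagonal M fun a r => (bern 𝕜 a * bern 𝕜 r * z ^ (a + r)) •
        (dpow 𝕜 η (k + 1 - (a + r : ℕ)) * ι 𝕜 𝔤 (∑ i ∈ Finset.range r,
        (LieAlgebra.ad 𝕜 𝔤 η ^ i) ⁅(LieAlgebra.ad 𝕜 𝔤 η ^ a) ξ,
          (LieAlgebra.ad 𝕜 𝔤 η ^ (r - 1 - i)) ζ⁆))]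
  · refine Finset.sum_congr rfl fun n _ => ?_
    rw [map_sum, Finset.mul_sum, Finset.smul_sum]
    refine Finset.sum_congr rfl fun p hp => ?_
    obtain rfl := Finset.HasAntidiagonal.mem_antidiagonal.1 hp
    rw [map_smul, mul_smul_comm, smul_smul, mul_comm (z ^ _)]
  · intro a r har
    rw [dpow_of_neg _ (by omega), zero_mul, smul_zero]

/-- The left multiplications form a representation of the rescaled Lie algebra. -/
theorem leftMul_lie (z : 𝕜) (ξ ζ : 𝔤) :
    leftMul 𝔤 z ξ * leftMul 𝔤 z ζ - leftMul 𝔤 z ζ * leftMul 𝔤 z ξ = z • leftMul 𝔤 z ⁅ξ, ζ⁆ := by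
  refine linearMap_ext_dpow fun η k => ?_
  rw [LinearMap.sub_apply, Module.End.mul_apply, Module.End.mul_apply, LinearMap.smul_apply,
    leftMul_leftMul_dpow z ζ ξ η k (k + 3) (by omega),
    leftMul_leftMul_dpow z ξ ζ η k (k + 3) (by omega),
    leftMul_dpow z ⁅ξ, ζ⁆ η k (k + 2) (by omega)]
  have hsymm : ∀ ξ ζ : 𝔤, ∑ a ∈ Finset.range (k + 3), ∑ r ∈ Finset.range (k + 3),
      (bern 𝕜 a * bern 𝕜 r * z ^ (a + r)) •
        (dpow 𝕜 η (k - a - r) * (ι 𝕜 𝔤 ((LieAlgebra.ad 𝕜 𝔤 η ^ a) ξ) *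
          ι 𝕜 𝔤 ((LieAlgebra.ad 𝕜 𝔤 η ^ r) ζ))) =
      ∑ a ∈ Finset.range (k + 3), ∑ r ∈ Finset.range (k + 3),
      (bern 𝕜 a * bern 𝕜 r * z ^ (a + r)) •
        (dpow 𝕜 η (k - a - r) * (ι 𝕜 𝔤 ((LieAlgebra.ad 𝕜 𝔤 η ^ a) ζ) *
          ι 𝕜 𝔤 ((LieAlgebra.ad 𝕜 𝔤 η ^ r) ξ))) := by
    intro ξ ζ
    rw [Finset.sum_comm]
    refine Finset.sum_congr rfl fun a _ => Finset.sum_congr rfl fun r _ => ?_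
    rw [mul_comm (bern 𝕜 a), add_comm a r, sub_right_comm, mul_comm (ι 𝕜 𝔤 _)]
  -- In degree `0` the inner sum over contractions is empty. The resulting shift of the index by one
  -- supplies the factor `z` on the right-hand side.
  rw [hsymm ξ ζ, add_sub_add_right_eq_sub, ← Finset.sum_sub_distrib, Finset.sum_range_succ']
  simp only [Finset.Nat.antidiagonal_zero, Finset.sum_singleton, Finset.range_zero, Finset.sum_empty, smul_zero,
    map_zero, mul_zero, sub_self, add_zero]
  rw [Finset.smul_sum]
  refine Finset.sum_congr rfl fun n _ => ?_
  have h := sum_bern_bracket (𝕜 := 𝕜) η ζ ξ n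
  simp only [smul_sub, Finset.sum_sub_distrib] at h
  rw [← smul_sub, ← mul_sub, ← map_sub, h, ← lie_skew, map_neg, map_neg, smul_neg, map_neg, neg_neg,
    map_smul,     mul_smul_comm, smul_smul, smul_smul]
  congr 1
  · ring
  · congr 2
    push_cast
    ring

/-- Only the term without contractions survives, since `ad η` kills `η`. -/
theorem leftMul_pow (z : 𝕜) (η : 𝔤) (k : ℕ) : leftMul 𝔤 z η (ι 𝕜 𝔤 η ^ k) = ι 𝕜 𝔤 η ^ (k + 1) := by
  rw [pow_eq_smul_dpow, map_smul, leftMul_dpow z η η k (k + 1) (by omega), Finset.sum_range_succ',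
    Finset.sum_eq_zero fun r _ => ?_, zero_add]
  · simp only [pow_zero, mul_one, bern_zero, one_smul, Module.End.one_apply, Nat.cast_zero, sub_zero]
    rw [← smul_mul_assoc, ← pow_eq_smul_dpow, pow_succ]
  · rw [pow_succ (LieAlgebra.ad 𝕜 𝔤 η), Module.End.mul_apply, LieAlgebra.ad_apply, lie_self, map_zero, map_zero, mul_zero,
      smul_zero]

end Representation

/-! ### Symmetrized extensions intertwine left multiplications. -/

section Universal

open SymmetricAlgebra

variable {𝕜 : Type*} [RCLike 𝕜] {𝔤 : Type*} [LieRing 𝔤] [LieAlgebra 𝕜 𝔤]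
variable {A : Type*} [Ring A] [Algebra 𝕜 A]

/-- The map `ξ₁ ⋯ ξₙ ↦ (1 / n!) ∑_σ j(ξ_σ(1)) ⋯ j(ξ_σ(n))` induced by a linear map `j`. -/
def symLift (j : 𝔤 →ₗ[𝕜] A) : SymmetricAlgebra 𝕜 𝔤 →ₗ[𝕜] A :=
  (TensorAlgebra.lift 𝕜 j).toLinearMap ∘ₗ (SymAlg 𝕜 𝔤).subtype ∘ₗ (symEquiv 𝕜 𝔤).toLinearMap

theorem symLift_apply (j : 𝔤 →ₗ[𝕜] A) (x : SymmetricAlgebra 𝕜 𝔤) :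
    symLift j x = TensorAlgebra.lift 𝕜 j (symEquiv 𝕜 𝔤 x) := rfl

theorem symLift_pow (j : 𝔤 →ₗ[𝕜] A) (η : 𝔤) (k : ℕ) : symLift j (ι 𝕜 𝔤 η ^ k) = j η ^ k := by
  rw [symLift_apply, coe_symEquiv_pow, map_pow, TensorAlgebra.lift_ι_apply]

theorem symLift_ι (j : 𝔤 →ₗ[𝕜] A) (η : 𝔤) : symLift j (ι 𝕜 𝔤 η) = j η := by
  simpa using symLift_pow j η 1

theorem symLift_one (j : 𝔤 →ₗ[𝕜] A) : symLift j (1 : SymmetricAlgebra 𝕜 𝔤) = 1 := by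
  simpa using symLift_pow j 0 0

theorem symLift_dpow (j : 𝔤 →ₗ[𝕜] A) (η : 𝔤) (k : ℕ) :
    symLift j (dpow 𝕜 η k) = ((k ! : ℕ) : 𝕜)⁻¹ • j η ^ k := by
  rw [dpow_natCast, map_smul, symLift_pow]

/-- Compare the coefficients of `ε` in `(η + ε a) ^ (m + 1)` before and after applying `symLift j`:
in the commutative algebra all positions of `a` coincide, in `A` they have to be summed. -/
theorem symLift_pow_mul_ι (j : 𝔤 →ₗ[𝕜] A) (η a : 𝔤) (m : ℕ) :
    ((m + 1 : ℕ) : 𝕜) • symLift j (ι 𝕜 𝔤 η ^ m * ι 𝕜 𝔤 a) =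
      ∑ i ∈ Finset.range (m + 1), j η ^ i * j a * j η ^ (m - i) := by
  obtain ⟨f, hf, -, -, hf1⟩ := exists_add_smul_pow (𝕜 := 𝕜) (ι 𝕜 𝔤 a) (ι 𝕜 𝔤 η) (m + 1)
  obtain ⟨g, hg, -, -, hg1⟩ := exists_add_smul_pow (𝕜 := 𝕜) (j a) (j η) (m + 1)
  have h := eq_of_sum_pow_smul_eq (m + 2) (fun i => symLift j (f i)) g (fun ε => by
    have := congrArg (symLift j) (hf ε)
    rw [← map_smul, ← map_add, symLift_pow, map_sum, map_add, map_smul, hg] at this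
    simpa using this.symm) 1 (by omega)
  have h2 : f 1 = ((m + 1 : ℕ) : 𝕜) • (ι 𝕜 𝔤 η ^ m * ι 𝕜 𝔤 a) := by
    rw [hf1, Finset.sum_congr rfl (g := fun _ => ι 𝕜 𝔤 η ^ m * ι 𝕜 𝔤 a)]
    · rw [Finset.sum_const, Finset.card_range, ← Nat.cast_smul_eq_nsmul 𝕜]
    · intro i hi
      have hi := Finset.mem_range.1 hi
      rw [mul_right_comm, ← pow_add]
      congr 2
      omega
  rw [← map_smul, ← h2, h, hg1]
  rfl

/-- Moving an element of the Lie algebra to the left of a power. -/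
theorem pow_mul_eq_sum (z : 𝕜) (j : 𝔤 →ₗ[𝕜] A)
    (hj : ∀ ξ ζ, j ξ * j ζ - j ζ * j ξ = z • j ⁅ξ, ζ⁆) (η a : 𝔤) (i : ℕ) :
    j η ^ i * j a = ∑ c ∈ Finset.range (i + 1),
      ((i.choose c : 𝕜) * z ^ c) • (j ((LieAlgebra.ad 𝕜 𝔤 η ^ c) a) * j η ^ (i - c)) := by
  -- On products `j b * x`, left multiplication by `j η` is the sum of two commuting operators: `z
  -- ad η` applied to `b`, and left multiplication by `j η` applied to `x`. The formula is the
  -- binomial theorem for them.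
  let F : 𝔤 ⊗[𝕜] A →ₗ[𝕜] A := LinearMap.mul' 𝕜 A ∘ₗ j.rTensor A
  let P : Module.End 𝕜 (𝔤 ⊗[𝕜] A) := (z • LieAlgebra.ad 𝕜 𝔤 η).rTensor A
  let Q : Module.End 𝕜 (𝔤 ⊗[𝕜] A) := (LinearMap.mulLeft 𝕜 (j η)).lTensor 𝔤
  have hcomm : Commute P Q := by
    refine TensorProduct.ext' fun b x => ?_
    simp [P, Q]
  have hF : ∀ t, j η * F t = F ((P + Q) t) := by
    intro t
    induction t using TensorProduct.induction_on with
    | zero => simp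
    | add s t hs ht => rw [map_add, mul_add, hs, ht, map_add, map_add]
    | tmul b x =>
      have := hj η b
      rw [sub_eq_iff_eq_add] at this
      simp [F, P, Q, ← mul_assoc, this, add_mul]
  have hpow : ∀ i t, j η ^ i * F t = F (((P + Q) ^ i) t) := by
    intro i
    induction i with
    | zero => simp
    | succ i ih => intro t; rw [pow_succ, mul_assoc, hF, ih, pow_succ, Module.End.mul_apply]
  have h1 := hpow i (a ⊗ₜ 1)
  rw [hcomm.add_pow] at h1
  have hP : ∀ c, P ^ c = ((z • LieAlgebra.ad 𝕜 𝔤 η) ^ c).rTensor A := fun c =>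
    LinearMap.rTensor_pow _ c
  have hQ : ∀ c, Q ^ c = ((LinearMap.mulLeft 𝕜 (j η)) ^ c).lTensor 𝔤 := fun c =>
    LinearMap.lTensor_pow _ c
  have hF1 : F (a ⊗ₜ 1) = j a := by simp [F]
  rw [hF1] at h1
  rw [h1, LinearMap.sum_apply, map_sum]
  refine Finset.sum_congr rfl fun c _ => ?_
  rw [Module.End.mul_apply, Module.End.mul_apply, hP, hQ, ← nsmul_one, LinearMap.smul_apply, Module.End.one_apply,
    map_nsmul, map_nsmul, map_nsmul, LinearMap.lTensor_tmul, LinearMap.rTensor_tmul, LinearMap.pow_mulLeft, smul_pow]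
  simp only [nsmul_eq_mul, LinearMap.smul_apply, map_smul,
    LinearMap.rTensor_tmul, mul_smul, F, LinearMap.comp_apply, LinearMap.mul'_apply,
    LinearMap.mulLeft_apply, mul_one]
  rw [← nsmul_eq_mul, Nat.cast_smul_eq_nsmul, smul_mul_assoc, smul_comm]

/-- Sum over the positions of `a` in the symmetrized product and move `a` to the left each time. The
hockey-stick identity for binomial coefficients leaves `1 / (c + 1)!`, the coefficients of `(exp x -
1) / x`. -/
theorem symLift_dpow_mul_ι (z : 𝕜) (j : 𝔤 →ₗ[𝕜] A)
    (hj : ∀ ξ ζ, j ξ * j ζ - j ζ * j ξ = z • j ⁅ξ, ζ⁆) (η a : 𝔤) (k : ℤ) (M : ℕ) (hM : k < M) :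
    symLift j (dpow 𝕜 η k * ι 𝕜 𝔤 a) = ∑ c ∈ Finset.range M,
      ((((c + 1) ! : ℕ) : 𝕜)⁻¹ * z ^ c) •
        (j ((LieAlgebra.ad 𝕜 𝔤 η ^ c) a) * symLift j (dpow 𝕜 η (k - c))) := by
  rcases lt_or_ge k 0 with hk | hk
  · rw [dpow_of_neg _ hk, zero_mul, map_zero, Finset.sum_eq_zero]
    intro c _
    rw [dpow_of_neg _ (by omega), map_zero, mul_zero, smul_zero]
  obtain ⟨m, rfl⟩ := Int.eq_ofNat_of_zero_le hk
  have hm1 : ((m + 1 : ℕ) : 𝕜) ≠ 0 := Nat.cast_ne_zero.2 m.succ_ne_zero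
  have hsub : ∑ c ∈ Finset.range M, ((((c + 1) ! : ℕ) : 𝕜)⁻¹ * z ^ c) •
        (j ((LieAlgebra.ad 𝕜 𝔤 η ^ c) a) * symLift j (dpow 𝕜 η ((m : ℤ) - c))) =
      ∑ c ∈ Finset.range (m + 1), ((((c + 1) ! : ℕ) : 𝕜)⁻¹ * z ^ c) •
        (j ((LieAlgebra.ad 𝕜 𝔤 η ^ c) a) * symLift j (dpow 𝕜 η ((m : ℤ) - c))) := by
    refine (Finset.sum_subset (Finset.range_subset_range.2 (by omega)) fun c _ hc => ?_).symm
    rw [Finset.mem_range] at hc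
    rw [dpow_of_neg _ (by omega), map_zero, mul_zero, smul_zero]
  have hterm : ∀ i ∈ Finset.range (m + 1), j η ^ i * j a * j η ^ (m - i) =
      ∑ c ∈ Finset.range (m + 1), ((i.choose c : 𝕜) * z ^ c) •
        (j ((LieAlgebra.ad 𝕜 𝔤 η ^ c) a) * j η ^ (m - c)) := by
    intro i hi
    have hi := Finset.mem_range.1 hi
    rw [pow_mul_eq_sum z j hj, Finset.sum_mul]
    refine (Finset.sum_congr rfl fun c hc => ?_).trans
      (Finset.sum_subset (Finset.range_subset_range.2 (by omega)) fun c _ hc => ?_)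
    · have hc := Finset.mem_range.1 hc
      rw [smul_mul_assoc, mul_assoc, ← pow_add]
      congr 3
      omega
    · rw [Nat.choose_eq_zero_of_lt (by rw [Finset.mem_range] at hc; omega)]
      simp
  have hchoose : ∀ c ∈ Finset.range (m + 1), ∑ i ∈ Finset.range (m + 1), i.choose c =
      (m + 1).choose (c + 1) := by
    intro c hc
    rw [← Nat.sum_Icc_choose]
    refine (Finset.sum_subset (fun i hi => ?_) fun i hi hi' => ?_).symm
    · rw [Finset.mem_Icc] at hi
      rw [Finset.mem_range]
      omega
    · rw [Finset.mem_range] at hi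
      rw [Finset.mem_Icc] at hi'
      exact Nat.choose_eq_zero_of_lt (by omega)
  have h := symLift_pow_mul_ι j η a m
  rw [Finset.sum_congr rfl hterm, Finset.sum_comm] at h
  rw [hsub]
  refine (smul_right_injective A (mul_ne_zero hm1 (Nat.cast_ne_zero.2 m.factorial_ne_zero))) ?_
  dsimp only
  rw [mul_smul, ← map_smul (symLift j) ((m ! : ℕ) : 𝕜), ← smul_mul_assoc]
  rw [← pow_eq_smul_dpow, h,
    Finset.smul_sum]
  refine Finset.sum_congr rfl fun c hc => ?_
  have hc' := Finset.mem_range.1 hc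
  rw [← Finset.sum_smul, ← Finset.sum_mul, ← Nat.cast_sum, hchoose c hc,
    show (m : ℤ) - (c : ℤ) = ((m - c : ℕ) : ℤ) by omega, symLift_dpow, mul_smul_comm,
    smul_smul, smul_smul]
  congr 1
  rw [Nat.cast_choose 𝕜 (by omega : c + 1 ≤ m + 1), show m + 1 - (c + 1) = m - c by omega,
    Nat.factorial_succ m]
  push_cast
  ring

/-- Left multiplications in an algebra generated by a representation of the Lie algebra. -/
theorem symLift_leftMul (z : 𝕜) (j : 𝔤 →ₗ[𝕜] A)
    (hj : ∀ ξ ζ, j ξ * j ζ - j ζ * j ξ = z • j ⁅ξ, ζ⁆) (ξ : 𝔤) (x : SymmetricAlgebra 𝕜 𝔤) :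
    symLift j (leftMul 𝔤 z ξ x) = j ξ * symLift j x := by
  suffices h : symLift j ∘ₗ leftMul 𝔤 z ξ = LinearMap.mulLeft 𝕜 (j ξ) ∘ₗ symLift j from
    congr($h x)
  refine linearMap_ext_dpow fun η k => ?_
  rw [LinearMap.comp_apply, LinearMap.comp_apply, LinearMap.mulLeft_apply,
    leftMul_dpow z ξ η k (k + 1) (by omega), map_sum]
  have h : ∀ r ∈ Finset.range (k + 1), symLift j ((bern 𝕜 r * z ^ r) •
        (dpow 𝕜 η (k - r) * ι 𝕜 𝔤 ((LieAlgebra.ad 𝕜 𝔤 η ^ r) ξ))) =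
      ∑ c ∈ Finset.range (k + 1), (bern 𝕜 r * (((c + 1) ! : ℕ) : 𝕜)⁻¹ * z ^ (r + c)) •
        (j ((LieAlgebra.ad 𝕜 𝔤 η ^ (r + c)) ξ) * symLift j (dpow 𝕜 η (k - (r + c : ℕ)))) := by
    intro r _
    rw [map_smul, symLift_dpow_mul_ι z j hj η _ _ (k + 1) (by omega), Finset.smul_sum]
    refine Finset.sum_congr rfl fun c _ => ?_
    rw [smul_smul, ← Module.End.mul_apply, ← pow_add, add_comm c r]
    congr 1
    · ring
    · congr 3
      push_cast
      ring
  rw [Finset.sum_congr rfl h, sum_range_sum_range_eq_sum_antidiagonal (k + 1) fun r c =>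
    (bern 𝕜 r * (((c + 1) ! : ℕ) : 𝕜)⁻¹ * z ^ (r + c)) •
        (j ((LieAlgebra.ad 𝕜 𝔤 η ^ (r + c)) ξ) * symLift j (dpow 𝕜 η (k - (r + c : ℕ))))]
  -- The series `x / (exp x - 1)` and `(exp x - 1) / x` are inverse to each other, so all terms of
  -- positive degree cancel.
  · have h2 : ∀ n ∈ Finset.range (k + 1), ∑ p ∈ antidiagonal n,
        (bern 𝕜 p.1 * (((p.2 + 1) ! : ℕ) : 𝕜)⁻¹ * z ^ (p.1 + p.2)) •
        (j ((LieAlgebra.ad 𝕜 𝔤 η ^ (p.1 + p.2)) ξ) * symLift j (dpow 𝕜 η (k - (p.1 + p.2 : ℕ)))) =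
        if n = 0 then j ξ * symLift j (dpow 𝕜 η k) else 0 := by
      intro n _
      rw [Finset.sum_congr rfl (g := fun p => (bern 𝕜 p.1 * (((p.2 + 1) ! : ℕ) : 𝕜)⁻¹) • (z ^ n •
        (j ((LieAlgebra.ad 𝕜 𝔤 η ^ n) ξ) * symLift j (dpow 𝕜 η (k - n)))))
        (fun p hp => by
          rw [Finset.HasAntidiagonal.mem_antidiagonal] at hp
          rw [hp, mul_smul]), ← Finset.sum_smul, sum_bern_div]
      split_ifs with hn
      · subst hn; simp
      · simp
    rw [Finset.sum_congr rfl h2, Finset.sum_ite_eq' (Finset.range (k + 1)) 0]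
    simp
  · intro r c hrc
    rw [dpow_of_neg _ (by omega), map_zero, mul_zero, smul_zero]

end Universal

/-! ### The star product, its associativity and its universal property. -/

section Star

open SymmetricAlgebra

variable {𝕜 : Type*} [RCLike 𝕜] {𝔤 : Type*} [LieRing 𝔤] [LieAlgebra 𝕜 𝔤]
variable {A : Type*} [Ring A] [Algebra 𝕜 A]

variable (𝔤) in
/-- The Gutt star product on the quotient model of the symmetric algebra. -/
def starMul (z : 𝕜) : SymmetricAlgebra 𝕜 𝔤 →ₗ[𝕜] SymmetricAlgebra 𝕜 𝔤 →ₗ[𝕜] SymmetricAlgebra 𝕜 𝔤 :=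
  symLift (leftMul 𝔤 z)

theorem starMul_pow_apply (z : 𝕜) (η : 𝔤) (k : ℕ) :
    starMul 𝔤 z (ι 𝕜 𝔤 η ^ k) = leftMul 𝔤 z η ^ k := symLift_pow _ η k

/-- Star multiplication by `η ^ k` from the left is the `k`-th power of `leftMul`, so
`symLift_leftMul` can be iterated. -/
theorem symLift_starMul (z : 𝕜) (j : 𝔤 →ₗ[𝕜] A)
    (hj : ∀ ξ ζ, j ξ * j ζ - j ζ * j ξ = z • j ⁅ξ, ζ⁆) (x y : SymmetricAlgebra 𝕜 𝔤) :
    symLift j (starMul 𝔤 z x y) = symLift j x * symLift j y := by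
  suffices h : (starMul 𝔤 z).compr₂ (symLift j) =
      (LinearMap.mul 𝕜 A ∘ₗ symLift j).compl₂ (symLift j) from congr($h x y)
  refine linearMap_ext_pow fun η k => LinearMap.ext fun y => ?_
  change symLift j (starMul 𝔤 z _ y) = symLift j _ * symLift j y
  rw [starMul_pow_apply, symLift_pow]
  induction k with
  | zero => simp
  | succ k ih => rw [pow_succ', Module.End.mul_apply, symLift_leftMul z j hj, ih, pow_succ', mul_assoc]

/-- By `leftMul_lie` the operators `leftMul` themselves satisfy the hypothesis of `symLift_starMul`;
associativity says that `x ↦ (x ⋆ ·)` is multiplicative. -/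
theorem starMul_assoc (z : 𝕜) (x y w : SymmetricAlgebra 𝕜 𝔤) :
    starMul 𝔤 z (starMul 𝔤 z x y) w = starMul 𝔤 z x (starMul 𝔤 z y w) :=
  congr($(symLift_starMul z (leftMul 𝔤 z) (leftMul_lie z) x y) w)

theorem one_starMul (z : 𝕜) (x : SymmetricAlgebra 𝕜 𝔤) : starMul 𝔤 z 1 x = x :=
  congr($(symLift_one (leftMul 𝔤 z)) x)

theorem starMul_pow_pow (z : 𝕜) (η : 𝔤) (k l : ℕ) :
    starMul 𝔤 z (ι 𝕜 𝔤 η ^ k) (ι 𝕜 𝔤 η ^ l) = ι 𝕜 𝔤 η ^ (k + l) := by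
  rw [starMul_pow_apply]
  induction k with
  | zero => simp
  | succ k ih => rw [pow_succ', Module.End.mul_apply, ih, leftMul_pow, add_right_comm]

theorem starMul_one (z : 𝕜) (x : SymmetricAlgebra 𝕜 𝔤) : starMul 𝔤 z x 1 = x := by
  suffices h : (starMul 𝔤 z).flip 1 = LinearMap.id from congr($h x)
  refine linearMap_ext_pow fun η k => ?_
  simpa using starMul_pow_pow z η k 0

variable (𝔤) in
/-- The Gutt star product, as a bilinear map on the symmetric algebra. -/
def starProd (z : 𝕜) : SymAlg 𝕜 𝔤 →ₗ[𝕜] SymAlg 𝕜 𝔤 →ₗ[𝕜] SymAlg 𝕜 𝔤 :=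
  ((starMul 𝔤 z).compr₂ (symEquiv 𝕜 𝔤).toLinearMap).compl₁₂ (symEquiv 𝕜 𝔤).symm.toLinearMap
    (symEquiv 𝕜 𝔤).symm.toLinearMap

theorem starProd_apply (z : 𝕜) (x y : SymAlg 𝕜 𝔤) : starProd 𝔤 z x y =
    symEquiv 𝕜 𝔤 (starMul 𝔤 z ((symEquiv 𝕜 𝔤).symm x) ((symEquiv 𝕜 𝔤).symm y)) := rfl

theorem starProd_symEquiv (z : 𝕜) (x y : SymmetricAlgebra 𝕜 𝔤) :
    starProd 𝔤 z (symEquiv 𝕜 𝔤 x) (symEquiv 𝕜 𝔤 y) = symEquiv 𝕜 𝔤 (starMul 𝔤 z x y) := by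
  rw [starProd_apply, LinearEquiv.symm_apply_apply, LinearEquiv.symm_apply_apply]

/-- The symmetric algebra with the Gutt star product `⋆_z` as multiplication. -/
def StarAlg (_z : 𝕜) (𝔤 : Type*) [LieRing 𝔤] [LieAlgebra 𝕜 𝔤] : Type _ := SymAlg 𝕜 𝔤

instance (z : 𝕜) : AddCommGroup (StarAlg z 𝔤) := inferInstanceAs (AddCommGroup (SymAlg 𝕜 𝔤))

instance (z : 𝕜) : Module 𝕜 (StarAlg z 𝔤) := inferInstanceAs (Module 𝕜 (SymAlg 𝕜 𝔤))

/-- The identity map of the symmetric algebra into the star product algebra. -/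
def toStarAlg (z : 𝕜) : SymAlg 𝕜 𝔤 ≃ₗ[𝕜] StarAlg z 𝔤 := LinearEquiv.refl 𝕜 _

instance (z : 𝕜) : Ring (StarAlg z 𝔤) where
  __ := (inferInstance : AddCommGroup (StarAlg z 𝔤))
  mul x y := toStarAlg z (starProd 𝔤 z ((toStarAlg z).symm x) ((toStarAlg z).symm y))
  one := toStarAlg z (symEquiv 𝕜 𝔤 1)
  left_distrib x y w := by
    change toStarAlg z _ = toStarAlg z _ + toStarAlg z _
    rw [map_add, map_add, map_add]
  right_distrib x y w := by
    change toStarAlg z _ = toStarAlg z _ + toStarAlg z _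
    rw [map_add, map_add, LinearMap.add_apply, map_add]
  zero_mul x := by
    change toStarAlg z _ = 0
    rw [map_zero, map_zero, LinearMap.zero_apply, map_zero]
  mul_zero x := by
    change toStarAlg z _ = 0
    rw [map_zero, map_zero, map_zero]
  mul_assoc x y w := by
    change toStarAlg z _ = toStarAlg z _
    congr 1
    change symEquiv 𝕜 𝔤 (starMul 𝔤 z ((symEquiv 𝕜 𝔤).symm (symEquiv 𝕜 𝔤 _)) _) =
      symEquiv 𝕜 𝔤 (starMul 𝔤 z _ ((symEquiv 𝕜 𝔤).symm (symEquiv 𝕜 𝔤 _)))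
    rw [LinearEquiv.symm_apply_apply, LinearEquiv.symm_apply_apply, starMul_assoc]
  one_mul x := by
    change toStarAlg z (symEquiv 𝕜 𝔤 (starMul 𝔤 z ((symEquiv 𝕜 𝔤).symm (symEquiv 𝕜 𝔤 1)) _)) = x
    rw [LinearEquiv.symm_apply_apply, one_starMul]
    exact (symEquiv 𝕜 𝔤).apply_symm_apply x
  mul_one x := by
    change toStarAlg z (symEquiv 𝕜 𝔤 (starMul 𝔤 z _ ((symEquiv 𝕜 𝔤).symm (symEquiv 𝕜 𝔤 1)))) = x
    rw [LinearEquiv.symm_apply_apply, starMul_one]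
    exact (symEquiv 𝕜 𝔤).apply_symm_apply x

theorem toStarAlg_mul (z : 𝕜) (x y : SymAlg 𝕜 𝔤) :
    toStarAlg z x * toStarAlg z y = toStarAlg z (starProd 𝔤 z x y) := rfl

theorem toStarAlg_one (z : 𝕜) : toStarAlg z (symEquiv 𝕜 𝔤 1) = 1 := rfl

instance (z : 𝕜) : Algebra 𝕜 (StarAlg z 𝔤) := Algebra.ofModule
  (fun c x y => by
    change toStarAlg z _ = c • toStarAlg z _
    rw [map_smul, map_smul, LinearMap.smul_apply, map_smul])
  (fun c x y => by
    change toStarAlg z _ = c • toStarAlg z _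
    rw [map_smul, map_smul, map_smul])

/-- The inclusion of the Lie algebra. -/
def starι (z : 𝕜) : 𝔤 →ₗ[𝕜] StarAlg z 𝔤 :=
  (toStarAlg z).toLinearMap ∘ₗ (symEquiv 𝕜 𝔤).toLinearMap ∘ₗ ι 𝕜 𝔤

theorem starι_pow (z : 𝕜) (η : 𝔤) (k : ℕ) :
    starι z η ^ k = toStarAlg z (symEquiv 𝕜 𝔤 (ι 𝕜 𝔤 η ^ k)) := by
  induction k with
  | zero => simp [toStarAlg_one]
  | succ k ih =>
    rw [pow_succ, ih]
    change _ * toStarAlg z (symEquiv 𝕜 𝔤 (ι 𝕜 𝔤 η)) = _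
    rw [toStarAlg_mul, starProd_symEquiv]
    simpa using congrArg (fun x => toStarAlg z (symEquiv 𝕜 𝔤 x)) (starMul_pow_pow z η k 1)

theorem starAlg_ext {z : 𝕜} {M : Type*} [AddCommGroup M] [Module 𝕜 M] {f g : StarAlg z 𝔤 →ₗ[𝕜] M}
    (h : ∀ (η : 𝔤) (k : ℕ), f (starι z η ^ k) = g (starι z η ^ k)) : f = g := by
  have : f ∘ₗ (toStarAlg z).toLinearMap = g ∘ₗ (toStarAlg z).toLinearMap :=
    symAlg_ext fun v k => by simpa [starι_pow] using h v k
  exact this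

theorem starAlg_algHom_ext {z : 𝕜} {f g : StarAlg z 𝔤 →ₐ[𝕜] A}
    (h : ∀ η : 𝔤, f (starι z η) = g (starι z η)) : f = g := by
  have : f.toLinearMap = g.toLinearMap := starAlg_ext fun η k => by simp [h]
  exact AlgHom.ext fun x => congr($this x)

/-- The universal property of the star product algebra. -/
def starLift (z : 𝕜) (j : 𝔤 →ₗ[𝕜] A) (hj : ∀ ξ ζ, j ξ * j ζ - j ζ * j ξ = z • j ⁅ξ, ζ⁆) :
    StarAlg z 𝔤 →ₐ[𝕜] A :=
  AlgHom.ofLinearMap (symLift j ∘ₗ (symEquiv 𝕜 𝔤).symm.toLinearMap ∘ₗ (toStarAlg z).symm.toLinearMap)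
    (by simp [← toStarAlg_one, symLift_one])
    (fun x y => by
      change symLift j ((symEquiv 𝕜 𝔤).symm (symEquiv 𝕜 𝔤 _)) = _
      rw [LinearEquiv.symm_apply_apply, symLift_starMul z j hj]
      rfl)

theorem starLift_ι (z : 𝕜) (j : 𝔤 →ₗ[𝕜] A)
    (hj : ∀ ξ ζ, j ξ * j ζ - j ζ * j ξ = z • j ⁅ξ, ζ⁆) (ξ : 𝔤) :
    starLift z j hj (starι z ξ) = j ξ := by
  simp [starLift, starι, symLift_ι]

theorem starι_lie (z : 𝕜) (ξ ζ : 𝔤) :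
    starι z ξ * starι z ζ - starι z ζ * starι z ξ = z • starι z ⁅ξ, ζ⁆ := by
  have h := congr($(leftMul_lie z ξ ζ) 1)
  have h1 : ∀ ξ : 𝔤, leftMul 𝔤 z ξ 1 = ι 𝕜 𝔤 ξ := fun ξ => by simpa using leftMul_pow z ξ 0
  simp only [LinearMap.sub_apply, Module.End.mul_apply, LinearMap.smul_apply, h1] at h
  have h2 : ∀ ξ ζ : 𝔤, starι z ξ * starι z ζ =
      toStarAlg z (symEquiv 𝕜 𝔤 (leftMul 𝔤 z ξ (ι 𝕜 𝔤 ζ))) := fun ξ ζ => by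
    change toStarAlg z (symEquiv 𝕜 𝔤 _) * toStarAlg z (symEquiv 𝕜 𝔤 _) = _
    rw [toStarAlg_mul, starProd_symEquiv]
    congr 2
    simpa using congr($(starMul_pow_apply z ξ 1) (ι 𝕜 𝔤 ζ))
  rw [h2, h2, ← map_sub, ← map_sub, h, map_smul, map_smul]
  rfl

end Star

/-! ### The Poincaré-Birkhoff-Witt theorem and the comparison with the enveloping algebra. -/

section PBW

open SymmetricAlgebra

variable (𝕜 : Type*) [RCLike 𝕜] (𝔤 : Type*) [LieRing 𝔤] [LieAlgebra 𝕜 𝔤]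

attribute [local instance 100] LieRing.ofAssociativeRing

theorem envι_lie (ξ ζ : 𝔤) :
    (UniversalEnvelopingAlgebra.ι 𝕜 ξ * UniversalEnvelopingAlgebra.ι 𝕜 ζ -
      UniversalEnvelopingAlgebra.ι 𝕜 ζ * UniversalEnvelopingAlgebra.ι 𝕜 ξ :
        UniversalEnvelopingAlgebra 𝕜 𝔤) =
      (1 : 𝕜) • UniversalEnvelopingAlgebra.ι 𝕜 ⁅ξ, ζ⁆ := by
  rw [LieHom.map_lie, LieRing.of_associative_ring_bracket, one_smul]

theorem pbw_symEquiv (x : SymmetricAlgebra 𝕜 𝔤) :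
    pbw 𝕜 𝔤 (symEquiv 𝕜 𝔤 x) =
      symLift (UniversalEnvelopingAlgebra.ι 𝕜 : 𝔤 →ₗ⁅𝕜⁆ UniversalEnvelopingAlgebra 𝕜 𝔤).toLinearMap
        x := by
  have : UniversalEnvelopingAlgebra.mkAlgHom 𝕜 𝔤 = TensorAlgebra.lift 𝕜
      (UniversalEnvelopingAlgebra.ι 𝕜 : 𝔤 →ₗ⁅𝕜⁆ UniversalEnvelopingAlgebra 𝕜 𝔤).toLinearMap := by
    refine TensorAlgebra.hom_ext (LinearMap.ext fun ξ => ?_)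
    simp
  rw [symLift_apply, ← this]
  rfl

/-- Multiplicativity is available before bijectivity is known, and surjectivity of `pbw` is deduced
from it. -/
theorem pbw_mul (x y : SymAlg 𝕜 𝔤) : pbw 𝕜 𝔤 x * pbw 𝕜 𝔤 y = pbw 𝕜 𝔤 (starProd 𝔤 1 x y) := by
  obtain ⟨x, rfl⟩ := (symEquiv 𝕜 𝔤).surjective x
  obtain ⟨y, rfl⟩ := (symEquiv 𝕜 𝔤).surjective y
  rw [starProd_symEquiv, pbw_symEquiv, pbw_symEquiv, pbw_symEquiv,
    symLift_starMul 1 _ (envι_lie 𝕜 𝔤)]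

/-- The Poincaré-Birkhoff-Witt theorem in characteristic zero. -/
theorem pbw_bijective : Function.Bijective (pbw 𝕜 𝔤) := by
  constructor
  -- The enveloping algebra acts on the symmetric algebra through `leftMul` at `z = 1`. Evaluating
  -- this action at `1` gives a left inverse of `pbw`.
  · let F : 𝔤 →ₗ⁅𝕜⁆ Module.End 𝕜 (SymmetricAlgebra 𝕜 𝔤) :=
      { leftMul 𝔤 (1 : 𝕜) with
        map_lie' := fun {ξ ζ} => by
          rw [LieRing.of_associative_ring_bracket]
          simpa using (leftMul_lie (1 : 𝕜) ξ ζ).symm }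
    have hF : ∀ t : TensorAlgebra 𝕜 𝔤, UniversalEnvelopingAlgebra.lift 𝕜 F
        (UniversalEnvelopingAlgebra.mkAlgHom 𝕜 𝔤 t) = TensorAlgebra.lift 𝕜 (leftMul 𝔤 (1 : 𝕜)) t := by
      intro t
      have : (UniversalEnvelopingAlgebra.lift 𝕜 F).comp (UniversalEnvelopingAlgebra.mkAlgHom 𝕜 𝔤) =
          TensorAlgebra.lift 𝕜 (leftMul 𝔤 (1 : 𝕜)) := by
        refine TensorAlgebra.hom_ext (LinearMap.ext fun ξ => ?_)
        rw [LinearMap.comp_apply, LinearMap.comp_apply, AlgHom.toLinearMap_apply, AlgHom.comp_apply,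
          AlgHom.toLinearMap_apply, TensorAlgebra.lift_ι_apply,
          UniversalEnvelopingAlgebra.lift_ι_apply']
        rfl
      exact congr($this t)
    refine Function.LeftInverse.injective (g := fun u =>
      symEquiv 𝕜 𝔤 (UniversalEnvelopingAlgebra.lift 𝕜 F u 1)) fun x => ?_
    obtain ⟨x, rfl⟩ := (symEquiv 𝕜 𝔤).surjective x
    refine congrArg (symEquiv 𝕜 𝔤) ?_
    change UniversalEnvelopingAlgebra.lift 𝕜 F (UniversalEnvelopingAlgebra.mkAlgHom 𝕜 𝔤 _) 1 = x
    rw [hF]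
    exact starMul_one 1 x
  · intro u
    obtain ⟨t, rfl⟩ : ∃ t, UniversalEnvelopingAlgebra.mkAlgHom 𝕜 𝔤 t = u :=
      Quotient.mk_surjective u
    change UniversalEnvelopingAlgebra.mkAlgHom 𝕜 𝔤 t ∈ LinearMap.range (pbw 𝕜 𝔤)
    have hone : pbw 𝕜 𝔤 (symEquiv 𝕜 𝔤 1) = 1 := by rw [pbw_symEquiv, symLift_one]
    induction t using TensorAlgebra.induction with
    | algebraMap r =>
      rw [AlgHom.commutes, Algebra.algebraMap_eq_smul_one, ← hone]
      exact Submodule.smul_mem _ _ (LinearMap.mem_range_self _ _)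
    | ι ξ => exact ⟨symEquiv 𝕜 𝔤 (ι 𝕜 𝔤 ξ), by rw [pbw_symEquiv, symLift_ι]; simp⟩
    | mul a b ha hb =>
      obtain ⟨x, hx⟩ := ha
      obtain ⟨y, hy⟩ := hb
      rw [map_mul, ← hx, ← hy, pbw_mul]
      exact LinearMap.mem_range_self _ _
    | add a b ha hb => rw [map_add]; exact Submodule.add_mem _ ha hb

theorem pbwInv_pbw (x : SymAlg 𝕜 𝔤) : pbwInv 𝕜 𝔤 (pbw 𝕜 𝔤 x) = x := by
  rw [pbwInv, dif_pos (pbw_bijective 𝕜 𝔤)]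
  exact (LinearEquiv.ofBijective (pbw 𝕜 𝔤) (pbw_bijective 𝕜 𝔤)).symm_apply_apply x

theorem pbwInv_pbw_mul (x y : SymAlg 𝕜 𝔤) :
    pbwInv 𝕜 𝔤 (pbw 𝕜 𝔤 x * pbw 𝕜 𝔤 y) = starProd 𝔤 1 x y := by
  rw [pbw_mul, pbwInv_pbw]

end PBW

/-! ### Algebraic Hopf identities for the star product. -/

section Hopf

variable {𝕜 : Type*} [RCLike 𝕜]

section Module

variable {V : Type*} [AddCommGroup V] [Module 𝕜 V]

variable (𝕜) in
/-- The power `ηᵏ` as an element of the symmetric algebra. -/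
def symPow (η : V) (k : ℕ) : SymAlg 𝕜 V := symEquiv 𝕜 V (SymmetricAlgebra.ι 𝕜 V η ^ k)

theorem coe_symPow (η : V) (k : ℕ) :
    (symPow 𝕜 η k : TensorAlgebra 𝕜 V) = TensorAlgebra.ι 𝕜 η ^ k := coe_symEquiv_pow η k

theorem sym_pow (η : V) (k : ℕ) : sym 𝕜 V (TensorAlgebra.ι 𝕜 η ^ k) = symPow 𝕜 η k :=
  sym_ι_pow η k

theorem symPow_zero (η : V) : symPow 𝕜 η 0 = symOne 𝕜 V := by
  rw [← sym_pow, pow_zero]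
  rfl

theorem symComul_symPow (η : V) (k : ℕ) : symComul 𝕜 V (symPow 𝕜 η k) =
    ∑ m ∈ Finset.range (k + 1), (k.choose m : 𝕜) • (symPow 𝕜 η m ⊗ₜ[𝕜] symPow 𝕜 η (k - m)) := by
  rw [symComul, LinearMap.comp_apply, LinearMap.comp_apply, Submodule.subtype_apply, coe_symPow,
    AlgHom.toLinearMap_apply, map_pow, tensorComul, TensorAlgebra.lift_ι_apply]
  have hc : Commute ((TensorAlgebra.ι 𝕜 η) ⊗ₜ[𝕜] (1 : TensorAlgebra 𝕜 V))
      ((1 : TensorAlgebra 𝕜 V) ⊗ₜ[𝕜] (TensorAlgebra.ι 𝕜 η)) := by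
    simp [commute_iff_eq]
  have := hc.add_pow k
  simp only [LinearMap.add_apply, LinearMap.comp_apply, AlgHom.toLinearMap_apply,
    Algebra.TensorProduct.includeLeft_apply, Algebra.TensorProduct.includeRight_apply]
  rw [this, map_sum]
  refine Finset.sum_congr rfl fun m _ => ?_
  rw [← nsmul_eq_mul', map_nsmul, ← Nat.cast_smul_eq_nsmul 𝕜]
  simp [sym_pow]

theorem symComul_symOne : symComul 𝕜 V (symOne 𝕜 V) = symOne 𝕜 V ⊗ₜ symOne 𝕜 V := by
  rw [← symPow_zero 0, symComul_symPow]
  simp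

theorem symCounit_symPow (η : V) (k : ℕ) : symCounit 𝕜 V (symPow 𝕜 η k) = 0 ^ k := by
  simp [symCounit, coe_symPow, TensorAlgebra.algebraMapInv]

theorem symAntipode_symPow (η : V) (k : ℕ) :
    symAntipode 𝕜 V (symPow 𝕜 η k) = (-1 : 𝕜) ^ k • symPow 𝕜 η k := by
  rw [symAntipode, LinearMap.comp_apply, LinearMap.comp_apply, Submodule.subtype_apply, coe_symPow,
    AlgHom.toLinearMap_apply, map_pow, TensorAlgebra.lift_ι_apply, LinearMap.neg_apply, neg_pow,
    ← map_one (algebraMap 𝕜 (TensorAlgebra 𝕜 V)), ← map_neg, ← map_pow, ← Algebra.smul_def, map_smul,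
    sym_pow]

theorem symMap_symPow {W : Type*} [AddCommGroup W] [Module 𝕜 W] (f : V →ₗ[𝕜] W) (η : V) (k : ℕ) :
    symMap 𝕜 f (symPow 𝕜 η k) = symPow 𝕜 (f η) k := by
  rw [symMap, LinearMap.comp_apply, LinearMap.comp_apply, Submodule.subtype_apply, coe_symPow,
    AlgHom.toLinearMap_apply, map_pow, TensorAlgebra.lift_ι_apply, LinearMap.comp_apply, sym_pow]

theorem symAlg_ext_symPow {M : Type*} [AddCommGroup M] [Module 𝕜 M] {f g : SymAlg 𝕜 V →ₗ[𝕜] M}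
    (h : ∀ (v : V) (k : ℕ), f (symPow 𝕜 v k) = g (symPow 𝕜 v k)) : f = g := symAlg_ext h

theorem symMap_id : symMap 𝕜 (LinearMap.id : V →ₗ[𝕜] V) = LinearMap.id :=
  symAlg_ext_symPow fun v k => by rw [symMap_symPow]; rfl

variable {W : Type*} [AddCommGroup W] [Module 𝕜 W]

theorem symMap_comp {X : Type*} [AddCommGroup X] [Module 𝕜 X] (g : W →ₗ[𝕜] X) (f : V →ₗ[𝕜] W) :
    symMap 𝕜 (g ∘ₗ f) = symMap 𝕜 g ∘ₗ symMap 𝕜 f :=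
  symAlg_ext_symPow fun v k => by
    rw [symMap_symPow, LinearMap.comp_apply, LinearMap.comp_apply, symMap_symPow, symMap_symPow]

theorem symMap_symOne (f : V →ₗ[𝕜] W) : symMap 𝕜 f (symOne 𝕜 V) = symOne 𝕜 W := by
  rw [← symPow_zero 0, symMap_symPow, symPow_zero]

theorem symMap_symι (f : V →ₗ[𝕜] W) (v : V) : symMap 𝕜 f (symι 𝕜 V v) = symι 𝕜 W (f v) := by
  have h : ∀ {X : Type _} [AddCommGroup X] [Module 𝕜 X] (v : X), symι 𝕜 X v = symPow 𝕜 v 1 := by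
    intro X _ _ v
    rw [← sym_pow, pow_one]
    rfl
  rw [h, symMap_symPow, ← sym_pow, pow_one]
  rfl

theorem symComul_symMap (f : V →ₗ[𝕜] W) (x : SymAlg 𝕜 V) : symComul 𝕜 W (symMap 𝕜 f x) =
    TensorProduct.map (symMap 𝕜 f) (symMap 𝕜 f) (symComul 𝕜 V x) := by
  suffices h : symComul 𝕜 W ∘ₗ symMap 𝕜 f =
      (TensorProduct.map (symMap 𝕜 f) (symMap 𝕜 f) :
        SymAlg 𝕜 V ⊗[𝕜] SymAlg 𝕜 V →ₗ[𝕜] SymAlg 𝕜 W ⊗[𝕜] SymAlg 𝕜 W) ∘ₗ symComul 𝕜 V from congr($h x)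
  refine symAlg_ext_symPow (M := SymAlg 𝕜 W ⊗[𝕜] SymAlg 𝕜 W) fun v k => ?_
  simp [symMap_symPow, symComul_symPow]

theorem symCounit_symMap (f : V →ₗ[𝕜] W) (x : SymAlg 𝕜 V) :
    symCounit 𝕜 W (symMap 𝕜 f x) = symCounit 𝕜 V x := by
  suffices h : symCounit 𝕜 W ∘ₗ symMap 𝕜 f = symCounit 𝕜 V from congr($h x)
  refine symAlg_ext_symPow fun v k => ?_
  rw [LinearMap.comp_apply, symMap_symPow, symCounit_symPow, symCounit_symPow]

theorem symAntipode_symMap (f : V →ₗ[𝕜] W) (x : SymAlg 𝕜 V) :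
    symAntipode 𝕜 W (symMap 𝕜 f x) = symMap 𝕜 f (symAntipode 𝕜 V x) := by
  suffices h : symAntipode 𝕜 W ∘ₗ symMap 𝕜 f = symMap 𝕜 f ∘ₗ symAntipode 𝕜 V from congr($h x)
  refine symAlg_ext_symPow fun v k => ?_
  rw [LinearMap.comp_apply, LinearMap.comp_apply, symMap_symPow, symAntipode_symPow,
    symAntipode_symPow, map_smul, symMap_symPow]

theorem symCounit_symComul (x : SymAlg 𝕜 V) :
    TensorProduct.map (symCounit 𝕜 V) LinearMap.id (symComul 𝕜 V x) = 1 ⊗ₜ x := by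
  suffices h : TensorProduct.map (symCounit 𝕜 V) (LinearMap.id (M := SymAlg 𝕜 V)) ∘ₗ symComul 𝕜 V =
      TensorProduct.mk 𝕜 𝕜 (SymAlg 𝕜 V) 1 from congr($h x)
  refine symAlg_ext_symPow fun v k => ?_
  rw [LinearMap.comp_apply, symComul_symPow, map_sum, Finset.sum_range_succ', Finset.sum_eq_zero]
  · simp [symCounit_symPow]
  · intro m _
    simp [symCounit_symPow]

theorem symComul_symCounit (x : SymAlg 𝕜 V) :
    TensorProduct.map LinearMap.id (symCounit 𝕜 V) (symComul 𝕜 V x) = x ⊗ₜ 1 := by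
  suffices h : TensorProduct.map (LinearMap.id (M := SymAlg 𝕜 V)) (symCounit 𝕜 V) ∘ₗ symComul 𝕜 V =
      (TensorProduct.mk 𝕜 (SymAlg 𝕜 V) 𝕜).flip 1 from congr($h x)
  refine symAlg_ext_symPow (M := SymAlg 𝕜 V ⊗[𝕜] 𝕜) fun v k => ?_
  rw [LinearMap.comp_apply, symComul_symPow, map_sum, Finset.sum_range_succ, Finset.sum_eq_zero]
  · simp [symCounit_symPow]
  · intro m hm
    have hm := Finset.mem_range.1 hm
    simp [symCounit_symPow, zero_pow (by omega : k - m ≠ 0)]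

theorem symCounit_symOne : symCounit 𝕜 V (symOne 𝕜 V) = 1 := by
  rw [← symPow_zero 0, symCounit_symPow, pow_zero]

end Module

variable {𝔤 : Type*} [LieRing 𝔤] [LieAlgebra 𝕜 𝔤]

theorem starι_pow' (z : 𝕜) (η : 𝔤) (k : ℕ) : starι z η ^ k = toStarAlg z (symPow 𝕜 η k) :=
  starι_pow z η k

theorem starProd_assoc (z : 𝕜) (x y w : SymAlg 𝕜 𝔤) :
    starProd 𝔤 z (starProd 𝔤 z x y) w = starProd 𝔤 z x (starProd 𝔤 z y w) :=
  mul_assoc (toStarAlg z x) (toStarAlg z y) (toStarAlg z w)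

theorem symOne_eq : symOne 𝕜 𝔤 = symEquiv 𝕜 𝔤 1 := by
  rw [← symPow_zero 0, symPow, pow_zero]

theorem symOne_starProd (z : 𝕜) (x : SymAlg 𝕜 𝔤) : starProd 𝔤 z (symOne 𝕜 𝔤) x = x := by
  rw [symOne_eq]
  exact one_mul (toStarAlg z x)

theorem starProd_symOne (z : 𝕜) (x : SymAlg 𝕜 𝔤) : starProd 𝔤 z x (symOne 𝕜 𝔤) = x := by
  rw [symOne_eq]
  exact mul_one (toStarAlg z x)

theorem starProd_symPow_symPow (z : 𝕜) (η : 𝔤) (k l : ℕ) :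
    starProd 𝔤 z (symPow 𝕜 η k) (symPow 𝕜 η l) = symPow 𝕜 η (k + l) := by
  rw [symPow, symPow, starProd_symEquiv, starMul_pow_pow, symPow]

/-- The universal property provides an algebra homomorphism extending `f`; it agrees with `symMap`
on powers. -/
theorem symMap_starProd {𝔥 : Type*} [LieRing 𝔥] [LieAlgebra 𝕜 𝔥] (f : 𝔤 →ₗ⁅𝕜⁆ 𝔥) (z : 𝕜)
    (x y : SymAlg 𝕜 𝔤) : symMap 𝕜 f.toLinearMap (starProd 𝔤 z x y) =
      starProd 𝔥 z (symMap 𝕜 f.toLinearMap x) (symMap 𝕜 f.toLinearMap y) := by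
  let F : StarAlg z 𝔤 →ₐ[𝕜] StarAlg z 𝔥 := starLift z (starι z ∘ₗ f.toLinearMap) fun ξ ζ => by
    simp only [LinearMap.comp_apply, starι_lie]
    simp
  have hF : ∀ x, F (toStarAlg z x) = toStarAlg z (symMap 𝕜 f.toLinearMap x) := by
    intro x
    suffices h : F.toLinearMap ∘ₗ (toStarAlg z).toLinearMap =
      (toStarAlg z).toLinearMap ∘ₗ symMap 𝕜 f.toLinearMap from congr($h x)
    refine symAlg_ext_symPow fun v k => ?_
    simp only [LinearMap.comp_apply, LinearEquiv.coe_coe, AlgHom.toLinearMap_apply, symMap_symPow]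
    rw [← starι_pow', ← starι_pow', map_pow, starLift_ι]
    rfl
  apply (toStarAlg z).injective
  rw [← hF, ← toStarAlg_mul, map_mul, hF, hF, toStarAlg_mul]

theorem symCounit_starProd (z : 𝕜) (x y : SymAlg 𝕜 𝔤) :
    symCounit 𝕜 𝔤 (starProd 𝔤 z x y) = symCounit 𝕜 𝔤 x * symCounit 𝕜 𝔤 y := by
  let F : StarAlg z 𝔤 →ₐ[𝕜] 𝕜 := starLift z 0 fun ξ ζ => by simp
  have hF : ∀ x, F (toStarAlg z x) = symCounit 𝕜 𝔤 x := by
    intro x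
    suffices h : F.toLinearMap ∘ₗ (toStarAlg z).toLinearMap = symCounit 𝕜 𝔤 from congr($h x)
    refine symAlg_ext_symPow fun v k => ?_
    simp only [LinearMap.comp_apply, LinearEquiv.coe_coe, AlgHom.toLinearMap_apply]
    rw [← starι_pow', map_pow, starLift_ι, symCounit_symPow]
    rfl
  rw [← hF, ← toStarAlg_mul, map_mul, hF, hF]

/-- The coproduct as a homomorphism of star product algebras. -/
def comulHom (z : 𝕜) : StarAlg z 𝔤 →ₐ[𝕜] StarAlg z 𝔤 ⊗[𝕜] StarAlg z 𝔤 :=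
  starLift z ((TensorProduct.mk 𝕜 (StarAlg z 𝔤) (StarAlg z 𝔤)).flip 1 ∘ₗ starι z +
    TensorProduct.mk 𝕜 (StarAlg z 𝔤) (StarAlg z 𝔤) 1 ∘ₗ starι z) fun ξ ζ => by
      simp only [LinearMap.add_apply, LinearMap.comp_apply, LinearMap.flip_apply,
        TensorProduct.mk_apply, add_mul, mul_add, Algebra.TensorProduct.tmul_mul_tmul, one_mul,
        mul_one, smul_add]
      rw [← TensorProduct.tmul_smul z 1 (starι z ⁅ξ, ζ⁆),
        TensorProduct.smul_tmul' z (starι z ⁅ξ, ζ⁆), ← starι_lie, TensorProduct.sub_tmul, TensorProduct.tmul_sub]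
      abel

theorem comulHom_ι (z : 𝕜) (ξ : 𝔤) :
    comulHom z (starι z ξ) = starι z ξ ⊗ₜ 1 + 1 ⊗ₜ starι z ξ := starLift_ι ..

theorem comulHom_toStarAlg (z : 𝕜) (x : SymAlg 𝕜 𝔤) : comulHom z (toStarAlg z x) =
    TensorProduct.map (toStarAlg z).toLinearMap (toStarAlg z).toLinearMap (symComul 𝕜 𝔤 x) := by
  suffices h : (comulHom z).toLinearMap ∘ₗ (toStarAlg z).toLinearMap =
      TensorProduct.map (toStarAlg z).toLinearMap (toStarAlg z).toLinearMap ∘ₗ symComul 𝕜 𝔤 from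
    congr($h x)
  refine symAlg_ext_symPow fun v k => ?_
  rw [LinearMap.comp_apply, LinearMap.comp_apply, symComul_symPow, AlgHom.toLinearMap_apply,
    LinearEquiv.coe_coe, ← starι_pow', map_pow, comulHom_ι]
  have hc : Commute ((starι z v) ⊗ₜ[𝕜] (1 : StarAlg z 𝔤)) ((1 : StarAlg z 𝔤) ⊗ₜ[𝕜] (starι z v)) := by
    simp [commute_iff_eq]
  rw [hc.add_pow k, map_sum]
  refine Finset.sum_congr rfl fun m _ => ?_
  rw [← nsmul_eq_mul', ← Nat.cast_smul_eq_nsmul 𝕜, map_smul]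
  simp [starι_pow']

/-- `comulHom` is multiplicative by construction and agrees with the undeformed coproduct on powers,
by the binomial theorem for the commuting elements `v ⊗ 1` and `1 ⊗ v`. -/
theorem symComul_starProd (z : 𝕜) (x y : SymAlg 𝕜 𝔤) : symComul 𝕜 𝔤 (starProd 𝔤 z x y) =
    TensorProduct.map (TensorProduct.lift (starProd 𝔤 z)) (TensorProduct.lift (starProd 𝔤 z))
      (TensorProduct.tensorTensorTensorComm 𝕜 _ _ _ _ (symComul 𝕜 𝔤 x ⊗ₜ symComul 𝕜 𝔤 y)) := by
  have hinj : Function.Injective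
      (TensorProduct.congr (toStarAlg (𝔤 := 𝔤) z) (toStarAlg (𝔤 := 𝔤) z)) :=
    LinearEquiv.injective _
  apply hinj
  have h1 : ∀ t, TensorProduct.congr (toStarAlg (𝔤 := 𝔤) z) (toStarAlg (𝔤 := 𝔤) z) t =
    TensorProduct.map (toStarAlg z).toLinearMap (toStarAlg z).toLinearMap t := fun t => rfl
  have h2 : ∀ s t : SymAlg 𝕜 𝔤 ⊗[𝕜] SymAlg 𝕜 𝔤,
      TensorProduct.map (toStarAlg z).toLinearMap (toStarAlg z).toLinearMap
        (TensorProduct.map (TensorProduct.lift (starProd 𝔤 z)) (TensorProduct.lift (starProd 𝔤 z))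
          (TensorProduct.tensorTensorTensorComm 𝕜 _ _ _ _ (s ⊗ₜ t))) =
      TensorProduct.map (toStarAlg z).toLinearMap (toStarAlg z).toLinearMap s *
        TensorProduct.map (toStarAlg z).toLinearMap (toStarAlg z).toLinearMap t := by
    intro s t
    induction s using TensorProduct.induction_on with
    | zero => simp
    | add s s' hs hs' => simp only [TensorProduct.add_tmul, map_add, hs, hs', add_mul]
    | tmul a b =>
      induction t using TensorProduct.induction_on with
      | zero => simp
      | add s s' hs hs' => simp only [TensorProduct.tmul_add, map_add, hs, hs', mul_add]
      | tmul c d => simp [toStarAlg_mul]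
  rw [h1, h1, h2, ← comulHom_toStarAlg, ← comulHom_toStarAlg, ← comulHom_toStarAlg, ← map_mul,
    toStarAlg_mul]

theorem symComul_coassoc (x : SymAlg 𝕜 𝔤) :
    TensorProduct.assoc 𝕜 _ _ _ (TensorProduct.map (symComul 𝕜 𝔤) LinearMap.id (symComul 𝕜 𝔤 x)) =
      TensorProduct.map LinearMap.id (symComul 𝕜 𝔤) (symComul 𝕜 𝔤 x) := by
  -- Coassociativity does not involve `z`. With the product for `z = 0` both sides are algebra
  -- homomorphisms, so it suffices to compare them on generators.
  have hAlg : ((Algebra.TensorProduct.assoc 𝕜 𝕜 𝕜 (StarAlg (0 : 𝕜) 𝔤) (StarAlg (0 : 𝕜) 𝔤)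
      (StarAlg (0 : 𝕜) 𝔤)).toAlgHom.comp
      (Algebra.TensorProduct.map (comulHom (0 : 𝕜)) (AlgHom.id 𝕜 (StarAlg (0 : 𝕜) 𝔤)))).comp (comulHom (0 : 𝕜)) =
      (Algebra.TensorProduct.map (AlgHom.id 𝕜 (StarAlg (0 : 𝕜) 𝔤)) (comulHom (0 : 𝕜))).comp (comulHom (0 : 𝕜)) := by
    refine starAlg_algHom_ext fun η => ?_
    simp [comulHom_ι, TensorProduct.add_tmul, TensorProduct.tmul_add, Algebra.TensorProduct.one_def,
      add_assoc]
  set θ := TensorProduct.map (toStarAlg (0 : 𝕜) (𝔤 := 𝔤)).toLinearMap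
    (toStarAlg (0 : 𝕜) (𝔤 := 𝔤)).toLinearMap with hθ
  have hinj : Function.Injective (TensorProduct.congr (toStarAlg (𝔤 := 𝔤) (0 : 𝕜))
      (TensorProduct.congr (toStarAlg (𝔤 := 𝔤) (0 : 𝕜)) (toStarAlg (𝔤 := 𝔤) (0 : 𝕜)))) :=
    LinearEquiv.injective _
  have hΔ : ∀ x, comulHom (0 : 𝕜) (toStarAlg 0 x) = θ (symComul 𝕜 𝔤 x) := comulHom_toStarAlg 0
  apply hinj
  have h0 : ∀ (s : SymAlg 𝕜 𝔤 ⊗[𝕜] SymAlg 𝕜 𝔤) (b : SymAlg 𝕜 𝔤),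
      TensorProduct.congr (toStarAlg (𝔤 := 𝔤) (0 : 𝕜))
        (TensorProduct.congr (toStarAlg (𝔤 := 𝔤) (0 : 𝕜)) (toStarAlg (𝔤 := 𝔤) (0 : 𝕜)))
          (TensorProduct.assoc 𝕜 _ _ _ (s ⊗ₜ b)) =
      Algebra.TensorProduct.assoc 𝕜 𝕜 𝕜 _ _ _ (θ s ⊗ₜ toStarAlg 0 b) := by
    intro s b
    induction s using TensorProduct.induction_on with
    | zero => simp
    | add s s' hs hs' => simp only [TensorProduct.add_tmul, map_add, hs, hs']
    | tmul c d => simp [hθ]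
  have h1 : ∀ t, TensorProduct.congr (toStarAlg (𝔤 := 𝔤) (0 : 𝕜))
        (TensorProduct.congr (toStarAlg (𝔤 := 𝔤) (0 : 𝕜)) (toStarAlg (𝔤 := 𝔤) (0 : 𝕜)))
      (TensorProduct.assoc 𝕜 _ _ _ (TensorProduct.map (symComul 𝕜 𝔤) LinearMap.id t)) =
      Algebra.TensorProduct.assoc 𝕜 𝕜 𝕜 _ _ _
        (Algebra.TensorProduct.map (comulHom (0 : 𝕜)) (AlgHom.id 𝕜 (StarAlg (0 : 𝕜) 𝔤)) (θ t)) := by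
    intro t
    induction t using TensorProduct.induction_on with
    | zero => simp
    | add s s' hs hs' => simp only [map_add, hs, hs']
    | tmul a b =>
      rw [TensorProduct.map_tmul, h0, ← hΔ]
      rfl
  have h2 : ∀ t, TensorProduct.congr (toStarAlg (𝔤 := 𝔤) (0 : 𝕜))
        (TensorProduct.congr (toStarAlg (𝔤 := 𝔤) (0 : 𝕜)) (toStarAlg (𝔤 := 𝔤) (0 : 𝕜)))
      (TensorProduct.map LinearMap.id (symComul 𝕜 𝔤) t) =
        (Algebra.TensorProduct.map (AlgHom.id 𝕜 (StarAlg (0 : 𝕜) 𝔤)) (comulHom (0 : 𝕜)) (θ t)) := by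
    intro t
    induction t using TensorProduct.induction_on with
    | zero => simp
    | add s s' hs hs' => simp only [map_add, hs, hs']
    | tmul a b =>
      rw [TensorProduct.map_tmul, TensorProduct.congr_tmul]
      change _ ⊗ₜ θ (symComul 𝕜 𝔤 b) = _
      rw [← hΔ]
      rfl
  rw [h1, h2, ← hΔ]
  exact congr($hAlg (toStarAlg 0 x))

/-- For a power `v ^ k` all products involve only powers of `v`, where the star product is
undeformed, and the sum becomes `(-1 + 1) ^ k` times `v ^ k`. -/
theorem starProd_symAntipode_left (z : 𝕜) (x : SymAlg 𝕜 𝔤) :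
    TensorProduct.lift (starProd 𝔤 z)
      (TensorProduct.map (symAntipode 𝕜 𝔤) LinearMap.id (symComul 𝕜 𝔤 x)) =
      symCounit 𝕜 𝔤 x • symOne 𝕜 𝔤 := by
  suffices h : TensorProduct.lift (starProd 𝔤 z) ∘ₗ
      TensorProduct.map (symAntipode 𝕜 𝔤) LinearMap.id ∘ₗ symComul 𝕜 𝔤 =
      (symCounit 𝕜 𝔤).smulRight (symOne 𝕜 𝔤) from congr($h x)
  refine symAlg_ext_symPow fun v k => ?_
  simp only [LinearMap.comp_apply, symComul_symPow, map_sum, map_smul, TensorProduct.map_tmul,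
    symAntipode_symPow, LinearMap.id_apply, TensorProduct.lift.tmul, LinearMap.smul_apply,
    starProd_symPow_symPow, LinearMap.smulRight_apply, symCounit_symPow]
  have h := add_pow (-1 : 𝕜) 1 k
  rw [neg_add_cancel] at h
  rw [h, Finset.sum_smul]
  rcases k.eq_zero_or_pos with rfl | hk
  · simp [symPow_zero]
  · rw [zero_pow hk.ne'] at h
    rw [← Finset.sum_smul, ← h, zero_smul]
    rw [Finset.sum_congr rfl (g := fun m => ((-1 : 𝕜) ^ m * 1 ^ (k - m) * (k.choose m : 𝕜)) •
      symPow 𝕜 v k), ← Finset.sum_smul, ← h, zero_smul]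
    intro m hm
    have hm := Finset.mem_range.1 hm
    rw [smul_smul, show m + (k - m) = k by omega, one_pow, mul_one, mul_comm]

theorem starProd_symAntipode_right (z : 𝕜) (x : SymAlg 𝕜 𝔤) :
    TensorProduct.lift (starProd 𝔤 z)
      (TensorProduct.map LinearMap.id (symAntipode 𝕜 𝔤) (symComul 𝕜 𝔤 x)) =
      symCounit 𝕜 𝔤 x • symOne 𝕜 𝔤 := by
  suffices h : TensorProduct.lift (starProd 𝔤 z) ∘ₗ
      TensorProduct.map LinearMap.id (symAntipode 𝕜 𝔤) ∘ₗ symComul 𝕜 𝔤 =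
      (symCounit 𝕜 𝔤).smulRight (symOne 𝕜 𝔤) from congr($h x)
  refine symAlg_ext_symPow fun v k => ?_
  simp only [LinearMap.comp_apply, symComul_symPow, map_sum, map_smul, TensorProduct.map_tmul,
    symAntipode_symPow, LinearMap.id_apply, TensorProduct.lift.tmul,
    starProd_symPow_symPow, LinearMap.smulRight_apply, symCounit_symPow]
  have h := add_pow (1 : 𝕜) (-1) k
  rw [add_neg_cancel] at h
  rw [h, Finset.sum_smul]
  rcases k.eq_zero_or_pos with rfl | hk
  · simp [symPow_zero]
  · rw [zero_pow hk.ne'] at h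
    rw [← Finset.sum_smul, ← h, zero_smul]
    rw [Finset.sum_congr rfl (g := fun m => ((1 : 𝕜) ^ m * (-1) ^ (k - m) * (k.choose m : 𝕜)) •
      symPow 𝕜 v k), ← Finset.sum_smul, ← h, zero_smul]
    intro m hm
    have hm := Finset.mem_range.1 hm
    rw [smul_smul, show m + (k - m) = k by omega, one_pow, one_mul, mul_comm]

end Hopf

/-! ### Bracket words and the lower central series. -/

section Words

theorem length_of {α : Type*} (x : α) : (FreeMagma.of x).length = 1 := rfl

theorem length_mul {α : Type*} (a b : FreeMagma α) : (a * b).length = a.length + b.length := rfl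

theorem length_pos {α : Type*} (w : FreeMagma α) : 0 < w.length := by
  induction w with
  | ih1 x => exact Nat.one_pos
  | ih2 a b iha ihb => exact Nat.add_pos_left iha _

variable {𝕜 : Type*} [RCLike 𝕜] {𝔤 : Type*} [LieRing 𝔤] [LieAlgebra 𝕜 𝔤]

theorem bracketWord_mul (a b : FreeMagma 𝔤) : bracketWord (a * b) = ⁅bracketWord a, bracketWord b⁆ :=
  rfl

theorem letterProd_mul (q : Seminorm 𝕜 𝔤) (a b : FreeMagma 𝔤) :
    letterProd q (a * b) = letterProd q a * letterProd q b := rfl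

theorem letterProd_nonneg (q : Seminorm 𝕜 𝔤) (w : FreeMagma 𝔤) : 0 ≤ letterProd q w := by
  induction w with
  | ih1 x => exact apply_nonneg q x
  | ih2 a b iha ihb => exact mul_nonneg iha ihb

variable (𝕜) in
-- Induction on `i` through the Jacobi identity. The series is indexed from `0`, which accounts for
-- the `+ 1`.
theorem lie_mem_lowerCentralSeries {i j : ℕ} {a b : 𝔤}
    (ha : a ∈ LieModule.lowerCentralSeries 𝕜 𝔤 𝔤 i) (hb : b ∈ LieModule.lowerCentralSeries 𝕜 𝔤 𝔤 j) :
    ⁅a, b⁆ ∈ LieModule.lowerCentralSeries 𝕜 𝔤 𝔤 (i + j + 1) := by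
  have hlie : ∀ {k : ℕ} (x : 𝔤) {c : 𝔤}, c ∈ LieModule.lowerCentralSeries 𝕜 𝔤 𝔤 k →
      ⁅x, c⁆ ∈ LieModule.lowerCentralSeries 𝕜 𝔤 𝔤 (k + 1) := fun x c hc => by
    rw [LieModule.lowerCentralSeries_succ]
    exact LieSubmodule.lie_mem_lie (LieSubmodule.mem_top x) hc
  induction i generalizing j a b with
  | zero => simpa using hlie a hb
  | succ i ih =>
    rw [LieModule.lowerCentralSeries_succ, ← LieSubmodule.mem_toSubmodule,
      LieSubmodule.lieIdeal_oper_eq_linear_span'] at ha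
    induction ha using Submodule.span_induction with
    | mem y hy =>
      obtain ⟨x, -, c, hc, rfl⟩ := hy
      rw [lie_lie]
      refine sub_mem ?_ ?_
      · have := hlie x (ih hc hb)
        rwa [show i + 1 + j + 1 = i + j + 1 + 1 by omega]
      · have := ih hc (hlie x hb)
        rwa [show i + 1 + j + 1 = i + (j + 1) + 1 by omega]
    | zero => simp
    | add x y _ _ hx hy => rw [add_lie]; exact add_mem hx hy
    | smul c x _ hx => rw [smul_lie]; exact SMulMemClass.smul_mem c hx

variable (𝕜) in
theorem bracketWord_mem_lowerCentralSeries (w : FreeMagma 𝔤) :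
    bracketWord w ∈ LieModule.lowerCentralSeries 𝕜 𝔤 𝔤 (w.length - 1) := by
  induction w with
  | ih1 x => simp
  | ih2 a b iha ihb =>
    have := lie_mem_lowerCentralSeries 𝕜 iha ihb
    have ha := length_pos a
    have hb := length_pos b
    rwa [show a.length - 1 + (b.length - 1) + 1 = (a * b).length - 1 by rw [length_mul]; omega] at this

theorem bracketWord_eq_zero {N : ℕ} (hnil : LieModule.lowerCentralSeries 𝕜 𝔤 𝔤 N = ⊥)
    {w : FreeMagma 𝔤} (hw : N < w.length) : bracketWord w = 0 := by
  have h := LieModule.antitone_lowerCentralSeries 𝕜 𝔤 𝔤 (show N ≤ w.length - 1 by omega)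
    (bracketWord_mem_lowerCentralSeries 𝕜 w)
  rw [hnil] at h
  exact (LieSubmodule.mem_bot _).1 h

end Words

/-! ### Linear combinations with controlled total weight. -/

section Hull

variable {𝕜 : Type*} [NormedField 𝕜] {E F : Type*} [AddCommGroup E] [Module 𝕜 E] [AddCommGroup F]
  [Module 𝕜 F]

/-- `Hull G c x`: the vector `x` is a linear combination of vectors `xⱼ` with `G cⱼ xⱼ` and
coefficients `aⱼ` such that `∑ⱼ |aⱼ| cⱼ ≤ c`. -/
inductive Hull (G : ℝ → E → Prop) : ℝ → E → Prop
  | of {c x} (h : G c x) : Hull G c x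
  | zero : Hull G 0 0
  | add {c x c' x'} (h : Hull G c x) (h' : Hull G c' x') : Hull G (c + c') (x + x')
  | smul {c x} (a : 𝕜) (h : Hull G c x) : Hull G (‖a‖ * c) (a • x)
  | mono {c c' x} (h : Hull G c x) (hc : c ≤ c') : Hull G c' x

namespace Hull

variable {G : ℝ → E → Prop} {G' : ℝ → F → Prop}

theorem map (f : E →ₗ[𝕜] F) (k : ℝ) (hk : 0 ≤ k)
    (hf : ∀ c x, G c x → Hull (𝕜 := 𝕜) G' (k * c) (f x)) {c : ℝ} {x : E} (h : Hull (𝕜 := 𝕜) G c x) :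
    Hull (𝕜 := 𝕜) G' (k * c) (f x) := by
  induction h with
  | of h => exact hf _ _ h
  | zero => simpa using Hull.zero
  | add _ _ h h' => rw [map_add, mul_add]; exact h.add h'
  | smul a _ h => rw [map_smul, mul_left_comm]; exact h.smul a
  | mono _ hc h => exact h.mono (mul_le_mul_of_nonneg_left hc hk)

theorem sum {ι : Type*} (s : Finset ι) {c : ι → ℝ} {x : ι → E}
    (h : ∀ i ∈ s, Hull (𝕜 := 𝕜) G (c i) (x i)) : Hull (𝕜 := 𝕜) G (∑ i ∈ s, c i) (∑ i ∈ s, x i) := by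
  classical
  induction s using Finset.induction_on with
  | empty => simpa using Hull.zero
  | insert i s hi ih =>
    rw [Finset.sum_insert hi, Finset.sum_insert hi]
    exact (h i (Finset.mem_insert_self i s)).add (ih fun j hj => h j (Finset.mem_insert_of_mem hj))

theorem seminorm_le (s : Seminorm 𝕜 E) (k : ℝ) (hk : 0 ≤ k) (hs : ∀ c x, G c x → s x ≤ k * c) {c : ℝ}
    {x : E} (h : Hull (𝕜 := 𝕜) G c x) : s x ≤ k * c := by
  induction h with
  | of h => exact hs _ _ h
  | zero => simp
  | add _ _ h h' => rw [mul_add]; exact (map_add_le_add s _ _).trans (add_le_add h h')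
  | smul a _ h =>
    rw [map_smul_eq_mul, mul_left_comm]
    exact mul_le_mul_of_nonneg_left h (norm_nonneg a)
  | mono _ hc h => exact h.trans (mul_le_mul_of_nonneg_left hc hk)

theorem mem (W : Submodule 𝕜 E) (hW : ∀ c x, G c x → x ∈ W) {c : ℝ} {x : E}
    (h : Hull (𝕜 := 𝕜) G c x) : x ∈ W := by
  induction h with
  | of h => exact hW _ _ h
  | zero => exact W.zero_mem
  | add _ _ h h' => exact W.add_mem h h'
  | smul a _ h => exact W.smul_mem a h
  | mono _ _ h => exact h

end Hull

end Hull

/-! ### Contractions of products of bracket words. -/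

section WordProducts

variable {𝕜 : Type*} [RCLike 𝕜] {𝔤 : Type*} [LieRing 𝔤] [LieAlgebra 𝕜 𝔤]

variable (𝕜) in
/-- The product of the values of a list of bracket expressions. -/
def wordsProd (L : List (FreeMagma 𝔤)) : SymmetricAlgebra 𝕜 𝔤 :=
  (L.map fun w => SymmetricAlgebra.ι 𝕜 𝔤 (bracketWord w)).prod

/-- The product of the `letterProd`s of a list of bracket expressions. -/
def lettersProd (q : Seminorm 𝕜 𝔤) (L : List (FreeMagma 𝔤)) : ℝ := (L.map (letterProd q)).prod

/-- `x` is a product of `m` bracket expressions with `d` letters altogether, and `c` is the product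
of the values of `q` on these letters. -/
def IsWordProd (q : Seminorm 𝕜 𝔤) (m d : ℕ) (c : ℝ) (x : SymmetricAlgebra 𝕜 𝔤) : Prop :=
  ∃ L : List (FreeMagma 𝔤), L.length = m ∧ (L.map FreeMagma.length).sum = d ∧
    c = lettersProd q L ∧ x = wordsProd 𝕜 L

/-- The variant of `IsWordProd` with a marked last bracket expression. -/
def IsWordTensor (q : Seminorm 𝕜 𝔤) (m d : ℕ) (c : ℝ) (t : SymmetricAlgebra 𝕜 𝔤 ⊗[𝕜] 𝔤) : Prop :=
  ∃ (L : List (FreeMagma 𝔤)) (w : FreeMagma 𝔤), L.length = m ∧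
    (L.map FreeMagma.length).sum + w.length = d ∧ c = lettersProd q L * letterProd q w ∧
    t = wordsProd 𝕜 L ⊗ₜ bracketWord w

/-- Contraction lets the marked word absorb each of the `m` other words in turn: `m` terms, one word
fewer, and the same letters in each term. -/
theorem contract_hull_of_isWordTensor (q : Seminorm 𝕜 𝔤) {m d : ℕ} {c : ℝ}
    {t : SymmetricAlgebra 𝕜 𝔤 ⊗[𝕜] 𝔤} (h : IsWordTensor q m d c t) :
    Hull (𝕜 := 𝕜) (IsWordTensor q (m - 1) d) (m * c) (contract 𝕜 𝔤 t) := by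
  obtain ⟨L, w, rfl, rfl, rfl, rfl⟩ := h
  induction L with
  | nil => simpa [wordsProd, contract_one_tmul] using Hull.zero
  | cons v L ih =>
    have hw : wordsProd 𝕜 (v :: L) = SymmetricAlgebra.ι 𝕜 𝔤 (bracketWord v) * wordsProd 𝕜 L := by
      simp [wordsProd]
    have hl : lettersProd q (v :: L) = letterProd q v * lettersProd q L := by simp [lettersProd]
    rw [hw, contract_ι_mul_tmul, List.length_cons, Nat.add_sub_cancel]
    have h1 : Hull (𝕜 := 𝕜) (IsWordTensor q L.length
        (((v :: L).map FreeMagma.length).sum + w.length)) (lettersProd q (v :: L) * letterProd q w)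
        (wordsProd 𝕜 L ⊗ₜ[𝕜] ⁅bracketWord v, bracketWord w⁆) := by
      refine .of ⟨L, v * w, rfl, ?_, ?_, rfl⟩
      · rw [length_mul, List.map_cons, List.sum_cons]
        omega
      · rw [hl, letterProd_mul]
        ring
    have h2 : Hull (𝕜 := 𝕜) (IsWordTensor q L.length
        (((v :: L).map FreeMagma.length).sum + w.length))
        (letterProd q v * (L.length * (lettersProd q L * letterProd q w)))
        (SymmetricAlgebra.ι 𝕜 𝔤 (bracketWord v) • contract 𝕜 𝔤 (wordsProd 𝕜 L ⊗ₜ[𝕜] bracketWord w)) := by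
      -- For the empty list the contraction vanishes. It is split off because the truncated
      -- `L.length - 1` followed by adding a word gives back `L.length` only for nonempty lists.
      rcases L with - | ⟨u, L⟩
      · simpa [wordsProd, contract_one_tmul] using Hull.zero
      refine Hull.map (Algebra.lsmul 𝕜 𝕜 (SymmetricAlgebra 𝕜 𝔤 ⊗[𝕜] 𝔤)
        (SymmetricAlgebra.ι 𝕜 𝔤 (bracketWord v))) _ (letterProd_nonneg q v) ?_ ih
      rintro c t ⟨L', w', hm, hd, rfl, rfl⟩
      refine .of ⟨v :: L', w', ?_, ?_, ?_, ?_⟩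
      · simp [hm]
      · rw [List.map_cons, List.sum_cons, add_assoc, hd, List.map_cons (l := u :: L), List.sum_cons,
          add_assoc]
      · simp [lettersProd, mul_assoc]
      · simp [wordsProd, TensorProduct.smul_tmul']
    refine (h1.add h2).mono (le_of_eq ?_)
    rw [hl]
    push_cast
    ring

/-- The number of available factors drops by one with each contraction, so the weights multiply to a
falling factorial. -/
theorem contract_pow_hull (q : Seminorm 𝕜 𝔤) {m d : ℕ} {c : ℝ} {t : SymmetricAlgebra 𝕜 𝔤 ⊗[𝕜] 𝔤}
    (h : Hull (𝕜 := 𝕜) (IsWordTensor q m d) c t) (r : ℕ) :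
    Hull (𝕜 := 𝕜) (IsWordTensor q (m - r) d) (m.descFactorial r * c) ((contract 𝕜 𝔤 ^ r) t) := by
  induction r with
  | zero => simpa using h
  | succ r ih =>
    rw [pow_succ', Module.End.mul_apply, Nat.descFactorial_succ, Nat.cast_mul, mul_assoc,
      show m - (r + 1) = m - r - 1 by omega]
    exact Hull.map _ _ (Nat.cast_nonneg _) (fun c x => contract_hull_of_isWordTensor q) ih

theorem contract_eq_zero_of_hull (q : Seminorm 𝕜 𝔤) {d : ℕ} {c : ℝ}
    {t : SymmetricAlgebra 𝕜 𝔤 ⊗[𝕜] 𝔤} (h : Hull (𝕜 := 𝕜) (IsWordTensor q 0 d) c t) :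
    contract 𝕜 𝔤 t = 0 := by
  refine h.mem (LinearMap.ker (contract 𝕜 𝔤)) ?_
  rintro c x ⟨L, w, hL, -, -, rfl⟩
  rw [List.length_eq_zero_iff.1 hL]
  simp [wordsProd, contract_one_tmul]

theorem contract_pow_eq_zero_of_hull (q : Seminorm 𝕜 𝔤) {m d : ℕ} {c : ℝ}
    {t : SymmetricAlgebra 𝕜 𝔤 ⊗[𝕜] 𝔤} (h : Hull (𝕜 := 𝕜) (IsWordTensor q m d) c t) {r : ℕ}
    (hr : m < r) : (contract 𝕜 𝔤 ^ r) t = 0 := by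
  obtain ⟨k, rfl⟩ := Nat.exists_eq_add_of_lt hr
  have h0 := contract_pow_hull q h m
  rw [Nat.sub_self] at h0
  rw [show m + k + 1 = k + 1 + m by omega, pow_add, pow_succ, Module.End.mul_apply,
    Module.End.mul_apply, contract_eq_zero_of_hull q h0, map_zero]

variable (𝕜) in
/-- The homogeneous part of degree `r` in `z` of left multiplication with `ξ`,
without the Bernoulli number. -/
def contractMul (r : ℕ) (ξ : 𝔤) : SymmetricAlgebra 𝕜 𝔤 →ₗ[𝕜] SymmetricAlgebra 𝕜 𝔤 :=
  mulι 𝕜 𝔤 ∘ₗ (contract 𝕜 𝔤 ^ r) ∘ₗ (TensorProduct.mk 𝕜 (SymmetricAlgebra 𝕜 𝔤) 𝔤).flip ξ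

theorem tmul_hull (q : Seminorm 𝕜 𝔤) {m d : ℕ} {c : ℝ} {x : SymmetricAlgebra 𝕜 𝔤}
    (h : Hull (𝕜 := 𝕜) (IsWordProd q m d) c x) (ξ : 𝔤) :
    Hull (𝕜 := 𝕜) (IsWordTensor q m (d + 1)) (q ξ * c) (x ⊗ₜ[𝕜] ξ) := by
  refine Hull.map ((TensorProduct.mk 𝕜 (SymmetricAlgebra 𝕜 𝔤) 𝔤).flip ξ) _ (apply_nonneg q ξ) ?_ h
  rintro _ _ ⟨L, hm, hd, rfl, rfl⟩
  exact .of ⟨L, .of ξ, hm, by rw [hd, length_of], mul_comm _ _, rfl⟩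

theorem contractMul_hull (q : Seminorm 𝕜 𝔤) {m d : ℕ} {c : ℝ} {x : SymmetricAlgebra 𝕜 𝔤}
    (h : Hull (𝕜 := 𝕜) (IsWordProd q m d) c x) (ξ : 𝔤) (r : ℕ) :
    Hull (𝕜 := 𝕜) (IsWordProd q (m - r + 1) (d + 1)) (m.descFactorial r * (q ξ * c))
      (contractMul 𝕜 r ξ x) := by
  have h1 := contract_pow_hull q (tmul_hull q h ξ) r
  rw [← one_mul ((m.descFactorial r : ℝ) * (q ξ * c))]
  refine Hull.map (mulι 𝕜 𝔤) _ zero_le_one ?_ h1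
  rintro _ _ ⟨L, w, hm, hd, rfl, rfl⟩
  refine .of ⟨L ++ [w], by simp [hm], by simp [← hd], by simp [lettersProd], ?_⟩
  simp [wordsProd, mulι_tmul]

theorem contractMul_eq_zero (q : Seminorm 𝕜 𝔤) {m d : ℕ} {c : ℝ} {x : SymmetricAlgebra 𝕜 𝔤}
    (h : Hull (𝕜 := 𝕜) (IsWordProd q m d) c x) (ξ : 𝔤) {r : ℕ} (hr : m < r) :
    contractMul 𝕜 r ξ x = 0 := by
  change mulι 𝕜 𝔤 ((contract 𝕜 𝔤 ^ r) (x ⊗ₜ ξ)) = 0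
  rw [contract_pow_eq_zero_of_hull q (tmul_hull q h ξ) hr, map_zero]

theorem leftMul_eq_sum_contractMul (q : Seminorm 𝕜 𝔤) {m d : ℕ} {c : ℝ} {x : SymmetricAlgebra 𝕜 𝔤}
    (h : Hull (𝕜 := 𝕜) (IsWordProd q m d) c x) (z : 𝕜) (ξ : 𝔤) {M : ℕ} (hM : m < M) :
    leftMul 𝔤 z ξ x = ∑ r ∈ Finset.range M, (bern 𝕜 r * z ^ r) • contractMul 𝕜 r ξ x :=
  leftMul_apply_eq_sum z ξ x M fun _ hr =>
    contract_pow_eq_zero_of_hull q (tmul_hull q h ξ) (hM.trans_le hr)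

variable (𝕜) in
/-- The homogeneous part of degree `n` in `z` of the iterated left multiplication with
the elements of a list. -/
def leftMulPart : List 𝔤 → ℕ → SymmetricAlgebra 𝕜 𝔤 → SymmetricAlgebra 𝕜 𝔤
  | [], n, y => if n = 0 then y else 0
  | ξ :: l, n, y => ∑ a ∈ antidiagonal n, bern 𝕜 a.1 • contractMul 𝕜 a.1 ξ (leftMulPart l a.2 y)

theorem leftMulPart_nil (n : ℕ) (y : SymmetricAlgebra 𝕜 𝔤) :
    leftMulPart 𝕜 [] n y = if n = 0 then y else 0 := rfl

theorem leftMulPart_cons (ξ : 𝔤) (l : List 𝔤) (n : ℕ) (y : SymmetricAlgebra 𝕜 𝔤) :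
    leftMulPart 𝕜 (ξ :: l) n y =
      ∑ a ∈ antidiagonal n, bern 𝕜 a.1 • contractMul 𝕜 a.1 ξ (leftMulPart 𝕜 l a.2 y) := rfl

end WordProducts

/-! ### Geometric decay of the Bernoulli coefficients. -/

section BernoulliBound

/-- Euler's formula expresses the coefficient by `ζ(2k)`, and `ζ(2k) ≤ ζ(2) = π² / 6`; the powers of
`π` are compensated by `π ^ 2 ≤ π ^ (2k)`. -/
theorem abs_bernoulli_div_factorial_le {k : ℕ} (hk : k ≠ 0) :
    |(bernoulli (2 * k) : ℝ) / ((2 * k) ! : ℕ)| ≤ (1 / 2) ^ (2 * k) := by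
  have h1 := hasSum_zeta_nat hk
  have h2 : (-1 : ℝ) ^ (k + 1) * 2 ^ (2 * k - 1) * Real.pi ^ (2 * k) * bernoulli (2 * k) /
      ((2 * k) ! : ℕ) ≤ Real.pi ^ 2 / 6 := by
    refine hasSum_le (fun n => ?_) h1 hasSum_zeta_two
    rcases n.eq_zero_or_pos with rfl | hn
    · simp [hk]
    · have hn' : (1 : ℝ) ≤ n := by exact_mod_cast hn
      exact one_div_le_one_div_of_le (by positivity) (pow_le_pow_right₀ hn' (by omega))
  have h0 : (0 : ℝ) ≤ (-1 : ℝ) ^ (k + 1) * 2 ^ (2 * k - 1) * Real.pi ^ (2 * k) * bernoulli (2 * k) /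
      ((2 * k) ! : ℕ) := h1.nonneg fun n => by positivity
  have habs : 2 ^ (2 * k - 1) * Real.pi ^ (2 * k) * |(bernoulli (2 * k) : ℝ) / ((2 * k) ! : ℕ)| ≤
      Real.pi ^ 2 / 6 := by
    refine le_trans (le_of_eq ?_) h2
    rw [← abs_of_nonneg h0, abs_div, abs_div, abs_mul, abs_mul, abs_mul, abs_pow, abs_neg, abs_one,
      one_pow, one_mul, mul_div_assoc]
    congr 1
    rw [abs_of_nonneg (by positivity), abs_of_nonneg (by positivity)]
  have hpi : (1 : ℝ) ≤ Real.pi := by linarith [Real.pi_gt_three]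
  have hpow : Real.pi ^ 2 ≤ Real.pi ^ (2 * k) := pow_le_pow_right₀ hpi (by omega)
  have h22 : (2 : ℝ) * 2 ^ (2 * k - 1) = 2 ^ (2 * k) := by
    rw [← pow_succ', Nat.sub_add_cancel (by omega)]
  set B := |(bernoulli (2 * k) : ℝ) / ((2 * k) ! : ℕ)|
  have hB : 0 ≤ B := abs_nonneg _
  have h3 : 2 ^ (2 * k - 1) * B * Real.pi ^ 2 ≤ (1 / 6) * Real.pi ^ 2 := by
    calc _ ≤ 2 ^ (2 * k - 1) * B * Real.pi ^ (2 * k) := by gcongr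
      _ ≤ _ := by linarith
  have h4 := le_of_mul_le_mul_right h3 (by positivity)
  rw [one_div, inv_pow, ← h22, inv_eq_one_div, le_div_iff₀ (by positivity)]
  linarith

theorem norm_bern_le (𝕜 : Type*) [RCLike 𝕜] (r : ℕ) : ‖bern 𝕜 r‖ ≤ (1 / 2) ^ r := by
  have hn : ‖bern 𝕜 r‖ = |(bernoulli r : ℝ) / (r ! : ℕ)| := by
    rw [bern, eq_ratCast, ← RCLike.ofReal_ratCast, RCLike.norm_ofReal]
    push_cast
    rfl
  rw [hn]
  rcases r.even_or_odd' with ⟨k, rfl | rfl⟩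
  · rcases eq_or_ne k 0 with rfl | hk
    · simp
    · exact abs_bernoulli_div_factorial_le hk
  · rcases eq_or_ne k 0 with rfl | hk
    · norm_num [bernoulli_one]
    · rw [bernoulli_eq_zero_of_odd ⟨k, rfl⟩ (by omega)]
      simp

theorem sum_norm_bern_le (𝕜 : Type*) [RCLike 𝕜] (M : ℕ) :
    ∑ r ∈ Finset.range M, ‖bern 𝕜 r‖ ≤ 2 :=
  (Finset.sum_le_sum fun r _ => norm_bern_le 𝕜 r).trans (by
    have := sum_geometric_two_le M
    simpa using this)

end BernoulliBound

/-! ### The operators `Cₙ` as sums of bracket-word products. -/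

section GuttOperators

variable {𝕜 : Type*} [RCLike 𝕜] {𝔤 : Type*} [LieRing 𝔤] [LieAlgebra 𝕜 𝔤]

/-- Adding a letter on the left splits `n` into new and old contractions. The two falling factorials
multiply to one that depends only on `n`, so the Bernoulli coefficients can be summed separately,
with sum at most `2`; this is the source of `2 ^ l.length`. Vanishing is proved along with the bound
because truncated subtraction makes the degree count meaningless for too many contractions. -/
theorem leftMulPart_eq_zero_and_hull (q : Seminorm 𝕜 𝔤) {m d : ℕ} {c : ℝ} {y : SymmetricAlgebra 𝕜 𝔤}
    (h : Hull (𝕜 := 𝕜) (IsWordProd q m d) c y) (hc : 0 ≤ c) (l : List 𝔤) (n : ℕ) :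
    (l.length + m < n → leftMulPart 𝕜 l n y = 0) ∧
    (n ≤ l.length + m → Hull (𝕜 := 𝕜) (IsWordProd q (l.length + m - n) (l.length + d))
      (2 ^ l.length * (l.length + m).descFactorial n * ((l.map q).prod * c)) (leftMulPart 𝕜 l n y)) := by
  induction l generalizing n with
  | nil =>
    rw [leftMulPart_nil]
    rcases eq_or_ne n 0 with rfl | hn
    · simpa using h
    · simp only [if_neg hn, implies_true, true_and]
      exact fun _ => Hull.zero.mono (by simpa using mul_nonneg (Nat.cast_nonneg _) hc)
  | cons ξ l ih =>
    have hq : 0 ≤ (l.map q).prod := List.prod_nonneg fun x hx => by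
      obtain ⟨w, -, rfl⟩ := List.mem_map.1 hx
      exact apply_nonneg q w
    set C : ℝ := (l.map q).prod * c with hC
    have hC0 : 0 ≤ C := mul_nonneg hq hc
    rw [leftMulPart_cons]
    constructor
    · intro hn
      rw [List.length_cons] at hn
      refine Finset.sum_eq_zero fun a ha => ?_
      have ha := Finset.HasAntidiagonal.mem_antidiagonal.1 ha
      rcases lt_or_ge (l.length + m) a.2 with h2 | h2
      · rw [(ih a.2).1 h2, map_zero, smul_zero]
      · rw [contractMul_eq_zero q ((ih a.2).2 h2) ξ (by omega), smul_zero]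
    · intro hn
      rw [List.length_cons] at hn
      rw [List.length_cons, show l.length + 1 + m = l.length + m + 1 by omega,
        show l.length + 1 + d = l.length + d + 1 by omega, List.map_cons, List.prod_cons,
        mul_assoc (q ξ), ← hC]
      have hterm : ∀ a ∈ antidiagonal n, Hull (𝕜 := 𝕜)
          (IsWordProd q (l.length + m + 1 - n) (l.length + d + 1))
          (‖bern 𝕜 a.1‖ * (2 ^ l.length * (l.length + m).descFactorial n * (q ξ * C)))
          (bern 𝕜 a.1 • contractMul 𝕜 a.1 ξ (leftMulPart 𝕜 l a.2 y)) := by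
        intro a ha
        have ha := Finset.HasAntidiagonal.mem_antidiagonal.1 ha
        have hnn : 0 ≤ ‖bern 𝕜 a.1‖ * (2 ^ l.length * (l.length + m).descFactorial n * (q ξ * C)) := by
          positivity
        rcases lt_or_ge (l.length + m) a.2 with h2 | h2
        · rw [(ih a.2).1 h2, map_zero, smul_zero]
          exact Hull.zero.mono hnn
        have h3 := (ih a.2).2 h2
        rcases lt_or_ge (l.length + m - a.2) a.1 with h4 | h4
        · rw [contractMul_eq_zero q h3 ξ h4, smul_zero]
          exact Hull.zero.mono hnn
        have h5 := (contractMul_hull q h3 ξ a.1).smul (bern 𝕜 a.1)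
        rw [show l.length + m - a.2 - a.1 + 1 = l.length + m + 1 - n by omega] at h5
        refine h5.mono (le_of_eq ?_)
        rw [← Nat.descFactorial_mul_descFactorial (show a.2 ≤ n by omega),
          show n - a.2 = a.1 by omega]
        push_cast
        ring
      refine (Hull.sum _ hterm).mono ?_
      rw [← Finset.sum_mul, Finset.Nat.sum_antidiagonal_eq_sum_range_succ_mk]
      calc (∑ r ∈ Finset.range n.succ, ‖bern 𝕜 r‖) *
            (2 ^ l.length * (l.length + m).descFactorial n * (q ξ * C))
          ≤ 2 * (2 ^ l.length * (l.length + m + 1).descFactorial n * (q ξ * C)) := by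
            have hd : ((l.length + m).descFactorial n : ℝ) ≤ (l.length + m + 1).descFactorial n := by
              exact_mod_cast Nat.descFactorial_le n (Nat.le_succ _)
            have := sum_norm_bern_le 𝕜 n.succ
            gcongr
        _ = _ := by ring

theorem prod_leftMul_eq_sum (q : Seminorm 𝕜 𝔤) {m d : ℕ} {c : ℝ} {y : SymmetricAlgebra 𝕜 𝔤}
    (h : Hull (𝕜 := 𝕜) (IsWordProd q m d) c y) (hc : 0 ≤ c) (z : 𝕜) (l : List 𝔤) {M : ℕ}
    (hM : l.length + m < M) : (l.map (leftMul 𝔤 z)).prod y =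
      ∑ n ∈ Finset.range M, z ^ n • leftMulPart 𝕜 l n y := by
  induction l with
  | nil =>
    rw [Finset.sum_eq_single_of_mem 0 (Finset.mem_range.2 (by omega))]
    · simp [leftMulPart_nil]
    · intro n _ hn
      rw [leftMulPart_nil, if_neg hn, smul_zero]
  | cons ξ l ih =>
    rw [List.length_cons] at hM
    rw [List.map_cons, List.prod_cons, Module.End.mul_apply, ih (by omega), map_sum]
    have hz : ∀ a b, M ≤ a + b →
        (bern 𝕜 a * z ^ (a + b)) • contractMul 𝕜 a ξ (leftMulPart 𝕜 l b y) = 0 := by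
      intro a b hab
      have hb := leftMulPart_eq_zero_and_hull q h hc l b
      rcases lt_or_ge (l.length + m) b with h2 | h2
      · rw [hb.1 h2, map_zero, smul_zero]
      · rw [contractMul_eq_zero q (hb.2 h2) ξ (by omega), smul_zero]
    have hb : ∀ b ∈ Finset.range M, leftMul 𝔤 z ξ (z ^ b • leftMulPart 𝕜 l b y) =
        ∑ a ∈ Finset.range M, (bern 𝕜 a * z ^ (a + b)) • contractMul 𝕜 a ξ (leftMulPart 𝕜 l b y) := by
      intro b _
      have hb := leftMulPart_eq_zero_and_hull q h hc l b
      rcases lt_or_ge (l.length + m) b with h2 | h2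
      · simp [hb.1 h2]
      · rw [map_smul, leftMul_eq_sum_contractMul q (hb.2 h2) z ξ (M := M) (by omega), Finset.smul_sum]
        refine Finset.sum_congr rfl fun a _ => ?_
        rw [smul_smul, pow_add]
        congr 1
        ring
    rw [Finset.sum_congr rfl hb, Finset.sum_comm, sum_range_sum_range_eq_sum_antidiagonal M _ hz]
    refine Finset.sum_congr rfl fun n _ => ?_
    rw [leftMulPart_cons, Finset.smul_sum]
    refine Finset.sum_congr rfl fun a ha => ?_
    rw [Finset.HasAntidiagonal.mem_antidiagonal.1 ha, smul_smul, mul_comm]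

section Module

variable {V : Type*} [AddCommGroup V] [Module 𝕜 V]

theorem coe_sym (t : TensorAlgebra 𝕜 V) :
    (sym 𝕜 V t : TensorAlgebra 𝕜 V) = symmetrizer 𝕜 V t := rfl

theorem sym_symmetrizer (t : TensorAlgebra 𝕜 V) : sym 𝕜 V (symmetrizer 𝕜 V t) = sym 𝕜 V t :=
  Subtype.ext (symmetrizer_symmetrizer t)

theorem symProj_sym_tprod {n : ℕ} (v : Fin n → V) (j : ℕ) :
    symProj 𝕜 V j (sym 𝕜 V (TensorAlgebra.tprod 𝕜 V n v)) =
      if j = n then sym 𝕜 V (TensorAlgebra.tprod 𝕜 V n v) else 0 := by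
  simp only [symProj, LinearMap.comp_apply, Submodule.subtype_apply, coe_sym]
  rcases eq_or_ne j n with rfl | h
  · rw [if_pos rfl, symmetrizer_tprod]
    simp only [map_smul, map_sum, component_tprod_self, TensorPower.toTensorAlgebra_tprod]
    rw [← map_sum, ← map_smul, ← symmetrizer_tprod, sym_symmetrizer]
  · rw [if_neg h, symmetrizer_tprod]
    simp only [map_smul, map_sum, component_tprod_of_ne h.symm, map_zero, Finset.sum_const_zero,
      smul_zero]

theorem exists_symProj_eq_zero (x : SymAlg 𝕜 V) : ∃ K : ℕ, ∀ k, K ≤ k → symProj 𝕜 V k x = 0 := by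
  classical
  obtain ⟨K, hK⟩ := (DFinsupp.support
    (TensorAlgebra.equivDirectSum (x : TensorAlgebra 𝕜 V))).exists_nat_subset_range
  refine ⟨K, fun k hk => ?_⟩
  have h : k ∉ DFinsupp.support (TensorAlgebra.equivDirectSum (x : TensorAlgebra 𝕜 V)) :=
    fun h => by have := Finset.mem_range.1 (hK h); omega
  have h0 : component 𝕜 V k x = 0 := DFinsupp.notMem_support_iff.1 h
  simp [symProj, h0]

end Module

theorem symEquiv_wordsProd (L : List (FreeMagma 𝔤)) : symEquiv 𝕜 𝔤 (wordsProd 𝕜 L) =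
    sym 𝕜 𝔤 (TensorAlgebra.tprod 𝕜 𝔤 L.length fun i => bracketWord (L.get i)) := by
  rw [← symEquiv_algHom, algHom_tprod, wordsProd, ← List.prod_ofFn]
  congr 2
  conv_lhs => rw [← List.ofFn_get L, List.map_ofFn]
  rfl

theorem symProj_symEquiv_of_hull (q : Seminorm 𝕜 𝔤) {m d : ℕ} {c : ℝ} {x : SymmetricAlgebra 𝕜 𝔤}
    (h : Hull (𝕜 := 𝕜) (IsWordProd q m d) c x) (j : ℕ) :
    symProj 𝕜 𝔤 j (symEquiv 𝕜 𝔤 x) = if j = m then symEquiv 𝕜 𝔤 x else 0 := by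
  split_ifs with hj
  · subst hj
    refine h.mem (LinearMap.eqLocus (symProj 𝕜 𝔤 j ∘ₗ (symEquiv 𝕜 𝔤).toLinearMap)
      (symEquiv 𝕜 𝔤).toLinearMap) ?_
    rintro c x ⟨L, rfl, -, -, rfl⟩
    simp only [LinearMap.mem_eqLocus, LinearMap.comp_apply, LinearEquiv.coe_coe, symEquiv_wordsProd,
      symProj_sym_tprod, if_true]
  · refine h.mem (LinearMap.ker (symProj 𝕜 𝔤 j ∘ₗ (symEquiv 𝕜 𝔤).toLinearMap)) ?_
    rintro c x ⟨L, rfl, -, -, rfl⟩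
    simp only [LinearMap.mem_ker, LinearMap.comp_apply, LinearEquiv.coe_coe, symEquiv_wordsProd,
      symProj_sym_tprod, if_neg hj]

theorem hull_algHom_tprod (q : Seminorm 𝕜 𝔤) {l : ℕ} (w : Fin l → 𝔤) :
    Hull (𝕜 := 𝕜) (IsWordProd q l l) (∏ i, q (w i))
      (SymmetricAlgebra.algHom 𝕜 𝔤 (TensorAlgebra.tprod 𝕜 𝔤 l w)) := by
  refine .of ⟨List.ofFn fun i => .of (w i), by simp, ?_, ?_, ?_⟩
  · rw [List.map_ofFn, List.sum_ofFn]
    simp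
  · rw [lettersProd, List.map_ofFn, List.prod_ofFn]
    rfl
  · rw [algHom_tprod, wordsProd, List.map_ofFn, List.prod_ofFn]
    rfl

theorem starProd_sym_tprod (z : 𝕜) {k l : ℕ} (v : Fin k → 𝔤) (w : Fin l → 𝔤) {M : ℕ} (hM : k + l < M) :
    starProd 𝔤 z (sym 𝕜 𝔤 (TensorAlgebra.tprod 𝕜 𝔤 k v)) (sym 𝕜 𝔤 (TensorAlgebra.tprod 𝕜 𝔤 l w)) =
      ∑ n ∈ Finset.range M, z ^ n • ((k ! : ℕ) : 𝕜)⁻¹ • ∑ σ : Equiv.Perm (Fin k),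
        symEquiv 𝕜 𝔤 (leftMulPart 𝕜 (List.ofFn (v ∘ σ)) n
          (SymmetricAlgebra.algHom 𝕜 𝔤 (TensorAlgebra.tprod 𝕜 𝔤 l w))) := by
  -- Only the number of factors matters here, so the zero seminorm serves for the bookkeeping.
  have hy := hull_algHom_tprod (𝕜 := 𝕜) 0 w
  rw [starProd_apply, symEquiv_symm_apply, symEquiv_symm_apply, coe_sym, coe_sym, algHom_symmetrizer,
    algHom_symmetrizer, starMul, symLift_apply, symEquiv_algHom, coe_sym, symmetrizer_tprod, map_smul,
    map_sum, LinearMap.smul_apply, LinearMap.sum_apply, map_smul, map_sum]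
  have h1 : ∀ σ : Equiv.Perm (Fin k), TensorAlgebra.lift 𝕜 (leftMul 𝔤 z)
      (TensorAlgebra.tprod 𝕜 𝔤 k (v ∘ σ)) = ((List.ofFn (v ∘ σ)).map (leftMul 𝔤 z)).prod := by
    intro σ
    rw [TensorAlgebra.tprod_apply, map_list_prod, List.map_ofFn, List.map_ofFn]
    congr 2
    funext i
    simp
  simp only [h1]
  rw [Finset.smul_sum]
  have h2 : ∀ σ : Equiv.Perm (Fin k), ((List.ofFn (v ∘ σ)).map (leftMul 𝔤 z)).prod
      (SymmetricAlgebra.algHom 𝕜 𝔤 (TensorAlgebra.tprod 𝕜 𝔤 l w)) =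
      ∑ n ∈ Finset.range M, z ^ n • leftMulPart 𝕜 (List.ofFn (v ∘ σ)) n
          (SymmetricAlgebra.algHom 𝕜 𝔤 (TensorAlgebra.tprod 𝕜 𝔤 l w)) := fun σ =>
    prod_leftMul_eq_sum 0 hy (Finset.prod_nonneg fun i _ => apply_nonneg _ _) z _ (by simpa using hM)
  simp only [h2, map_sum, map_smul, Finset.smul_sum]
  rw [Finset.sum_comm]
  refine Finset.sum_congr rfl fun n _ => Finset.sum_congr rfl fun σ _ => ?_
  rw [smul_comm]

theorem guttC_eq_finsum (n : ℕ) (x y : SymAlg 𝕜 𝔤) : guttC 𝕜 n x y = ∑ᶠ (k : ℕ) (l : ℕ),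
    if n ≤ k + l then
      symProj 𝕜 𝔤 (k + l - n) (starProd 𝔤 1 (symProj 𝕜 𝔤 k x) (symProj 𝕜 𝔤 l y)) else 0 := by
  simp only [guttC, pbwInv_pbw_mul]

theorem guttC_eq_sum (n : ℕ) (x y : SymAlg 𝕜 𝔤) {K L : ℕ} (hK : ∀ k, K ≤ k → symProj 𝕜 𝔤 k x = 0)
    (hL : ∀ l, L ≤ l → symProj 𝕜 𝔤 l y = 0) : guttC 𝕜 n x y =
      ∑ k ∈ Finset.range K, ∑ l ∈ Finset.range L, if n ≤ k + l then
        symProj 𝕜 𝔤 (k + l - n) (starProd 𝔤 1 (symProj 𝕜 𝔤 k x) (symProj 𝕜 𝔤 l y)) else 0 := by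
  have h1 : ∀ k, ∑ᶠ l : ℕ, (if n ≤ k + l then
      symProj 𝕜 𝔤 (k + l - n) (starProd 𝔤 1 (symProj 𝕜 𝔤 k x) (symProj 𝕜 𝔤 l y)) else 0) =
      ∑ l ∈ Finset.range L, if n ≤ k + l then
        symProj 𝕜 𝔤 (k + l - n) (starProd 𝔤 1 (symProj 𝕜 𝔤 k x) (symProj 𝕜 𝔤 l y)) else 0 := by
    intro k
    refine finsum_eq_sum_of_support_subset _ fun l hl => ?_
    rw [Finset.coe_range, Set.mem_Iio]
    by_contra h
    exact hl (by simp [hL l (not_lt.1 h)])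
  rw [guttC_eq_finsum]
  simp only [h1]
  refine finsum_eq_sum_of_support_subset _ fun k hk => ?_
  rw [Finset.coe_range, Set.mem_Iio]
  by_contra h
  exact hk (by simp [hK k (not_lt.1 h)])

theorem guttC_add_left (n : ℕ) (x x' y : SymAlg 𝕜 𝔤) :
    guttC 𝕜 n (x + x') y = guttC 𝕜 n x y + guttC 𝕜 n x' y := by
  obtain ⟨K, hK⟩ := exists_symProj_eq_zero x
  obtain ⟨K', hK'⟩ := exists_symProj_eq_zero x'
  obtain ⟨L, hL⟩ := exists_symProj_eq_zero y
  have h : ∀ k, max K K' ≤ k → symProj 𝕜 𝔤 k x = 0 := fun k hk => hK k (le_of_max_le_left hk)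
  have h' : ∀ k, max K K' ≤ k → symProj 𝕜 𝔤 k x' = 0 := fun k hk => hK' k (le_of_max_le_right hk)
  rw [guttC_eq_sum n x y h hL, guttC_eq_sum n x' y h' hL, guttC_eq_sum n (x + x') y
    (fun k hk => by rw [map_add, h k hk, h' k hk, add_zero]) hL]
  simp only [← Finset.sum_add_distrib]
  refine Finset.sum_congr rfl fun k _ => Finset.sum_congr rfl fun l _ => ?_
  split_ifs <;> simp

theorem guttC_add_right (n : ℕ) (x y y' : SymAlg 𝕜 𝔤) :
    guttC 𝕜 n x (y + y') = guttC 𝕜 n x y + guttC 𝕜 n x y' := by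
  obtain ⟨K, hK⟩ := exists_symProj_eq_zero y
  obtain ⟨K', hK'⟩ := exists_symProj_eq_zero y'
  obtain ⟨L, hL⟩ := exists_symProj_eq_zero x
  have h : ∀ k, max K K' ≤ k → symProj 𝕜 𝔤 k y = 0 := fun k hk => hK k (le_of_max_le_left hk)
  have h' : ∀ k, max K K' ≤ k → symProj 𝕜 𝔤 k y' = 0 := fun k hk => hK' k (le_of_max_le_right hk)
  rw [guttC_eq_sum n x y hL h, guttC_eq_sum n x y' hL h', guttC_eq_sum n x (y + y') hL
    (fun k hk => by rw [map_add, h k hk, h' k hk, add_zero])]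
  simp only [← Finset.sum_add_distrib]
  refine Finset.sum_congr rfl fun k _ => Finset.sum_congr rfl fun l _ => ?_
  split_ifs <;> simp

theorem guttC_smul_left (n : ℕ) (a : 𝕜) (x y : SymAlg 𝕜 𝔤) :
    guttC 𝕜 n (a • x) y = a • guttC 𝕜 n x y := by
  obtain ⟨K, hK⟩ := exists_symProj_eq_zero x
  obtain ⟨L, hL⟩ := exists_symProj_eq_zero y
  rw [guttC_eq_sum n x y hK hL, guttC_eq_sum n (a • x) y
    (fun k hk => by rw [map_smul, hK k hk, smul_zero]) hL]
  simp only [Finset.smul_sum]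
  refine Finset.sum_congr rfl fun k _ => Finset.sum_congr rfl fun l _ => ?_
  split_ifs <;> simp

theorem guttC_smul_right (n : ℕ) (a : 𝕜) (x y : SymAlg 𝕜 𝔤) :
    guttC 𝕜 n x (a • y) = a • guttC 𝕜 n x y := by
  obtain ⟨K, hK⟩ := exists_symProj_eq_zero x
  obtain ⟨L, hL⟩ := exists_symProj_eq_zero y
  rw [guttC_eq_sum n x y hK hL, guttC_eq_sum n x (a • y) hK
    (fun k hk => by rw [map_smul, hL k hk, smul_zero])]
  simp only [Finset.smul_sum]
  refine Finset.sum_congr rfl fun k _ => Finset.sum_congr rfl fun l _ => ?_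
  split_ifs <;> simp

variable (𝕜 𝔤) in
/-- The operators `Cₙ` as bilinear maps. -/
def guttBilin (n : ℕ) : SymAlg 𝕜 𝔤 →ₗ[𝕜] SymAlg 𝕜 𝔤 →ₗ[𝕜] SymAlg 𝕜 𝔤 :=
  LinearMap.mk₂ 𝕜 (guttC 𝕜 n) (guttC_add_left n) (guttC_smul_left n) (guttC_add_right n)
    (guttC_smul_right n)

theorem guttBilin_apply (n : ℕ) (x y : SymAlg 𝕜 𝔤) : guttBilin 𝕜 𝔤 n x y = guttC 𝕜 n x y := rfl

theorem leftMulPart_ofFn_eq_zero {k l n : ℕ} (v : Fin k → 𝔤) (w : Fin l → 𝔤) (hn : k + l < n) :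
    leftMulPart 𝕜 (List.ofFn v) n
      (SymmetricAlgebra.algHom 𝕜 𝔤 (TensorAlgebra.tprod 𝕜 𝔤 l w)) = 0 :=
  (leftMulPart_eq_zero_and_hull 0 (hull_algHom_tprod (𝕜 := 𝕜) 0 w)
    (Finset.prod_nonneg fun i _ => apply_nonneg _ _) _ n).1 (by simpa using hn)

theorem leftMulPart_ofFn_hull (q : Seminorm 𝕜 𝔤) {k l n : ℕ} (v : Fin k → 𝔤) (w : Fin l → 𝔤)
    (hn : n ≤ k + l) : Hull (𝕜 := 𝕜) (IsWordProd q (k + l - n) (k + l))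
      (2 ^ k * (k + l).descFactorial n * ((∏ i, q (v i)) * ∏ i, q (w i)))
      (leftMulPart 𝕜 (List.ofFn v) n
        (SymmetricAlgebra.algHom 𝕜 𝔤 (TensorAlgebra.tprod 𝕜 𝔤 l w))) := by
  have := (leftMulPart_eq_zero_and_hull q (hull_algHom_tprod (𝕜 := 𝕜) q w)
    (Finset.prod_nonneg fun i _ => apply_nonneg _ _) (List.ofFn v) n).2 (by simpa using hn)
  rw [List.map_ofFn, List.prod_ofFn, List.length_ofFn] at this
  exact this

/-- The coefficient of `z ^ n` in the star product consists of products of `k + l - n` words. Hence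
the degree projection in the definition of `guttC`, taken at `z = 1`, selects exactly this
coefficient. -/
theorem guttC_sym_tprod (n : ℕ) {k l : ℕ} (v : Fin k → 𝔤) (w : Fin l → 𝔤) :
    guttC 𝕜 n (sym 𝕜 𝔤 (TensorAlgebra.tprod 𝕜 𝔤 k v)) (sym 𝕜 𝔤 (TensorAlgebra.tprod 𝕜 𝔤 l w)) =
      ((k ! : ℕ) : 𝕜)⁻¹ • ∑ σ : Equiv.Perm (Fin k),
        symEquiv 𝕜 𝔤 (leftMulPart 𝕜 (List.ofFn (v ∘ σ)) n
          (SymmetricAlgebra.algHom 𝕜 𝔤 (TensorAlgebra.tprod 𝕜 𝔤 l w))) := by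
  rw [guttC_eq_finsum, finsum_eq_single _ k, finsum_eq_single _ l]
  · rw [symProj_sym_tprod, symProj_sym_tprod, if_pos rfl, if_pos rfl]
    split_ifs with hn
    · rw [starProd_sym_tprod 1 v w (Nat.lt_succ_self _), map_sum, Finset.sum_eq_single_of_mem n]
      · simp only [map_smul, map_sum, one_pow, one_smul]
        congr 1
        refine Finset.sum_congr rfl fun σ _ => ?_
        rw [symProj_symEquiv_of_hull 0 (leftMulPart_ofFn_hull 0 _ _ hn), if_pos rfl]
      · exact Finset.mem_range.2 (by omega)
      · intro n' hn' hne
        have hn' := Finset.mem_range.1 hn'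
        simp only [map_smul, map_sum, one_pow, one_smul]
        rw [Finset.sum_eq_zero, smul_zero]
        intro σ _
        rw [symProj_symEquiv_of_hull 0 (leftMulPart_ofFn_hull 0 _ _ (by omega)), if_neg (by omega)]
    · rw [Finset.sum_eq_zero, smul_zero]
      intro σ _
      rw [leftMulPart_ofFn_eq_zero _ _ (not_le.1 hn), map_zero]
  · intro l' hl'
    simp [-TensorAlgebra.tprod_apply, symProj_sym_tprod, hl']
  · intro k' hk'
    simp [-TensorAlgebra.tprod_apply, symProj_sym_tprod, hk']

theorem starProd_sym_tprod_eq_sum (z : 𝕜) {k l : ℕ} (v : Fin k → 𝔤) (w : Fin l → 𝔤) {M : ℕ}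
    (hM : k + l < M) : starProd 𝔤 z (sym 𝕜 𝔤 (TensorAlgebra.tprod 𝕜 𝔤 k v))
      (sym 𝕜 𝔤 (TensorAlgebra.tprod 𝕜 𝔤 l w)) = ∑ n ∈ Finset.range M, z ^ n •
        guttC 𝕜 n (sym 𝕜 𝔤 (TensorAlgebra.tprod 𝕜 𝔤 k v)) (sym 𝕜 𝔤 (TensorAlgebra.tprod 𝕜 𝔤 l w)) := by
  rw [starProd_sym_tprod z v w hM]
  simp only [guttC_sym_tprod]

theorem guttC_sym_tprod_eq_zero {n k l : ℕ} (v : Fin k → 𝔤) (w : Fin l → 𝔤) (hn : k + l < n) :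
    guttC 𝕜 n (sym 𝕜 𝔤 (TensorAlgebra.tprod 𝕜 𝔤 k v)) (sym 𝕜 𝔤 (TensorAlgebra.tprod 𝕜 𝔤 l w)) = 0 := by
  rw [guttC_sym_tprod, Finset.sum_eq_zero, smul_zero]
  intro σ _
  rw [leftMulPart_ofFn_eq_zero _ _ hn, map_zero]

end GuttOperators

/-! ### Estimates for `p_R` from elementary tensors. -/

section TensorSeminorm

variable {𝕜 : Type*} [RCLike 𝕜] {V : Type*} [AddCommGroup V] [Module 𝕜 V]

theorem seminorm_sum_le {ι : Type*} (s : Seminorm 𝕜 V) (t : Finset ι) (f : ι → V) :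
    s (∑ i ∈ t, f i) ≤ ∑ i ∈ t, s (f i) :=
  Finset.le_sum_of_subadditive s (map_zero s).le (map_add_le_add s) t f

theorem prod_smul_seminorm (a : ℝ≥0) (r : Seminorm 𝕜 V) {n : ℕ} (v : Fin n → V) :
    ∏ i, (a • r) (v i) = a ^ n * ∏ i, r (v i) := by
  have h : ∀ i, (a • r) (v i) = a * r (v i) := fun i => rfl
  simp only [h, Finset.prod_mul_distrib, Finset.prod_const, Finset.card_univ, Fintype.card_fin]

theorem seminormPower_tprod_le (p : Seminorm 𝕜 V) {n : ℕ} (v : Fin n → V) :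
    seminormPower p n (PiTensorProduct.tprod 𝕜 v) ≤ ∏ i, p (v i) := by
  let := p.toSeminormedAddCommGroup
  let : NormedSpace 𝕜 V := ⟨fun a b => (map_smul_eq_mul p a b).le⟩
  exact PiTensorProduct.projectiveSeminorm_tprod_le (𝕜 := 𝕜) v

/-- The projective power is the largest seminorm with the given bound on elementary tensors: the
bound passes to every representation of `t` and then to the infimum. -/
theorem seminorm_le_mul_seminormPower (p : Seminorm 𝕜 V) {n : ℕ} (s : Seminorm 𝕜 (⨂[𝕜]^n V)) {K : ℝ}
    (hK : 0 ≤ K) (hs : ∀ v : Fin n → V, s (PiTensorProduct.tprod 𝕜 v) ≤ K * ∏ i, p (v i))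
    (t : ⨂[𝕜]^n V) : s t ≤ K * seminormPower p n t := by
  let := p.toSeminormedAddCommGroup
  let : NormedSpace 𝕜 V := ⟨fun a b => (map_smul_eq_mul p a b).le⟩
  change s t ≤ K * iInf fun l : PiTensorProduct.lifts t => PiTensorProduct.projectiveSeminormAux l.1
  rw [Real.mul_iInf_of_nonneg hK]
  have : Nonempty (PiTensorProduct.lifts t) := (PiTensorProduct.nonempty_lifts t).to_subtype
  refine le_ciInf fun l => ?_
  have hl := (PiTensorProduct.mem_lifts_iff t l.1).1 l.2
  rw [PiTensorProduct.projectiveSeminormAux]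
  conv_lhs => rw [← hl]
  generalize FreeAddMonoid.toList l.1 = l
  induction l with
  | nil => simp
  | cons a l ih =>
    rw [List.map_cons, List.sum_cons, List.map_cons, List.sum_cons, mul_add]
    refine (map_add_le_add s _ _).trans (add_le_add ?_ ih)
    rw [map_smul_eq_mul, mul_left_comm]
    exact mul_le_mul_of_nonneg_left (hs _) (norm_nonneg _)

theorem finite_support_tensorSeminorm (p : Seminorm 𝕜 V) (R : ℝ) (x : TensorAlgebra 𝕜 V) :
    (Function.support fun n : ℕ =>
      ((n ! : ℕ) : ℝ) ^ R * seminormPower p n (component 𝕜 V n x)).Finite := by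
  classical
  refine (DFinsupp.support (TensorAlgebra.equivDirectSum x)).finite_toSet.subset fun n hn => ?_
  rw [Finset.mem_coe, DFinsupp.mem_support_iff]
  intro h0
  have h0 : component 𝕜 V n x = 0 := h0
  exact hn (by simp [h0])

theorem tensorSeminorm_apply (p : Seminorm 𝕜 V) (R : ℝ) (x : TensorAlgebra 𝕜 V) :
    tensorSeminorm p R x =
      ∑ᶠ n : ℕ, ((n ! : ℕ) : ℝ) ^ R * seminormPower p n (component 𝕜 V n x) := rfl

theorem tensorSeminorm_tprod_le (p : Seminorm 𝕜 V) (R : ℝ) {n : ℕ} (v : Fin n → V) :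
    tensorSeminorm p R (TensorAlgebra.tprod 𝕜 V n v) ≤ ((n ! : ℕ) : ℝ) ^ R * ∏ i, p (v i) := by
  rw [tensorSeminorm_apply, finsum_eq_single _ n]
  · rw [component_tprod_self]
    exact mul_le_mul_of_nonneg_left (seminormPower_tprod_le p v) (by positivity)
  · intro m hm
    rw [component_tprod_of_ne hm.symm, map_zero, mul_zero]

theorem sum_component (x : TensorAlgebra 𝕜 V) : ∃ s : Finset ℕ, ∀ t, s ⊆ t →
    x = ∑ n ∈ t, TensorPower.toTensorAlgebra (component 𝕜 V n x) := by
  classical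
  refine ⟨DFinsupp.support (TensorAlgebra.equivDirectSum x), fun t ht => ?_⟩
  have h : ∀ n (u : ⨂[𝕜]^n V), TensorAlgebra.equivDirectSum.symm
      (DirectSum.of (fun n => ⨂[𝕜]^n V) n u) = TensorPower.toTensorAlgebra u := by
    intro n u
    have h : (TensorAlgebra.equivDirectSum (R := 𝕜) (M := V)).symm.toLinearMap ∘ₗ
        DirectSum.lof 𝕜 ℕ (fun n => ⨂[𝕜]^n V) n = TensorPower.toTensorAlgebra := by
      refine PiTensorProduct.ext ?_
      ext v
      simp [DirectSum.lof_eq_of, -TensorAlgebra.tprod_apply]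
    exact congr($h u)
  have hx : ∑ n ∈ DFinsupp.support (TensorAlgebra.equivDirectSum x),
      TensorPower.toTensorAlgebra (component 𝕜 V n x) = x := by
    conv_rhs => rw [← TensorAlgebra.equivDirectSum.symm_apply_apply x,
      ← DirectSum.sum_support_of (TensorAlgebra.equivDirectSum x), map_sum]
    exact Finset.sum_congr rfl fun n _ => (h n _).symm
  rw [← Finset.sum_subset ht, hx]
  intro n _ hn
  have h0 : component 𝕜 V n x = 0 := DFinsupp.notMem_support_iff.1 hn
  rw [h0, map_zero]

theorem seminorm_le_mul_tensorSeminorm (p : Seminorm 𝕜 V) (R : ℝ) (s : Seminorm 𝕜 (TensorAlgebra 𝕜 V))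
    {K : ℝ} (hK : 0 ≤ K) (hs : ∀ (n : ℕ) (v : Fin n → V),
      s (TensorAlgebra.tprod 𝕜 V n v) ≤ K * (((n ! : ℕ) : ℝ) ^ R * ∏ i, p (v i)))
    (x : TensorAlgebra 𝕜 V) : s x ≤ K * tensorSeminorm p R x := by
  obtain ⟨t, ht⟩ := sum_component x
  set u := t ∪ (finite_support_tensorSeminorm p R x).toFinset with hu
  rw [tensorSeminorm_apply, finsum_eq_sum_of_support_subset _ (s := u) (by simp [hu]), Finset.mul_sum]
  conv_lhs => rw [ht u Finset.subset_union_left]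
  refine (seminorm_sum_le s _ _).trans (Finset.sum_le_sum fun n _ => ?_)
  rw [← mul_assoc]
  refine seminorm_le_mul_seminormPower p (s.comp TensorPower.toTensorAlgebra) (by positivity) ?_ _
  intro v
  rw [Seminorm.comp_apply, TensorPower.toTensorAlgebra_tprod, mul_assoc]
  exact hs n v

theorem tensorSeminorm_symmetrizer_le (p : Seminorm 𝕜 V) (R : ℝ) (x : TensorAlgebra 𝕜 V) :
    tensorSeminorm p R (symmetrizer 𝕜 V x) ≤ tensorSeminorm p R x := by
  rw [← one_mul (tensorSeminorm p R x)]
  refine seminorm_le_mul_tensorSeminorm p R ((tensorSeminorm p R).comp (symmetrizer 𝕜 V)) zero_le_one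
    (fun n v => ?_) x
  rw [Seminorm.comp_apply, symmetrizer_tprod, map_smul_eq_mul, norm_inv, RCLike.norm_natCast, one_mul,
    inv_mul_le_iff₀ (by exact_mod_cast n.factorial_pos)]
  have h : ∀ σ : Equiv.Perm (Fin n), tensorSeminorm p R (TensorAlgebra.tprod 𝕜 V n (v ∘ σ)) ≤
      ((n ! : ℕ) : ℝ) ^ R * ∏ i, p (v i) := fun σ =>
    (tensorSeminorm_tprod_le p R (v ∘ σ)).trans_eq
      (congrArg _ (Equiv.prod_comp σ fun i => p (v i)))
  refine (seminorm_sum_le _ _ _).trans ((Finset.sum_le_sum fun σ _ => h σ).trans_eq ?_)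
  rw [Finset.sum_const, Finset.card_univ, Fintype.card_perm, Fintype.card_fin, nsmul_eq_mul]

theorem symSeminorm_apply (p : Seminorm 𝕜 V) (R : ℝ) (x : SymAlg 𝕜 V) :
    symSeminorm p R x = tensorSeminorm p R x := rfl

theorem symSeminorm_sym_tprod_le (p : Seminorm 𝕜 V) (R : ℝ) {n : ℕ} (v : Fin n → V) :
    symSeminorm p R (sym 𝕜 V (TensorAlgebra.tprod 𝕜 V n v)) ≤ ((n ! : ℕ) : ℝ) ^ R * ∏ i, p (v i) :=
  (tensorSeminorm_symmetrizer_le p R _).trans (tensorSeminorm_tprod_le p R v)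

theorem seminorm_le_mul_symSeminorm (p : Seminorm 𝕜 V) (R : ℝ) (s : Seminorm 𝕜 (SymAlg 𝕜 V))
    {K : ℝ} (hK : 0 ≤ K) (hs : ∀ (n : ℕ) (v : Fin n → V),
      s (sym 𝕜 V (TensorAlgebra.tprod 𝕜 V n v)) ≤ K * (((n ! : ℕ) : ℝ) ^ R * ∏ i, p (v i)))
    (x : SymAlg 𝕜 V) : s x ≤ K * symSeminorm p R x := by
  have := seminorm_le_mul_tensorSeminorm p R (s.comp (sym 𝕜 V)) hK hs x
  rwa [Seminorm.comp_apply, sym_coe] at this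

/-- Apply `seminorm_le_mul_symSeminorm` in each variable. A geometric factor `a ^ (k + l)` is
absorbed by replacing the seminorms with their multiples by `a`; every later estimate passes through
this step. -/
theorem bilin_le_mul_symSeminorm {W E : Type*} [AddCommGroup W] [Module 𝕜 W] [AddCommGroup E]
    [Module 𝕜 E] (B : SymAlg 𝕜 V →ₗ[𝕜] SymAlg 𝕜 W →ₗ[𝕜] E) (s : Seminorm 𝕜 E) (p : Seminorm 𝕜 V)
    (q : Seminorm 𝕜 W) (R : ℝ) {K : ℝ} (hK : 0 ≤ K) (a : ℝ≥0)
    (h : ∀ (k l : ℕ) (v : Fin k → V) (w : Fin l → W),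
      s (B (sym 𝕜 V (TensorAlgebra.tprod 𝕜 V k v)) (sym 𝕜 W (TensorAlgebra.tprod 𝕜 W l w))) ≤
        K * (a ^ (k + l) * ((k ! : ℝ) ^ R * (l ! : ℝ) ^ R) * ((∏ i, p (v i)) * ∏ i, q (w i))))
    (x : SymAlg 𝕜 V) (y : SymAlg 𝕜 W) :
    s (B x y) ≤ K * (symSeminorm (a • p) R x * symSeminorm (a • q) R y) := by
  have h1 : ∀ (l : ℕ) (w : Fin l → W) (x : SymAlg 𝕜 V),
      s (B x (sym 𝕜 W (TensorAlgebra.tprod 𝕜 W l w))) ≤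
        K * ((l ! : ℝ) ^ R * ∏ i, (a • q) (w i)) * symSeminorm (a • p) R x := by
    intro l w x
    refine seminorm_le_mul_symSeminorm (a • p) R (s.comp (B.flip (sym 𝕜 W (TensorAlgebra.tprod 𝕜 W l w))))
      ?_ (fun k v => (h k l v w).trans_eq ?_) x
    · exact mul_nonneg hK (mul_nonneg (by positivity) (Finset.prod_nonneg fun i _ => apply_nonneg _ _))
    · rw [prod_smul_seminorm, prod_smul_seminorm, pow_add]
      ring
  have h2 := seminorm_le_mul_symSeminorm (a • q) R (s.comp (B x))
    (K := K * symSeminorm (a • p) R x) (mul_nonneg hK (apply_nonneg _ _))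
    (fun l w => (h1 l w x).trans_eq (by ring)) y
  rw [mul_assoc] at h2
  exact h2

theorem tensorSeminorm_mono (p : Seminorm 𝕜 V) {R R' : ℝ} (hR : R ≤ R') (x : TensorAlgebra 𝕜 V) :
    tensorSeminorm p R x ≤ tensorSeminorm p R' x := by
  rw [← one_mul (tensorSeminorm p R' x)]
  refine seminorm_le_mul_tensorSeminorm p R' _ zero_le_one (fun n v =>
    (tensorSeminorm_tprod_le p R v).trans ?_) x
  rw [one_mul]
  refine mul_le_mul_of_nonneg_right ?_ (Finset.prod_nonneg fun i _ => apply_nonneg _ _)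
  exact Real.rpow_le_rpow_of_exponent_le (by exact_mod_cast n.factorial_pos) hR

theorem tensorSeminorm_mono_seminorm {p q : Seminorm 𝕜 V} (hpq : p ≤ q) (R : ℝ)
    (x : TensorAlgebra 𝕜 V) : tensorSeminorm p R x ≤ tensorSeminorm q R x := by
  rw [← one_mul (tensorSeminorm q R x)]
  refine seminorm_le_mul_tensorSeminorm q R _ zero_le_one (fun n v =>
    (tensorSeminorm_tprod_le p R v).trans ?_) x
  rw [one_mul]
  exact mul_le_mul_of_nonneg_left
    (Finset.prod_le_prod (fun i _ => apply_nonneg _ _) fun i _ => hpq (v i)) (by positivity)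

end TensorSeminorm

/-! ### The Gutt star product agrees with the product built from left multiplications. -/

section GuttStarProd

variable {𝕜 : Type*} [RCLike 𝕜] {𝔤 : Type*} [LieRing 𝔤] [LieAlgebra 𝕜 𝔤]

theorem symAlg_induction {V : Type*} [AddCommGroup V] [Module 𝕜 V] {P : SymAlg 𝕜 V → Prop}
    (tprod : ∀ (n : ℕ) (v : Fin n → V), P (sym 𝕜 V (TensorAlgebra.tprod 𝕜 V n v)))
    (zero : P 0) (add : ∀ x y, P x → P y → P (x + y)) (smul : ∀ (a : 𝕜) x, P x → P (a • x))
    (x : SymAlg 𝕜 V) : P x := by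
  let W : Submodule 𝕜 (SymAlg 𝕜 V) :=
    { carrier := {x | P x}
      zero_mem' := zero
      add_mem' := fun {x y} hx hy => add x y hx hy
      smul_mem' := fun a x hx => smul a x hx }
  have h : W.mkQ ∘ₗ sym 𝕜 V = 0 := tensorAlgebra_ext fun n v => by
    rw [LinearMap.comp_apply, LinearMap.zero_apply, Submodule.mkQ_apply, Submodule.Quotient.mk_eq_zero]
    exact tprod n v
  have h1 : W.mkQ (sym 𝕜 V x) = 0 := congr($h (x : TensorAlgebra 𝕜 V))
  rw [sym_coe, Submodule.mkQ_apply, Submodule.Quotient.mk_eq_zero] at h1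
  exact h1

theorem exists_guttC_eq_zero (x y : SymAlg 𝕜 𝔤) : ∃ M : ℕ, ∀ n, M ≤ n → guttC 𝕜 n x y = 0 := by
  obtain ⟨K, hK⟩ := exists_symProj_eq_zero x
  obtain ⟨L, hL⟩ := exists_symProj_eq_zero y
  refine ⟨K + L, fun n hn => ?_⟩
  rw [guttC_eq_sum n x y hK hL]
  refine Finset.sum_eq_zero fun k hk => Finset.sum_eq_zero fun l hl => if_neg ?_
  have := Finset.mem_range.1 hk
  have := Finset.mem_range.1 hl
  omega

theorem guttStar_eq_sum (z : 𝕜) (x y : SymAlg 𝕜 𝔤) {M : ℕ}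
    (hM : ∀ n, M ≤ n → guttC 𝕜 n x y = 0) :
    guttStar z x y = ∑ n ∈ Finset.range M, z ^ n • guttC 𝕜 n x y := by
  refine finsum_eq_sum_of_support_subset _ fun n hn => ?_
  rw [Finset.coe_range, Set.mem_Iio]
  by_contra h
  exact hn (by simp [hM n (not_lt.1 h)])

theorem guttStar_add_left (z : 𝕜) (x x' y : SymAlg 𝕜 𝔤) :
    guttStar z (x + x') y = guttStar z x y + guttStar z x' y := by
  obtain ⟨K, hK⟩ := exists_guttC_eq_zero x y
  obtain ⟨K', hK'⟩ := exists_guttC_eq_zero x' y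
  have h : ∀ k, max K K' ≤ k → guttC 𝕜 k x y = 0 := fun k hk => hK k (le_of_max_le_left hk)
  have h' : ∀ k, max K K' ≤ k → guttC 𝕜 k x' y = 0 := fun k hk => hK' k (le_of_max_le_right hk)
  rw [guttStar_eq_sum z x y h, guttStar_eq_sum z x' y h', guttStar_eq_sum z (x + x') y
    (fun k hk => by rw [guttC_add_left, h k hk, h' k hk, add_zero]), ← Finset.sum_add_distrib]
  simp only [guttC_add_left, smul_add]

theorem guttStar_add_right (z : 𝕜) (x y y' : SymAlg 𝕜 𝔤) :
    guttStar z x (y + y') = guttStar z x y + guttStar z x y' := by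
  obtain ⟨K, hK⟩ := exists_guttC_eq_zero x y
  obtain ⟨K', hK'⟩ := exists_guttC_eq_zero x y'
  have h : ∀ k, max K K' ≤ k → guttC 𝕜 k x y = 0 := fun k hk => hK k (le_of_max_le_left hk)
  have h' : ∀ k, max K K' ≤ k → guttC 𝕜 k x y' = 0 := fun k hk => hK' k (le_of_max_le_right hk)
  rw [guttStar_eq_sum z x y h, guttStar_eq_sum z x y' h', guttStar_eq_sum z x (y + y')
    (fun k hk => by rw [guttC_add_right, h k hk, h' k hk, add_zero]), ← Finset.sum_add_distrib]
  simp only [guttC_add_right, smul_add]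

theorem guttStar_smul_left (z a : 𝕜) (x y : SymAlg 𝕜 𝔤) :
    guttStar z (a • x) y = a • guttStar z x y := by
  obtain ⟨K, hK⟩ := exists_guttC_eq_zero x y
  rw [guttStar_eq_sum z x y hK, guttStar_eq_sum z (a • x) y
    (fun k hk => by rw [guttC_smul_left, hK k hk, smul_zero]), Finset.smul_sum]
  refine Finset.sum_congr rfl fun k _ => ?_
  rw [guttC_smul_left, smul_comm]

theorem guttStar_smul_right (z a : 𝕜) (x y : SymAlg 𝕜 𝔤) :
    guttStar z x (a • y) = a • guttStar z x y := by
  obtain ⟨K, hK⟩ := exists_guttC_eq_zero x y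
  rw [guttStar_eq_sum z x y hK, guttStar_eq_sum z x (a • y)
    (fun k hk => by rw [guttC_smul_right, hK k hk, smul_zero]), Finset.smul_sum]
  refine Finset.sum_congr rfl fun k _ => ?_
  rw [guttC_smul_right, smul_comm]

theorem guttStar_eq_starProd (z : 𝕜) (x y : SymAlg 𝕜 𝔤) : guttStar z x y = starProd 𝔤 z x y := by
  induction x using symAlg_induction with
  | zero =>
    have := guttStar_smul_left z 0 (0 : SymAlg 𝕜 𝔤) y
    rw [zero_smul, zero_smul] at this
    rw [this, map_zero, LinearMap.zero_apply]
  | add x x' hx hx' => rw [guttStar_add_left, hx, hx', map_add, LinearMap.add_apply]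
  | smul a x hx => rw [guttStar_smul_left, hx, map_smul, LinearMap.smul_apply]
  | tprod k v =>
    induction y using symAlg_induction with
    | zero =>
      have := guttStar_smul_right z 0 (sym 𝕜 𝔤 (TensorAlgebra.tprod 𝕜 𝔤 k v)) 0
      rw [zero_smul, zero_smul] at this
      rw [this, map_zero]
    | add x x' hx hx' => rw [guttStar_add_right, hx, hx', map_add]
    | smul a x hx => rw [guttStar_smul_right, hx, map_smul]
    | tprod l w =>
      rw [starProd_sym_tprod_eq_sum z v w (Nat.lt_succ_self _), guttStar_eq_sum]
      intro n hn
      exact guttC_sym_tprod_eq_zero v w hn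

end GuttStarProd

/-! ### Factorial inequalities. -/

section FactorialEstimates

theorem pow_self_le_factorial_mul_exp (m : ℕ) : (m : ℝ) ^ m ≤ (m ! : ℝ) * Real.exp 1 ^ m := by
  have h := Real.pow_div_factorial_le_exp (m : ℝ) (Nat.cast_nonneg m) m
  rw [div_le_iff₀ (by exact_mod_cast m.factorial_pos)] at h
  rw [← Real.exp_nat_mul, mul_one, mul_comm]
  exact h

/-- Start from `d! ≤ d ^ d`. Since `d = m (1 + (d - m) / m) ≤ m exp ((d - m) / m)` and `d ≤ m N`,
one has `d ^ d ≤ m ^ d exp ((d - m) N)`; moreover `m ^ d ≤ (m ^ m) ^ N ≤ (m! e ^ m) ^ N`. The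
exponents of `e` add up to `d N`. -/
theorem factorial_le_exp_mul_factorial_pow {d m N : ℕ} (hmd : m ≤ d) (hm : 1 ≤ m) (hd : d ≤ m * N) :
    (d ! : ℝ) ≤ Real.exp 1 ^ (d * N) * (m ! : ℝ) ^ N := by
  have hm0 : (0 : ℝ) < m := by exact_mod_cast hm
  have hm1 : (1 : ℝ) ≤ m := by exact_mod_cast hm
  have hmd' : (m : ℝ) ≤ d := by exact_mod_cast hmd
  have h1 : (d : ℝ) ≤ m * Real.exp ((d - m) / m) := by
    have := Real.add_one_le_exp (((d : ℝ) - m) / m)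
    calc (d : ℝ) = m * ((d - m) / m + 1) := by field_simp; ring
      _ ≤ _ := mul_le_mul_of_nonneg_left this hm0.le
  have h2 : (d : ℝ) ^ d ≤ (m : ℝ) ^ d * Real.exp 1 ^ ((d - m) * N) := by
    calc (d : ℝ) ^ d ≤ (m * Real.exp ((d - m) / m)) ^ d := by gcongr
      _ = (m : ℝ) ^ d * Real.exp (d * ((d - m) / m)) := by rw [mul_pow, ← Real.exp_nat_mul]
      _ ≤ (m : ℝ) ^ d * Real.exp (((d - m) * N : ℕ) * 1) := by
        have h3 : (d : ℝ) * ((d - m) / m) ≤ ((d - m) * N : ℕ) * 1 := by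
          rw [mul_one, Nat.cast_mul, Nat.cast_sub hmd, mul_div_assoc', div_le_iff₀ hm0]
          have : (d : ℝ) ≤ m * N := by exact_mod_cast hd
          nlinarith [mul_le_mul_of_nonneg_left this (sub_nonneg.2 hmd')]
        gcongr
      _ = _ := by rw [Real.exp_nat_mul]
  have h4 : (m : ℝ) ^ d ≤ ((m ! : ℝ) * Real.exp 1 ^ m) ^ N := by
    calc (m : ℝ) ^ d ≤ (m : ℝ) ^ (m * N) := pow_le_pow_right₀ hm1 hd
      _ = ((m : ℝ) ^ m) ^ N := by rw [pow_mul]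
      _ ≤ _ := pow_le_pow_left₀ (by positivity) (pow_self_le_factorial_mul_exp m) N
  calc (d ! : ℝ) ≤ (d : ℝ) ^ d := by exact_mod_cast d.factorial_le_pow
    _ ≤ (m : ℝ) ^ d * Real.exp 1 ^ ((d - m) * N) := h2
    _ ≤ ((m ! : ℝ) * Real.exp 1 ^ m) ^ N * Real.exp 1 ^ ((d - m) * N) := by gcongr
    _ = Real.exp 1 ^ (m * N + (d - m) * N) * (m ! : ℝ) ^ N := by
      rw [mul_pow, ← pow_mul, pow_add]
      ring
    _ = _ := by rw [← add_mul, Nat.add_sub_cancel' hmd]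

theorem factorial_add_le (k l : ℕ) : ((k + l) ! : ℝ) ≤ 2 ^ (k + l) * (k ! * l !) := by
  have h := Nat.add_choose_mul_factorial_mul_factorial k l
  have h2 := (k + l).choose_le_two_pow l
  rw [← h]
  push_cast
  rw [mul_assoc]
  have h2 : ((k + l).choose l : ℝ) ≤ 2 ^ (k + l) := by exact_mod_cast h2
  gcongr

theorem descFactorial_mul_factorial {d n : ℕ} (hn : n ≤ d) :
    (d.descFactorial n : ℝ) * ((d - n) ! : ℝ) = (d ! : ℝ) := by
  rw [mul_comm]
  exact_mod_cast Nat.factorial_mul_descFactorial hn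

/-- Put `d = k + l`, `m = d - n`, `δ = 1 - R`, so that `R + ε = 1 - δ / N`. Apart from `2 ^ k` the
left side is `d! / m! ^ δ`; split `d!` into the powers with exponents `1 - δ / N` and `δ / N`. The
second is at most `e ^ d m! ^ δ` by `factorial_le_exp_mul_factorial_pow`, and the first is
distributed over `k!` and `l!` at the cost of `2 ^ d`. -/
theorem descFactorial_mul_rpow_le_of_nilpotent {k l n N : ℕ} {R : ℝ} (hN : 1 ≤ N) (hR0 : 0 ≤ R) (hR1 : R < 1)
    (hn : n ≤ k + l) (hkl : k + l ≤ (k + l - n) * N) :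
    2 ^ k * (k + l).descFactorial n * ((k + l - n) ! : ℝ) ^ R ≤
      (4 * Real.exp 1) ^ (k + l) * ((k ! : ℝ) ^ (R + ((N : ℝ) - 1) / N * (1 - R)) *
        (l ! : ℝ) ^ (R + ((N : ℝ) - 1) / N * (1 - R))) := by
  rcases Nat.eq_zero_or_pos (k + l) with h0 | h0
  · obtain ⟨rfl, rfl⟩ : k = 0 ∧ l = 0 := by omega
    obtain rfl : n = 0 := by omega
    simp
  have hN0 : (0 : ℝ) < N := by exact_mod_cast hN
  have hm : 1 ≤ k + l - n := by
    by_contra h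
    rw [show k + l - n = 0 by omega, zero_mul] at hkl
    omega
  set d := k + l with hd
  set m := d - n with hm'
  set δ := 1 - R with hδ
  have hδ0 : 0 ≤ δ := by rw [hδ]; linarith
  have hδ1 : δ ≤ 1 := by rw [hδ]; linarith
  have hdesc := descFactorial_mul_factorial hn
  rw [← hm'] at hdesc
  have hmf : (0 : ℝ) < (m ! : ℝ) := by positivity
  have hdf : (0 : ℝ) < (d ! : ℝ) := by positivity
  have hexp : R + ((N : ℝ) - 1) / N * δ = 1 - δ / N := by
    rw [hδ]
    field_simp
    ring
  rw [hexp]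
  have hδN1 : δ / N ≤ 1 := by
    rw [div_le_one hN0]
    have : (1 : ℝ) ≤ N := by exact_mod_cast hN
    linarith
  have hδN0 : 0 ≤ δ / N := by positivity
  have h1 : (d.descFactorial n : ℝ) * (m ! : ℝ) ^ R = (d ! : ℝ) ^ (1 - δ / N) *
      ((d ! : ℝ) ^ (δ / N) / (m ! : ℝ) ^ δ) := by
    rw [mul_div_assoc', ← Real.rpow_add hdf, sub_add_cancel, Real.rpow_one, ← hdesc,
      eq_div_iff (by positivity), mul_assoc, ← Real.rpow_add hmf, hδ, add_sub_cancel, Real.rpow_one]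
  have h2 : (d ! : ℝ) ^ (δ / N) ≤ Real.exp 1 ^ d * (m ! : ℝ) ^ δ := by
    calc (d ! : ℝ) ^ (δ / N) ≤ (Real.exp 1 ^ (d * N) * (m ! : ℝ) ^ N) ^ (δ / N) :=
          Real.rpow_le_rpow hdf.le
            (factorial_le_exp_mul_factorial_pow (Nat.sub_le _ _) hm hkl) hδN0
      _ = Real.exp 1 ^ ((d : ℝ) * δ) * (m ! : ℝ) ^ δ := by
        rw [Real.mul_rpow (by positivity) (by positivity), ← Real.rpow_natCast, ← Real.rpow_natCast,
          ← Real.rpow_mul (by positivity), ← Real.rpow_mul (by positivity)]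
        congr 2
        · push_cast
          field_simp
        · field_simp
      _ ≤ Real.exp 1 ^ (d : ℝ) * (m ! : ℝ) ^ δ := by
        have : (d : ℝ) * δ ≤ d := mul_le_of_le_one_right (Nat.cast_nonneg _) hδ1
        have h1e : (1 : ℝ) ≤ Real.exp 1 := Real.one_le_exp zero_le_one
        gcongr
      _ = _ := by rw [Real.rpow_natCast]
  have h3 : (d ! : ℝ) ^ (δ / N) / (m ! : ℝ) ^ δ ≤ Real.exp 1 ^ d := by
    rw [div_le_iff₀ (by positivity)]
    exact h2
  have h4 : (d ! : ℝ) ^ (1 - δ / N) ≤ 2 ^ d * ((k ! : ℝ) ^ (1 - δ / N) * (l ! : ℝ) ^ (1 - δ / N)) := by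
    calc (d ! : ℝ) ^ (1 - δ / N) ≤ (2 ^ d * ((k ! : ℝ) * l !)) ^ (1 - δ / N) :=
          Real.rpow_le_rpow hdf.le (factorial_add_le k l) (by linarith)
      _ = (2 ^ d : ℝ) ^ (1 - δ / N) * ((k ! : ℝ) ^ (1 - δ / N) * (l ! : ℝ) ^ (1 - δ / N)) := by
        rw [Real.mul_rpow (by positivity) (by positivity), Real.mul_rpow (by positivity) (by positivity)]
      _ ≤ (2 ^ d : ℝ) ^ (1 : ℝ) * ((k ! : ℝ) ^ (1 - δ / N) * (l ! : ℝ) ^ (1 - δ / N)) := by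
        refine mul_le_mul_of_nonneg_right ?_ (by positivity)
        exact Real.rpow_le_rpow_of_exponent_le (one_le_pow₀ one_le_two) (by linarith)
      _ = _ := by rw [Real.rpow_one]
  have h5 : (2 : ℝ) ^ k ≤ 2 ^ d := pow_le_pow_right₀ one_le_two (by omega)
  set A := (k ! : ℝ) ^ (1 - δ / N) * (l ! : ℝ) ^ (1 - δ / N) with hA
  have hA0 : 0 ≤ A := by positivity
  rw [mul_assoc, h1]
  calc (2 : ℝ) ^ k * ((d ! : ℝ) ^ (1 - δ / N) * ((d ! : ℝ) ^ (δ / N) / (m ! : ℝ) ^ δ))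
      ≤ 2 ^ d * ((2 ^ d * A) * Real.exp 1 ^ d) := by gcongr
    _ = (2 ^ d * 2 ^ d * Real.exp 1 ^ d) * A := by ring
    _ = _ := by rw [← mul_pow, ← mul_pow]; norm_num

/-- A falling factorial is at least `1`, hence bounded by its `R`-th power, which combines with `(k
+ l - n)! ^ R` to `(k + l)! ^ R`. Nilpotency is not needed. -/
theorem descFactorial_mul_rpow_le_of_one_le {k l n : ℕ} {R : ℝ} (hR : 1 ≤ R) (hn : n ≤ k + l) :
    2 ^ k * (k + l).descFactorial n * ((k + l - n) ! : ℝ) ^ R ≤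
      (2 * 2 ^ R) ^ (k + l) * ((k ! : ℝ) ^ R * (l ! : ℝ) ^ R) := by
  have hdesc := descFactorial_mul_factorial hn
  set d := k + l with hd
  have h1 : (1 : ℝ) ≤ d.descFactorial n := by exact_mod_cast Nat.descFactorial_pos.2 hn
  have h2 : (d.descFactorial n : ℝ) * ((d - n) ! : ℝ) ^ R ≤ (d ! : ℝ) ^ R := by
    rw [← hdesc, Real.mul_rpow (by positivity) (by positivity)]
    refine mul_le_mul_of_nonneg_right ?_ (by positivity)
    conv_lhs => rw [← Real.rpow_one (d.descFactorial n : ℝ)]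
    exact Real.rpow_le_rpow_of_exponent_le h1 hR
  have h3 : (d ! : ℝ) ^ R ≤ (2 ^ R) ^ d * ((k ! : ℝ) ^ R * (l ! : ℝ) ^ R) := by
    calc (d ! : ℝ) ^ R ≤ (2 ^ d * ((k ! : ℝ) * l !)) ^ R :=
          Real.rpow_le_rpow (by positivity) (factorial_add_le k l) (by linarith)
      _ = _ := by
        rw [Real.mul_rpow (by positivity) (by positivity), Real.mul_rpow (by positivity) (by positivity),
          ← Real.rpow_natCast, ← Real.rpow_natCast, ← Real.rpow_mul (by positivity),
          ← Real.rpow_mul (by positivity), mul_comm R]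
  have h5 : (2 : ℝ) ^ k ≤ 2 ^ d := pow_le_pow_right₀ one_le_two (by omega)
  set A := (k ! : ℝ) ^ R * (l ! : ℝ) ^ R with hA
  have hA0 : 0 ≤ A := by positivity
  rw [mul_assoc]
  calc (2 : ℝ) ^ k * (d.descFactorial n * ((d - n) ! : ℝ) ^ R) ≤ 2 ^ d * ((2 ^ R) ^ d * A) := by
        exact mul_le_mul h5 (h2.trans h3) (by positivity) (by positivity)
    _ = _ := by rw [mul_pow, mul_assoc]

/-- Here the falling factorial is bounded by `n! 2 ^ (k + l)`. The factor `n!` excludes summation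
over `n`, but the exponent `R` is kept, as continuity of a single `Cₙ` on `Sym_R` requires. -/
theorem descFactorial_mul_rpow_le_of_le_one {k l n : ℕ} {R : ℝ} (hR0 : 0 ≤ R) (hR1 : R ≤ 1) :
    2 ^ k * (k + l).descFactorial n * ((k + l - n) ! : ℝ) ^ R ≤
      n ! * (8 ^ (k + l) * ((k ! : ℝ) ^ R * (l ! : ℝ) ^ R)) := by
  set d := k + l with hd
  have h1 : (d.descFactorial n : ℝ) ≤ n ! * 2 ^ d := by
    rw [Nat.descFactorial_eq_factorial_mul_choose]
    exact_mod_cast Nat.mul_le_mul_left _ (d.choose_le_two_pow n)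
  have h2 : ((d - n) ! : ℝ) ^ R ≤ (d ! : ℝ) ^ R :=
    Real.rpow_le_rpow (by positivity) (by exact_mod_cast Nat.factorial_le (Nat.sub_le _ _)) hR0
  have h3 : (d ! : ℝ) ^ R ≤ 2 ^ d * ((k ! : ℝ) ^ R * (l ! : ℝ) ^ R) := by
    calc (d ! : ℝ) ^ R ≤ (2 ^ d * ((k ! : ℝ) * l !)) ^ R :=
          Real.rpow_le_rpow (by positivity) (factorial_add_le k l) hR0
      _ = (2 ^ d : ℝ) ^ R * ((k ! : ℝ) ^ R * (l ! : ℝ) ^ R) := by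
        rw [Real.mul_rpow (by positivity) (by positivity), Real.mul_rpow (by positivity) (by positivity)]
      _ ≤ (2 ^ d : ℝ) ^ (1 : ℝ) * ((k ! : ℝ) ^ R * (l ! : ℝ) ^ R) := by
        refine mul_le_mul_of_nonneg_right ?_ (by positivity)
        exact Real.rpow_le_rpow_of_exponent_le (one_le_pow₀ one_le_two) hR1
      _ = _ := by rw [Real.rpow_one]
  have h5 : (2 : ℝ) ^ k ≤ 2 ^ d := pow_le_pow_right₀ one_le_two (by omega)
  set A := (k ! : ℝ) ^ R * (l ! : ℝ) ^ R with hA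
  have hA0 : 0 ≤ A := by positivity
  calc (2 : ℝ) ^ k * d.descFactorial n * ((d - n) ! : ℝ) ^ R ≤ 2 ^ d * (n ! * 2 ^ d) * (2 ^ d * A) := by
        gcongr
        exact h2.trans h3
    _ = n ! * ((2 ^ d * 2 ^ d * 2 ^ d) * A) := by ring
    _ = _ := by rw [← mul_pow, ← mul_pow]; norm_num

end FactorialEstimates

/-! ### Bounds for `Cₙ` on elementary tensors, and vanishing by nilpotency. -/

section GuttEstimates

variable {𝕜 : Type*} [RCLike 𝕜] {𝔤 : Type*} [LieRing 𝔤] [LieAlgebra 𝕜 𝔤]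

theorem symSeminorm_wordsProd_le {p q : Seminorm 𝕜 𝔤} (hpq : IsAsymptoticEstimate p q) (R : ℝ)
    (L : List (FreeMagma 𝔤)) : symSeminorm p R (symEquiv 𝕜 𝔤 (wordsProd 𝕜 L)) ≤
      (L.length ! : ℝ) ^ R * lettersProd q L := by
  rw [symEquiv_wordsProd]
  refine (symSeminorm_sym_tprod_le p R _).trans (mul_le_mul_of_nonneg_left ?_ (by positivity))
  rw [lettersProd, ← List.prod_ofFn]
  conv_rhs => rw [← List.ofFn_get L, List.map_ofFn]
  rw [List.prod_ofFn, List.prod_ofFn]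
  exact Finset.prod_le_prod (fun _ _ => apply_nonneg _ _) fun i _ => hpq (L.get i)

theorem guttC_sym_tprod_mem_of_forall (W : Submodule 𝕜 (SymAlg 𝕜 𝔤)) {n k l : ℕ} (hn : n ≤ k + l)
    (hW : ∀ L : List (FreeMagma 𝔤), L.length = k + l - n → (L.map FreeMagma.length).sum = k + l →
      symEquiv 𝕜 𝔤 (wordsProd 𝕜 L) ∈ W) (v : Fin k → 𝔤) (w : Fin l → 𝔤) :
    guttC 𝕜 n (sym 𝕜 𝔤 (TensorAlgebra.tprod 𝕜 𝔤 k v)) (sym 𝕜 𝔤 (TensorAlgebra.tprod 𝕜 𝔤 l w)) ∈ W := by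
  rw [guttC_sym_tprod]
  refine W.smul_mem _ (W.sum_mem fun σ _ => ?_)
  refine (leftMulPart_ofFn_hull 0 (v ∘ σ) w hn).mem (W.comap (symEquiv 𝕜 𝔤).toLinearMap) ?_
  rintro _ _ ⟨L, hm, hd, -, rfl⟩
  exact hW L hm hd

/-- Pigeonhole: if `k + l` letters are distributed over `k + l - n` words and `(k + l - n) N < k +
l`, some word has more than `N` letters and vanishes. -/
theorem guttC_sym_tprod_eq_zero_of_nilpotent {N : ℕ}
    (hnil : LieModule.lowerCentralSeries 𝕜 𝔤 𝔤 N = ⊥) {n k l : ℕ} (hn : n ≤ k + l)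
    (hkl : (k + l - n) * N < k + l) (v : Fin k → 𝔤) (w : Fin l → 𝔤) :
    guttC 𝕜 n (sym 𝕜 𝔤 (TensorAlgebra.tprod 𝕜 𝔤 k v)) (sym 𝕜 𝔤 (TensorAlgebra.tprod 𝕜 𝔤 l w)) = 0 := by
  rw [← Submodule.mem_bot 𝕜]
  refine guttC_sym_tprod_mem_of_forall ⊥ hn (fun L hm hd => ?_) v w
  obtain ⟨u, hu, huN⟩ : ∃ u ∈ L, N < u.length := by
    by_contra! h
    have h1 : (L.map FreeMagma.length).sum ≤ (L.map FreeMagma.length).length • N :=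
      List.sum_le_card_nsmul _ _ fun x hx => by
        obtain ⟨u, hu, rfl⟩ := List.mem_map.1 hx
        exact h u hu
    rw [List.length_map, hm, hd, smul_eq_mul] at h1
    omega
  have h0 : wordsProd 𝕜 L = 0 := List.prod_eq_zero
    (List.mem_map.2 ⟨u, hu, by rw [bracketWord_eq_zero hnil huN, map_zero]⟩)
  rw [h0, map_zero]
  exact Submodule.zero_mem _

theorem symSeminorm_guttC_sym_tprod_le {p q : Seminorm 𝕜 𝔤} (hpq : IsAsymptoticEstimate p q) (R : ℝ)
    {n k l : ℕ} (hn : n ≤ k + l) (v : Fin k → 𝔤) (w : Fin l → 𝔤) :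
    symSeminorm p R (guttC 𝕜 n (sym 𝕜 𝔤 (TensorAlgebra.tprod 𝕜 𝔤 k v))
      (sym 𝕜 𝔤 (TensorAlgebra.tprod 𝕜 𝔤 l w))) ≤
      2 ^ k * (k + l).descFactorial n * ((k + l - n) ! : ℝ) ^ R * ((∏ i, q (v i)) * ∏ i, q (w i)) := by
  have h : ∀ σ : Equiv.Perm (Fin k), symSeminorm p R (symEquiv 𝕜 𝔤 (leftMulPart 𝕜 (List.ofFn (v ∘ σ)) n
      (SymmetricAlgebra.algHom 𝕜 𝔤 (TensorAlgebra.tprod 𝕜 𝔤 l w)))) ≤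
      2 ^ k * (k + l).descFactorial n * ((k + l - n) ! : ℝ) ^ R *
        ((∏ i, q (v i)) * ∏ i, q (w i)) := by
    intro σ
    refine ((leftMulPart_ofFn_hull q (v ∘ σ) w hn).seminorm_le
      ((symSeminorm p R).comp (symEquiv 𝕜 𝔤).toLinearMap) (((k + l - n) ! : ℝ) ^ R) (by positivity)
      ?_).trans_eq ?_
    · rintro _ _ ⟨L, hm, hd, rfl, rfl⟩
      rw [← hm]
      exact symSeminorm_wordsProd_le hpq R L
    · rw [show ∏ i, q ((v ∘ σ) i) = ∏ i, q (v i) from Equiv.prod_comp σ fun i => q (v i)]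
      ring
  rw [guttC_sym_tprod, map_smul_eq_mul, norm_inv, RCLike.norm_natCast,
    inv_mul_le_iff₀ (by exact_mod_cast k.factorial_pos)]
  refine (seminorm_sum_le _ _ _).trans ((Finset.sum_le_sum fun σ _ => h σ).trans_eq ?_)
  rw [Finset.sum_const, Finset.card_univ, Fintype.card_perm, Fintype.card_fin, nsmul_eq_mul]

end GuttEstimates

/-! ### Continuous seminorms and bilinear bounds. -/

section ContinuousSeminorms

variable {𝕜 : Type*} [RCLike 𝕜]

theorem exists_continuous_seminorm_ball_subset {E : Type*} [AddCommGroup E] [Module 𝕜 E]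
    [TopologicalSpace E] [PolynormableSpace 𝕜 E] {U : Set E} (hU : U ∈ nhds 0) :
    ∃ p : Seminorm 𝕜 E, Continuous p ∧ ∀ x, p x < 1 → x ∈ U := by
  have hE := PolynormableSpace.withSeminorms 𝕜 E
  have := hE.topologicalAddGroup
  have := hE.continuousSMul
  obtain ⟨s, r, hr, hs⟩ := (hE.mem_nhds_iff 0 U).1 hU
  refine ⟨r.toNNReal⁻¹ • s.sup fun p : {p : Seminorm 𝕜 E // Continuous p} => p.1, ?_, fun x hx => ?_⟩
  · exact (Seminorm.continuous_finsetSup fun p _ => p.2).const_smul _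
  · apply hs
    rw [Seminorm.mem_ball_zero]
    have hx : (r.toNNReal⁻¹ : ℝ≥0) * (s.sup fun p : {p : Seminorm 𝕜 E // Continuous p} => p.1) x < 1 := hx
    rw [NNReal.coe_inv, Real.coe_toNNReal _ hr.le, inv_mul_lt_iff₀ hr, mul_one] at hx
    exact hx

theorem exists_seminorm_bilin_le {E F G : Type*} [AddCommGroup E] [Module 𝕜 E]
    [TopologicalSpace E] [PolynormableSpace 𝕜 E] [AddCommGroup F] [Module 𝕜 F]
    [TopologicalSpace F] [PolynormableSpace 𝕜 F] [AddCommGroup G] [Module 𝕜 G]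
    (b : E →ₗ[𝕜] F →ₗ[𝕜] G) (s : Seminorm 𝕜 G) (hs : Continuous fun x : E × F => s (b x.1 x.2)) :
    ∃ (p : Seminorm 𝕜 E) (q : Seminorm 𝕜 F), Continuous p ∧ Continuous q ∧
      ∀ x y, s (b x y) ≤ p x * q y := by
  have h0 : {x : E × F | s (b x.1 x.2) < 1} ∈ nhds (0 : E × F) :=
    (isOpen_Iio.preimage hs).mem_nhds (by simp)
  rw [← Prod.mk_zero_zero, nhds_prod_eq, Filter.mem_prod_iff] at h0
  obtain ⟨U, hU, V, hV, hUV⟩ := h0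
  obtain ⟨p, hp, hpU⟩ := exists_continuous_seminorm_ball_subset (𝕜 := 𝕜) hU
  obtain ⟨q, hq, hqV⟩ := exists_continuous_seminorm_ball_subset (𝕜 := 𝕜) hV
  refine ⟨p, q, hp, hq, fun x y => ?_⟩
  -- Both arguments are rescaled into the unit balls; the `ε` is needed because `p x` or `q y` may
  -- vanish.
  have key : ∀ ε > 0, s (b x y) ≤ (p x + ε) * (q y + ε) := by
    intro ε hε
    have hpx : 0 < p x + ε := add_pos_of_nonneg_of_pos (apply_nonneg _ _) hε
    have hqy : 0 < q y + ε := add_pos_of_nonneg_of_pos (apply_nonneg _ _) hε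
    have h1 : ((p x + ε : ℝ) : 𝕜)⁻¹ • x ∈ U := by
      apply hpU
      rw [map_smul_eq_mul, norm_inv, RCLike.norm_ofReal, abs_of_pos hpx, inv_mul_lt_iff₀ hpx, mul_one]
      exact lt_add_of_pos_right _ hε
    have h2 : ((q y + ε : ℝ) : 𝕜)⁻¹ • y ∈ V := by
      apply hqV
      rw [map_smul_eq_mul, norm_inv, RCLike.norm_ofReal, abs_of_pos hqy, inv_mul_lt_iff₀ hqy, mul_one]
      exact lt_add_of_pos_right _ hε
    have h3 : s (b (((p x + ε : ℝ) : 𝕜)⁻¹ • x) (((q y + ε : ℝ) : 𝕜)⁻¹ • y)) < 1 :=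
      hUV (Set.mk_mem_prod h1 h2)
    rw [map_smul b, LinearMap.smul_apply, map_smul (b x), map_smul_eq_mul, map_smul_eq_mul, norm_inv,
      norm_inv, RCLike.norm_ofReal, RCLike.norm_ofReal, abs_of_pos hqy, abs_of_pos hpx,
      inv_mul_lt_iff₀ hpx, inv_mul_lt_iff₀ hqy, mul_one, mul_comm] at h3
    exact h3.le
  have ht : Filter.Tendsto (fun ε : ℝ => (p x + ε) * (q y + ε)) (nhdsWithin 0 (Set.Ioi 0))
      (nhds ((p x + 0) * (q y + 0))) := by
    refine Filter.Tendsto.mono_left ?_ nhdsWithin_le_nhds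
    exact Continuous.tendsto (by fun_prop) 0
  rw [add_zero, add_zero] at ht
  exact ge_of_tendsto ht (Filter.eventually_of_mem self_mem_nhdsWithin key)

end ContinuousSeminorms

/-! ### Existence of asymptotic estimates. -/

section AsymptoticEstimates

variable {𝕜 : Type*} [RCLike 𝕜] {𝔤 : Type*} [LieRing 𝔤] [LieAlgebra 𝕜 𝔤]

theorem exists_isAsymptoticEstimate [TopologicalSpace 𝔤] [PolynormableSpace 𝕜 𝔤]
    (hbracket : Continuous fun x : 𝔤 × 𝔤 => ⁅x.1, x.2⁆) {N : ℕ}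
    (hnil : LieModule.lowerCentralSeries 𝕜 𝔤 𝔤 N = ⊥) (p : Seminorm 𝕜 𝔤) (hp : Continuous p) :
    ∃ q : Seminorm 𝕜 𝔤, Continuous q ∧ IsAsymptoticEstimate p q := by
  have step : ∀ p : {p : Seminorm 𝕜 𝔤 // Continuous p}, ∃ q : {p : Seminorm 𝕜 𝔤 // Continuous p},
      p.1 ≤ q.1 ∧ ∀ x y, p.1 ⁅x, y⁆ ≤ q.1 x * q.1 y := by
    rintro ⟨p, hp⟩
    obtain ⟨r, r', hr, hr', h⟩ := exists_seminorm_bilin_le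
      (LieModule.toEnd 𝕜 𝔤 𝔤 : 𝔤 →ₗ[𝕜] 𝔤 →ₗ[𝕜] 𝔤) p (hp.comp hbracket)
    -- Adding `p` makes the iterated seminorms increase, so that both halves of a word can be
    -- estimated by the same later seminorm.
    refine ⟨⟨p + (r + r'), hp.add (hr.add hr')⟩, fun x => ?_, fun x y => (h x y).trans ?_⟩
    · exact le_add_of_nonneg_right (apply_nonneg (r + r') x)
    · refine mul_le_mul ?_ ?_ (apply_nonneg _ _) (apply_nonneg _ _)
      · exact (le_add_of_nonneg_right (apply_nonneg r' x)).trans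
          (le_add_of_nonneg_left (apply_nonneg p x))
      · exact (le_add_of_nonneg_left (apply_nonneg r y)).trans
          (le_add_of_nonneg_left (apply_nonneg p y))
  choose f hf hf' using step
  let P : ℕ → {p : Seminorm 𝕜 𝔤 // Continuous p} := fun n => f^[n] ⟨p, hp⟩
  have hP : ∀ n, P (n + 1) = f (P n) := fun n => Function.iterate_succ_apply' f n _
  have hmono : Monotone fun n => (P n).1 := monotone_nat_of_le_succ fun n => by
    rw [hP]
    exact hf _
  have key : ∀ (i j : ℕ) (w : FreeMagma 𝔤), w.length ≤ i + 1 →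
      (P j).1 (bracketWord w) ≤ letterProd (P (j + i)).1 w := by
    intro i
    induction i with
    | zero =>
      intro j w hw
      induction w with
      | ih1 x => exact le_rfl
      | ih2 a b =>
        have := length_pos a
        have := length_pos b
        rw [length_mul] at hw
        omega
    | succ i ih =>
      intro j w hw
      induction w with
      | ih1 x => exact hmono (Nat.le_add_right j (i + 1)) x
      | ih2 a b =>
        have ha := length_pos a
        have hb := length_pos b
        rw [length_mul] at hw
        have h1 := ih (j + 1) a (by omega)
        have h2 := ih (j + 1) b (by omega)
        rw [show j + 1 + i = j + (i + 1) by omega] at h1 h2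
        rw [bracketWord_mul, letterProd_mul]
        refine (hf' (P j) _ _).trans ?_
        rw [← hP]
        exact mul_le_mul h1 h2 (apply_nonneg _ _) (letterProd_nonneg _ _)
  -- The halves of a word are shorter than the word, so `N` iterations suffice for all words of
  -- length at most `N + 1`; words longer than `N` vanish.
  refine ⟨(P N).1, (P N).2, fun w => ?_⟩
  rcases le_or_gt w.length N with h | h
  · have := key N 0 w (by omega)
    rwa [zero_add] at this
  · rw [bracketWord_eq_zero hnil h, map_zero]
    exact letterProd_nonneg _ _

end AsymptoticEstimates

/-! ### The counit and the augmentation projection. -/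

section Counit

variable {𝕜 : Type*} [RCLike 𝕜] {V : Type*} [AddCommGroup V] [Module 𝕜 V]

theorem symCounit_sym_tprod {k : ℕ} (hk : k ≠ 0) (v : Fin k → V) :
    symCounit 𝕜 V (sym 𝕜 V (TensorAlgebra.tprod 𝕜 V k v)) = 0 := by
  have h : ∀ v : Fin k → V, TensorAlgebra.algebraMapInv (TensorAlgebra.tprod 𝕜 V k v) = (0 : 𝕜) := by
    intro v
    obtain ⟨k, rfl⟩ := Nat.exists_eq_succ_of_ne_zero hk
    rw [TensorAlgebra.tprod_apply, List.ofFn_succ, List.prod_cons, map_mul,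
      TensorAlgebra.algebraMapInv, TensorAlgebra.lift_ι_apply]
    simp
  rw [symCounit, LinearMap.comp_apply, Submodule.subtype_apply, coe_sym, symmetrizer_tprod]
  simp [-TensorAlgebra.tprod_apply, h]

theorem sym_tprod_zero (v : Fin 0 → V) :
    sym 𝕜 V (TensorAlgebra.tprod 𝕜 V 0 v) = symOne 𝕜 V := by
  simp [symOne]

variable (𝕜 V) in
/-- The projection onto the kernel of the counit. -/
def augProj : SymAlg 𝕜 V →ₗ[𝕜] SymAlg 𝕜 V :=
  LinearMap.id - (symCounit 𝕜 V).smulRight (symOne 𝕜 V)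

theorem augProj_eq_self {x : SymAlg 𝕜 V} (hx : symCounit 𝕜 V x = 0) : augProj 𝕜 V x = x := by
  simp [augProj, hx]

theorem augProj_symOne : augProj 𝕜 V (symOne 𝕜 V) = 0 := by
  simp [augProj, symCounit_symOne]

theorem augProj_sym_tprod {k : ℕ} (hk : k ≠ 0) (v : Fin k → V) :
    augProj 𝕜 V (sym 𝕜 V (TensorAlgebra.tprod 𝕜 V k v)) = sym 𝕜 V (TensorAlgebra.tprod 𝕜 V k v) :=
  augProj_eq_self (symCounit_sym_tprod hk v)

end Counit

/-! ### From elementary tensors to the estimates for `Cₙ` and the star product. -/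

section GuttEstimates

variable {𝕜 : Type*} [RCLike 𝕜] {𝔤 : Type*} [LieRing 𝔤] [LieAlgebra 𝕜 𝔤]

/-- The values of `Cₙ` on elementary tensors are bounded geometrically, uniformly in `n`. -/
def GuttBound (p : Seminorm 𝕜 𝔤) (R : ℝ) (q : Seminorm 𝕜 𝔤) (R' a : ℝ) : Prop :=
  ∀ (n k l : ℕ) (v : Fin k → 𝔤) (w : Fin l → 𝔤),
    symSeminorm p R (guttC 𝕜 n (sym 𝕜 𝔤 (TensorAlgebra.tprod 𝕜 𝔤 k v))
      (sym 𝕜 𝔤 (TensorAlgebra.tprod 𝕜 𝔤 l w))) ≤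
      a ^ (k + l) * ((k ! : ℝ) ^ R' * (l ! : ℝ) ^ R') * ((∏ i, q (v i)) * ∏ i, q (w i))

theorem guttBound_rhs_nonneg (q : Seminorm 𝕜 𝔤) (R' : ℝ) {a : ℝ} (ha : 0 ≤ a) {k l : ℕ}
    (v : Fin k → 𝔤) (w : Fin l → 𝔤) :
    0 ≤ a ^ (k + l) * ((k ! : ℝ) ^ R' * (l ! : ℝ) ^ R') * ((∏ i, q (v i)) * ∏ i, q (w i)) :=
  mul_nonneg (by positivity) (mul_nonneg (Finset.prod_nonneg fun _ _ => apply_nonneg _ _)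
    (Finset.prod_nonneg fun _ _ => apply_nonneg _ _))

theorem guttBound_of_nilpotent {N : ℕ} (hN : 1 ≤ N) (hnil : LieModule.lowerCentralSeries 𝕜 𝔤 𝔤 N = ⊥)
    {p q : Seminorm 𝕜 𝔤} (hpq : IsAsymptoticEstimate p q) {R : ℝ} (hR0 : 0 ≤ R) (hR1 : R < 1) :
    GuttBound p R q (R + ((N : ℝ) - 1) / N * (1 - R)) (4 * Real.exp 1) := by
  intro n k l v w
  have hnn := guttBound_rhs_nonneg q (R + ((N : ℝ) - 1) / N * (1 - R))
    (show 0 ≤ 4 * Real.exp 1 by positivity) v w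
  rcases lt_or_ge (k + l) n with hn | hn
  · rw [guttC_sym_tprod_eq_zero v w hn, map_zero]
    exact hnn
  rcases lt_or_ge ((k + l - n) * N) (k + l) with hkl | hkl
  · rw [guttC_sym_tprod_eq_zero_of_nilpotent hnil hn hkl v w, map_zero]
    exact hnn
  refine (symSeminorm_guttC_sym_tprod_le hpq R hn v w).trans (mul_le_mul_of_nonneg_right
    (descFactorial_mul_rpow_le_of_nilpotent hN hR0 hR1 hn hkl)
    (mul_nonneg (Finset.prod_nonneg fun _ _ => apply_nonneg _ _)
      (Finset.prod_nonneg fun _ _ => apply_nonneg _ _)))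

theorem guttBound_of_one_le {p q : Seminorm 𝕜 𝔤} (hpq : IsAsymptoticEstimate p q) {R : ℝ} (hR : 1 ≤ R) :
    GuttBound p R q R (2 * 2 ^ R) := by
  intro n k l v w
  rcases lt_or_ge (k + l) n with hn | hn
  · rw [guttC_sym_tprod_eq_zero v w hn, map_zero]
    exact guttBound_rhs_nonneg q R (by positivity) v w
  exact (symSeminorm_guttC_sym_tprod_le hpq R hn v w).trans (mul_le_mul_of_nonneg_right
    (descFactorial_mul_rpow_le_of_one_le hR hn)
    (mul_nonneg (Finset.prod_nonneg fun _ _ => apply_nonneg _ _)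
      (Finset.prod_nonneg fun _ _ => apply_nonneg _ _)))

theorem symSeminorm_guttC_le_of_le_one {p q : Seminorm 𝕜 𝔤} (hpq : IsAsymptoticEstimate p q) {R : ℝ}
    (hR0 : 0 ≤ R) (hR1 : R ≤ 1) (n : ℕ) (x y : SymAlg 𝕜 𝔤) : symSeminorm p R (guttC 𝕜 n x y) ≤
      n ! * (symSeminorm ((8 : ℝ≥0) • q) R x * symSeminorm ((8 : ℝ≥0) • q) R y) := by
  refine bilin_le_mul_symSeminorm (guttBilin 𝕜 𝔤 n) (symSeminorm p R) q q R (by positivity) 8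
    (fun k l v w => ?_) x y
  rw [guttBilin_apply]
  rcases lt_or_ge (k + l) n with hn | hn
  · rw [guttC_sym_tprod_eq_zero v w hn, map_zero]
    exact mul_nonneg (by positivity) (guttBound_rhs_nonneg q R (by positivity) v w)
  refine (symSeminorm_guttC_sym_tprod_le hpq R hn v w).trans ((mul_le_mul_of_nonneg_right
    (descFactorial_mul_rpow_le_of_le_one hR0 hR1)
    (mul_nonneg (Finset.prod_nonneg fun _ _ => apply_nonneg _ _)
      (Finset.prod_nonneg fun _ _ => apply_nonneg _ _))).trans_eq ?_)
  rw [NNReal.coe_ofNat]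
  ring

/-- Since `Cₙ` vanishes for `n > k + l`, the factor `M ^ n` is at most `(M + 1) ^ (k + l)` and is
absorbed by rescaling `q`. Adding `1` to `M` covers the case `M < 1`. -/
theorem GuttBound.pow_mul_guttC_le {p q : Seminorm 𝕜 𝔤} {R R' : ℝ} {a : ℝ≥0} (h : GuttBound p R q R' a)
    (M : ℝ≥0) (n : ℕ) (x y : SymAlg 𝕜 𝔤) : M ^ n * symSeminorm p R (guttC 𝕜 n x y) ≤
      symSeminorm ((a * (M + 1)) • q) R' x * symSeminorm ((a * (M + 1)) • q) R' y := by
  have := bilin_le_mul_symSeminorm (guttBilin 𝕜 𝔤 n) ((M ^ n) • symSeminorm p R) q q R'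
    zero_le_one (a * (M + 1)) (fun k l v w => ?_) x y
  · rw [one_mul] at this
    exact_mod_cast this
  rw [one_mul, guttBilin_apply]
  change ((M ^ n : ℝ≥0) : ℝ) * symSeminorm p R (guttC 𝕜 n _ _) ≤ _
  rcases lt_or_ge (k + l) n with hn | hn
  · rw [guttC_sym_tprod_eq_zero v w hn, map_zero, mul_zero]
    exact guttBound_rhs_nonneg q R' (by positivity) v w
  · have h1 : (M : ℝ) ^ n ≤ (M + 1) ^ (k + l) :=
      (pow_le_pow_left₀ M.coe_nonneg (by linarith) n).trans
        (pow_le_pow_right₀ (by linarith [M.coe_nonneg]) hn)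
    have hM : (0 : ℝ) ≤ (M + 1) ^ (k + l) := pow_nonneg (by linarith [M.coe_nonneg]) _
    rw [NNReal.coe_pow]
    refine (mul_le_mul h1 (h n k l v w) (apply_nonneg _ _) hM).trans_eq ?_
    push_cast
    rw [mul_pow]
    ring

/-- The sum of `‖z‖ ^ n` over `n ≤ k + l` is at most `(‖z‖ + 1) ^ (k + l)`, because binomial
coefficients are at least `1`. -/
theorem GuttBound.starProd_le {p q : Seminorm 𝕜 𝔤} {R R' : ℝ} {a : ℝ≥0} (h : GuttBound p R q R' a)
    (z : 𝕜) (x y : SymAlg 𝕜 𝔤) : symSeminorm p R (starProd 𝔤 z x y) ≤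
      symSeminorm ((a * (‖z‖₊ + 1)) • q) R' x * symSeminorm ((a * (‖z‖₊ + 1)) • q) R' y := by
  have := bilin_le_mul_symSeminorm (starProd 𝔤 z) (symSeminorm p R) q q R'
    zero_le_one (a * (‖z‖₊ + 1)) (fun k l v w => ?_) x y
  · rwa [one_mul] at this
  rw [one_mul, starProd_sym_tprod_eq_sum z v w (Nat.lt_succ_self _)]
  set X := a ^ (k + l) * ((k ! : ℝ) ^ R' * (l ! : ℝ) ^ R') * ((∏ i, q (v i)) * ∏ i, q (w i)) with hX
  have hX0 : 0 ≤ X := guttBound_rhs_nonneg q R' a.coe_nonneg v w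
  calc _ ≤ ∑ n ∈ Finset.range (k + l + 1), ‖z‖ ^ n * X := by
        refine (seminorm_sum_le _ _ _).trans (Finset.sum_le_sum fun n _ => ?_)
        rw [map_smul_eq_mul, norm_pow]
        exact mul_le_mul_of_nonneg_left (h n k l v w) (by positivity)
    _ ≤ (‖z‖ + 1) ^ (k + l) * X := by
        rw [← Finset.sum_mul, add_pow]
        refine mul_le_mul_of_nonneg_right (Finset.sum_le_sum fun n hn => ?_) hX0
        have hn := Finset.mem_range.1 hn
        have h1 : (1 : ℝ) ≤ (k + l).choose n := by
          exact_mod_cast Nat.choose_pos (show n ≤ k + l by omega)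
        rw [one_pow, mul_one]
        exact le_mul_of_one_le_right (by positivity) h1
    _ = _ := by
        push_cast
        rw [mul_pow, hX]
        ring

/-- For `n < k + l` one has `2 * 8 ^ n ≤ 8 ^ (k + l)`, which the rescaling by `8` absorbs. For `n =
k + l > 0` no word is left to hold the letters, so the term vanishes. The excluded case `n = k + l =
0` is `C₀(1, 1) = 1`, where the factor `1 / 2` can fail. -/
theorem guttC_le_of_guttBound {N : ℕ} (hnil : LieModule.lowerCentralSeries 𝕜 𝔤 𝔤 N = ⊥)
    {p q : Seminorm 𝕜 𝔤} {R R' : ℝ} {a : ℝ≥0} (h : GuttBound p R q R' a) {n k l : ℕ}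
    (hnkl : n ≠ 0 ∨ k + l ≠ 0) (v : Fin k → 𝔤) (w : Fin l → 𝔤) :
    symSeminorm p R (guttC 𝕜 n (sym 𝕜 𝔤 (TensorAlgebra.tprod 𝕜 𝔤 k v))
      (sym 𝕜 𝔤 (TensorAlgebra.tprod 𝕜 𝔤 l w))) ≤ 1 / (2 * 8 ^ n) *
      (((8 * a : ℝ≥0) : ℝ) ^ (k + l) * ((k ! : ℝ) ^ R' * (l ! : ℝ) ^ R') *
        ((∏ i, q (v i)) * ∏ i, q (w i))) := by
  have hnn := guttBound_rhs_nonneg q R' (8 * a).coe_nonneg v w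
  rcases lt_or_ge n (k + l) with hn | hn
  · refine (h n k l v w).trans ?_
    have hX0 := guttBound_rhs_nonneg q R' a.coe_nonneg v w
    have h8 : (2 : ℝ) * 8 ^ n ≤ 8 ^ (k + l) := by
      calc (2 : ℝ) * 8 ^ n ≤ 8 * 8 ^ n := by gcongr; norm_num
        _ = 8 ^ (n + 1) := by rw [pow_succ']
        _ ≤ _ := pow_le_pow_right₀ (by norm_num) hn
    rw [one_div, le_inv_mul_iff₀ (by positivity)]
    refine (mul_le_mul_of_nonneg_right h8 hX0).trans_eq ?_
    push_cast
    rw [mul_pow]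
    ring
  · have h0 : guttC 𝕜 n (sym 𝕜 𝔤 (TensorAlgebra.tprod 𝕜 𝔤 k v))
        (sym 𝕜 𝔤 (TensorAlgebra.tprod 𝕜 𝔤 l w)) = 0 := by
      rcases hn.lt_or_eq with hn | hn
      · exact guttC_sym_tprod_eq_zero v w hn
      · subst hn
        refine guttC_sym_tprod_eq_zero_of_nilpotent hnil le_rfl ?_ v w
        rw [Nat.sub_self, zero_mul]
        omega
    rw [h0, map_zero]
    positivity

theorem GuttBound.guttC_le {N : ℕ} (hnil : LieModule.lowerCentralSeries 𝕜 𝔤 𝔤 N = ⊥)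
    {p q : Seminorm 𝕜 𝔤} {R R' : ℝ} {a : ℝ≥0} (h : GuttBound p R q R' a) (n : ℕ) (x y : SymAlg 𝕜 𝔤)
    (hnxy : n ≠ 0 ∨ symCounit 𝕜 𝔤 x = 0 ∨ symCounit 𝕜 𝔤 y = 0) :
    symSeminorm p R (guttC 𝕜 n x y) ≤ 1 / (2 * 8 ^ n) *
      (symSeminorm ((8 * a) • q) R' x * symSeminorm ((8 * a) • q) R' y) := by
  have hc : (0 : ℝ) ≤ 1 / (2 * 8 ^ n) := by positivity
  have hnn : ∀ {k l : ℕ} (v : Fin k → 𝔤) (w : Fin l → 𝔤), 0 ≤ 1 / (2 * 8 ^ n) *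
      (((8 * a : ℝ≥0) : ℝ) ^ (k + l) * ((k ! : ℝ) ^ R' * (l ! : ℝ) ^ R') *
        ((∏ i, q (v i)) * ∏ i, q (w i))) := fun v w =>
    mul_nonneg hc (guttBound_rhs_nonneg q R' (8 * a).coe_nonneg v w)
  rcases hnxy with hn | hx | hy
  · exact bilin_le_mul_symSeminorm (guttBilin 𝕜 𝔤 n) (symSeminorm p R) q q R' hc (8 * a)
      (fun k l v w => guttC_le_of_guttBound hnil h (.inl hn) v w) x y
  -- Precomposing with `augProj` does not change the value at `x`, and it kills the degree zero
  -- tensors on which the bound could fail.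
  · have := bilin_le_mul_symSeminorm (guttBilin 𝕜 𝔤 n ∘ₗ augProj 𝕜 𝔤) (symSeminorm p R) q q R' hc
      (8 * a) (fun k l v w => ?_) x y
    · rwa [LinearMap.comp_apply, augProj_eq_self hx] at this
    · rw [LinearMap.comp_apply]
      rcases eq_or_ne k 0 with rfl | hk
      · rw [sym_tprod_zero, augProj_symOne, map_zero, LinearMap.zero_apply, map_zero]
        exact hnn v w
      · rw [augProj_sym_tprod hk]
        exact guttC_le_of_guttBound hnil h (.inr (by omega)) v w
  · have := bilin_le_mul_symSeminorm ((guttBilin 𝕜 𝔤 n).compl₂ (augProj 𝕜 𝔤)) (symSeminorm p R) q q R' hc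
      (8 * a) (fun k l v w => ?_) x y
    · rwa [LinearMap.compl₂_apply, augProj_eq_self hy] at this
    · rw [LinearMap.compl₂_apply]
      rcases eq_or_ne l 0 with rfl | hl
      · rw [sym_tprod_zero, augProj_symOne, map_zero, map_zero]
        exact hnn v w
      · rw [augProj_sym_tprod hl]
        exact guttC_le_of_guttBound hnil h (.inr (by omega)) v w

end GuttEstimates

/-! ### Continuity and extension of bilinear maps. -/

section Bilinear

variable {𝕜 : Type*} [RCLike 𝕜]

theorem continuous_bilin_of_seminorm_le {E F G ι : Type*} [AddCommGroup E] [Module 𝕜 E]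
    [TopologicalSpace E] [IsTopologicalAddGroup E] [AddCommGroup F] [Module 𝕜 F] [TopologicalSpace F]
    [IsTopologicalAddGroup F] [AddCommGroup G] [Module 𝕜 G] [TopologicalSpace G]
    {s : SeminormFamily 𝕜 G ι} (hs : WithSeminorms s) (b : E →ₗ[𝕜] F →ₗ[𝕜] G)
    (hb : ∀ i, ∃ (p : Seminorm 𝕜 E) (q : Seminorm 𝕜 F), Continuous p ∧ Continuous q ∧
      ∀ x y, s i (b x y) ≤ p x * q y) : Continuous fun x : E × F => b x.1 x.2 := by
  rw [continuous_iff_continuousAt]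
  rintro ⟨x₀, y₀⟩
  refine (hs.tendsto_nhds _ _).2 fun i ε hε => ?_
  obtain ⟨p, q, hp, hq, hpq⟩ := hb i
  have hg : Continuous fun x : E × F => p (x.1 - x₀) * q x.2 + p x₀ * q (x.2 - y₀) := by
    have h1 : Continuous fun x : E × F => p (x.1 - x₀) :=
      hp.comp (continuous_fst.sub continuous_const)
    have h2 : Continuous fun x : E × F => q (x.2 - y₀) :=
      hq.comp (continuous_snd.sub continuous_const)
    exact (h1.mul (hq.comp continuous_snd)).add (continuous_const.mul h2)
  have h0 := hg.tendsto (x₀, y₀)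
  simp only [sub_self, map_zero, zero_mul, mul_zero, add_zero] at h0
  filter_upwards [h0.eventually (gt_mem_nhds hε)] with x hx
  refine lt_of_le_of_lt ?_ hx
  have h3 : b x.1 x.2 - b x₀ y₀ = b (x.1 - x₀) x.2 + b x₀ (x.2 - y₀) := by
    rw [map_sub, map_sub, LinearMap.sub_apply]
    abel
  rw [h3]
  exact (map_add_le_add (s i) _ _).trans (add_le_add (hpq _ _) (hpq _ _))

theorem continuous_seminorm_bilin {E F G : Type*} [AddCommGroup E] [Module 𝕜 E]
    [TopologicalSpace E] [IsTopologicalAddGroup E] [AddCommGroup F] [Module 𝕜 F] [TopologicalSpace F]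
    [IsTopologicalAddGroup F] [AddCommGroup G] [Module 𝕜 G] (s : Seminorm 𝕜 G)
    (b : E →ₗ[𝕜] F →ₗ[𝕜] G) {p : Seminorm 𝕜 E} {q : Seminorm 𝕜 F} (hp : Continuous p)
    (hq : Continuous q) (h : ∀ x y, s (b x y) ≤ p x * q y) :
    Continuous fun x : E × F => s (b x.1 x.2) := by
  -- Give the target the topology of the single seminorm `s`; the general criterion then applies.
  let := seminormUniformSpace fun _ : Unit => s
  have hs := withSeminorms_seminorm fun _ : Unit => s
  exact (hs.continuous_seminorm ()).comp
    (continuous_bilin_of_seminorm_le hs b fun _ => ⟨p, q, hp, hq, h⟩)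

/-- Extension of a continuous bilinear map along dense linear maps. -/
theorem exists_extend_bilin {E F E' F' G : Type*} [AddCommGroup E] [Module 𝕜 E] [TopologicalSpace E]
    [AddCommGroup F] [Module 𝕜 F] [TopologicalSpace F]
    [AddCommGroup E'] [Module 𝕜 E'] [TopologicalSpace E'] [IsTopologicalAddGroup E']
    [ContinuousConstSMul 𝕜 E']
    [AddCommGroup F'] [Module 𝕜 F'] [TopologicalSpace F'] [IsTopologicalAddGroup F']
    [ContinuousConstSMul 𝕜 F']
    [AddCommGroup G] [Module 𝕜 G] [UniformSpace G] [IsUniformAddGroup G] [ContinuousConstSMul 𝕜 G]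
    [T2Space G] [CompleteSpace G] {e : E →ₗ[𝕜] E'} (he : IsDenseInducing e) {f : F →ₗ[𝕜] F'}
    (hf : IsDenseInducing f) (b : E →ₗ[𝕜] F →ₗ[𝕜] G) (hb : Continuous fun x : E × F => b x.1 x.2) :
    ∃ b' : E' →ₗ[𝕜] F' →ₗ[𝕜] G, (Continuous fun x : E' × F' => b' x.1 x.2) ∧
      ∀ x y, b' (e x) (f y) = b x y := by
  -- The extension is made for the underlying biadditive map; linearity in each variable follows by
  -- density.
  let ψ : E →+ F →+ G := AddMonoidHom.mk' (fun x => (b x).toAddMonoidHom) fun x y => by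
    ext z
    simp
  have hψ : Continuous fun p : E × F => ψ p.1 p.2 := hb
  have he' : IsDenseInducing e.toAddMonoidHom := he
  have hf' : IsDenseInducing f.toAddMonoidHom := hf
  have hcont := he'.extend_Z_bilin hf' hψ
  set B := IsDenseInducing.extend (he'.prodMap hf') (fun p : E × F => ψ p.1 p.2) with hB
  have hext : ∀ x y, B (e x, f y) = b x y := fun x y =>
    (he'.prodMap hf').extend_eq hψ (x, y)
  have hden2 : ∀ {P : E' → F' → Prop}, IsClosed {x : E' × F' | P x.1 x.2} →
      (∀ x y, P (e x) (f y)) → ∀ x y, P x y := fun hP h x y =>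
    isClosed_property (he.dense.prodMap hf.dense) (p := fun x : E' × F' => _) hP
      (fun x => h x.1 x.2) (x, y)
  have hden3 : ∀ {P : E' → E' → F' → Prop}, IsClosed {x : E' × E' × F' | P x.1 x.2.1 x.2.2} →
      (∀ x x' y, P (e x) (e x') (f y)) → ∀ x x' y, P x x' y := fun hP h x x' y =>
    isClosed_property (he.dense.prodMap (he.dense.prodMap hf.dense)) (p := fun x : E' × E' × F' => _) hP
      (fun x => h x.1 x.2.1 x.2.2) (x, x', y)
  have hden3' : ∀ {P : E' → F' → F' → Prop}, IsClosed {x : E' × F' × F' | P x.1 x.2.1 x.2.2} →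
      (∀ x y y', P (e x) (f y) (f y')) → ∀ x y y', P x y y' := fun hP h x y y' =>
    isClosed_property (he.dense.prodMap (hf.dense.prodMap hf.dense)) (p := fun x : E' × F' × F' => _) hP
      (fun x => h x.1 x.2.1 x.2.2) (x, y, y')
  refine ⟨LinearMap.mk₂ 𝕜 (fun x y => B (x, y)) ?_ ?_ ?_ ?_, hcont, hext⟩
  · refine hden3 (isClosed_eq (by fun_prop) (by fun_prop)) fun x x' y => ?_
    rw [← map_add, hext, hext, hext, map_add, LinearMap.add_apply]
  · intro c
    refine hden2 (isClosed_eq (by fun_prop) (by fun_prop)) fun x y => ?_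
    rw [← map_smul, hext, hext, map_smul, LinearMap.smul_apply]
  · refine hden3' (isClosed_eq (by fun_prop) (by fun_prop)) fun x y y' => ?_
    rw [← map_add, hext, hext, hext, map_add]
  · intro c
    refine hden2 (isClosed_eq (by fun_prop) (by fun_prop)) fun x y => ?_
    rw [← map_smul, hext, hext, map_smul]

end Bilinear

/-! ### Completions of locally convex spaces are locally convex. -/

section Completion

variable {𝕜 : Type*} [RCLike 𝕜] {E : Type*} [AddCommGroup E] [Module 𝕜 E] [UniformSpace E]
  [IsUniformAddGroup E] [UniformContinuousConstSMul 𝕜 E]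

/-- The extension of a continuous seminorm to the completion. -/
def completionSeminorm (s : Seminorm 𝕜 E) (hs : Continuous s) : Seminorm 𝕜 (Completion E) :=
  have hu : UniformContinuous s :=
    Seminorm.uniformContinuous_of_continuousAt_zero (by simpa using hs.continuousAt)
  Seminorm.of (Completion.extension s)
    (fun x y => Completion.induction_on₂ x y (isClosed_le
      (Completion.continuous_extension.comp (continuous_fst.add continuous_snd))
      ((Completion.continuous_extension.comp continuous_fst).add
        (Completion.continuous_extension.comp continuous_snd))) fun x y => by
      rw [← Completion.coe_add, Completion.extension_coe hu, Completion.extension_coe hu,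
        Completion.extension_coe hu]
      exact map_add_le_add s x y)
    (fun a x => Completion.induction_on x (isClosed_eq
      (Completion.continuous_extension.comp (continuous_const_smul a))
      (continuous_const.mul Completion.continuous_extension)) fun x => by
      rw [← Completion.coe_smul, Completion.extension_coe hu, Completion.extension_coe hu]
      exact map_smul_eq_mul s a x)

theorem completionSeminorm_coe (s : Seminorm 𝕜 E) (hs : Continuous s) (x : E) :
    completionSeminorm s hs (x : Completion E) = s x :=
  Completion.extension_coe
    (Seminorm.uniformContinuous_of_continuousAt_zero (by simpa using hs.continuousAt)) x

theorem continuous_completionSeminorm (s : Seminorm 𝕜 E) (hs : Continuous s) :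
    Continuous (completionSeminorm s hs) :=
  Completion.continuous_extension (f := s)

/-- The closed neighbourhoods of zero form a base. If such a neighbourhood contains the open unit
ball of a seminorm on `E`, it contains the open unit ball of the extended seminorm, because `E` is
dense in the latter. -/
instance [PolynormableSpace 𝕜 E] : PolynormableSpace 𝕜 (Completion E) := by
  let p : SeminormFamily 𝕜 (Completion E) {s : Seminorm 𝕜 E // Continuous s} := fun s =>
    completionSeminorm s.1 s.2
  suffices h : WithSeminorms p from h.toPolynormableSpace
  rw [SeminormFamily.withSeminorms_iff_nhds_eq_iInf]
  refine le_antisymm (le_iInf fun s => ?_) fun U hU => ?_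
  · rw [← Filter.map_le_iff_le_comap]
    have := (continuous_completionSeminorm s.1 s.2).tendsto 0
    rwa [map_zero] at this
  · obtain ⟨K, hK, hKc, hKU⟩ := exists_mem_nhds_isClosed_subset hU
    have hK' : ((↑) : E → Completion E) ⁻¹' K ∈ 𝓝 (0 : E) :=
      (Completion.continuous_coe E).continuousAt.preimage_mem_nhds (by rwa [Completion.coe_zero])
    obtain ⟨s, hs, hsK⟩ := exists_continuous_seminorm_ball_subset (𝕜 := 𝕜) hK'
    refine Filter.mem_of_superset (Filter.mem_iInf_of_mem ⟨s, hs⟩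
      (Filter.preimage_mem_comap (Iio_mem_nhds one_pos))) fun x hx => hKU ?_
    have hopen : IsOpen {x : Completion E | completionSeminorm s hs x < 1} :=
      isOpen_Iio.preimage (continuous_completionSeminorm s hs)
    have hx' : x ∈ closure ({x : Completion E | completionSeminorm s hs x < 1} ∩
        Set.range ((↑) : E → Completion E)) :=
      Completion.denseRange_coe.open_subset_closure_inter hopen hx
    refine hKc.closure_subset_iff.2 ?_ hx'
    rintro _ ⟨hy, y, rfl⟩
    have hy : completionSeminorm s hs (y : Completion E) < 1 := hy
    rw [completionSeminorm_coe] at hy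
    exact hsK y hy

end Completion

/-! ### Completed projective tensor products. -/

section Tensor

variable {𝕜 : Type*} [RCLike 𝕜]
variable {E : Type*} [AddCommGroup E] [Module 𝕜 E] [TopologicalSpace E]
variable {F : Type*} [AddCommGroup F] [Module 𝕜 F] [TopologicalSpace F]

instance : PolynormableSpace 𝕜 (ProjTensor 𝕜 E F) :=
  (withSeminorms_seminorm (projSeminorms 𝕜 E F)).toPolynormableSpace

theorem continuous_projTensor_seminorm {s : Seminorm 𝕜 (ProjTensor 𝕜 E F)}
    (hs : Continuous fun x : E × F => s (toProjTensor 𝕜 E F (x.1 ⊗ₜ[𝕜] x.2))) : Continuous s :=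
  (withSeminorms_seminorm (projSeminorms 𝕜 E F)).continuous_seminorm ⟨s, hs⟩

theorem isDenseInducing_toCTensor :
    IsDenseInducing ((toCTensor 𝕜 E F) ∘ (toProjTensor 𝕜 E F).symm) :=
  Completion.isDenseInducing_coe

variable (𝕜 E F) in
/-- The canonical bilinear map into the completed tensor product. -/
def ctmulBilin : E →ₗ[𝕜] F →ₗ[𝕜] CTensor 𝕜 E F := (TensorProduct.mk 𝕜 E F).compr₂ (toCTensor 𝕜 E F)

theorem continuous_projTmul [PolynormableSpace 𝕜 E] [PolynormableSpace 𝕜 F] :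
    Continuous fun x : E × F => toProjTensor 𝕜 E F (x.1 ⊗ₜ[𝕜] x.2) := by
  have := (PolynormableSpace.withSeminorms 𝕜 E).topologicalAddGroup
  have := (PolynormableSpace.withSeminorms 𝕜 F).topologicalAddGroup
  refine continuous_bilin_of_seminorm_le (withSeminorms_seminorm (projSeminorms 𝕜 E F))
    ((TensorProduct.mk 𝕜 E F).compr₂ (toProjTensor 𝕜 E F).toLinearMap) fun s => ?_
  exact exists_seminorm_bilin_le ((TensorProduct.mk 𝕜 E F).compr₂ (toProjTensor 𝕜 E F).toLinearMap)
    s.1 s.2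

theorem continuous_ctmul [PolynormableSpace 𝕜 E] [PolynormableSpace 𝕜 F] :
    Continuous fun x : E × F => ctmul 𝕜 x.1 x.2 :=
  (Completion.continuous_coe _).comp continuous_projTmul

section Lift

variable {G : Type*} [AddCommGroup G] [Module 𝕜 G] [UniformSpace G] [IsUniformAddGroup G]
  [UniformContinuousConstSMul 𝕜 G] [PolynormableSpace 𝕜 G] [T2Space G] [CompleteSpace G]

/-- The universal property of the completed projective tensor product. -/
def ctLift (b : E →ₗ[𝕜] F →ₗ[𝕜] G) (hb : Continuous fun x : E × F => b x.1 x.2) :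
    CTensor 𝕜 E F →L[𝕜] G :=
  ContinuousLinearMap.fromCompletion
    { toLinearMap := TensorProduct.lift b ∘ₗ (toProjTensor 𝕜 E F).symm.toLinearMap
      cont := (PolynormableSpace.withSeminorms 𝕜 G).continuous_of_continuous_comp _ fun s =>
        continuous_projTensor_seminorm (s.2.comp hb) }

theorem ctLift_toCTensor (b : E →ₗ[𝕜] F →ₗ[𝕜] G) (hb : Continuous fun x : E × F => b x.1 x.2)
    (t : E ⊗[𝕜] F) : ctLift b hb (toCTensor 𝕜 E F t) = TensorProduct.lift b t :=
  ContinuousLinearMap.fromCompletion_apply_coe _ _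

theorem ctLift_ctmul (b : E →ₗ[𝕜] F →ₗ[𝕜] G) (hb : Continuous fun x : E × F => b x.1 x.2)
    (x : E) (y : F) : ctLift b hb (ctmul 𝕜 x y) = b x y := by
  rw [ctmul, ctLift_toCTensor, TensorProduct.lift.tmul]

end Lift

theorem ctMap_toCTensor {E' F' : Type*} [AddCommGroup E'] [Module 𝕜 E'] [TopologicalSpace E']
    [AddCommGroup F'] [Module 𝕜 F'] [TopologicalSpace F'] (f : E →L[𝕜] E') (g : F →L[𝕜] F')
    (t : E ⊗[𝕜] F) : ctMap f g (toCTensor 𝕜 E F t) =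
      toCTensor 𝕜 E' F' (TensorProduct.map f.toLinearMap g.toLinearMap t) :=
  ContinuousLinearMap.completion_apply_coe _ _

/-- Needed because the supremum of an unbounded family of seminorms would be a junk value in
`projSeminorm`. -/
theorem bddAbove_projSeminorm (p : Seminorm 𝕜 E) (q : Seminorm 𝕜 F) :
    BddAbove {s : Seminorm 𝕜 (ProjTensor 𝕜 E F) |
      ∀ a b, s (toProjTensor 𝕜 E F (a ⊗ₜ[𝕜] b)) ≤ p a * q b} := by
  rw [Seminorm.bddAbove_iff]
  have key : ∀ t : E ⊗[𝕜] F, ∃ C : ℝ, ∀ s : Seminorm 𝕜 (ProjTensor 𝕜 E F),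
      (∀ a b, s (toProjTensor 𝕜 E F (a ⊗ₜ[𝕜] b)) ≤ p a * q b) → s (toProjTensor 𝕜 E F t) ≤ C := by
    intro t
    induction t using TensorProduct.induction_on with
    | zero => exact ⟨0, fun s _ => by simp⟩
    | tmul a b => exact ⟨p a * q b, fun s hs => hs a b⟩
    | add t t' h h' =>
      obtain ⟨C, hC⟩ := h
      obtain ⟨C', hC'⟩ := h'
      refine ⟨C + C', fun s hs => ?_⟩
      rw [map_add]
      exact (map_add_le_add s _ _).trans (add_le_add (hC s hs) (hC' s hs))
  choose C hC using key
  refine ⟨fun t => C ((toProjTensor 𝕜 E F).symm t), ?_⟩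
  rintro _ ⟨s, hs, rfl⟩ t
  exact hC ((toProjTensor 𝕜 E F).symm t) s hs

/-- The projective tensor product of two seminorms. -/
def projSeminorm (p : Seminorm 𝕜 E) (q : Seminorm 𝕜 F) : Seminorm 𝕜 (ProjTensor 𝕜 E F) :=
  sSup {s | ∀ a b, s (toProjTensor 𝕜 E F (a ⊗ₜ[𝕜] b)) ≤ p a * q b}

theorem projSeminorm_tmul_le (p : Seminorm 𝕜 E) (q : Seminorm 𝕜 F) (a : E) (b : F) :
    projSeminorm p q (toProjTensor 𝕜 E F (a ⊗ₜ[𝕜] b)) ≤ p a * q b := by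
  have h0 : (⊥ : Seminorm 𝕜 (ProjTensor 𝕜 E F)) ∈ {s : Seminorm 𝕜 (ProjTensor 𝕜 E F) |
      ∀ a b, s (toProjTensor 𝕜 E F (a ⊗ₜ[𝕜] b)) ≤ p a * q b} := fun a b =>
    mul_nonneg (apply_nonneg p a) (apply_nonneg q b)
  have : Nonempty {s : Seminorm 𝕜 (ProjTensor 𝕜 E F) |
      ∀ a b, s (toProjTensor 𝕜 E F (a ⊗ₜ[𝕜] b)) ≤ p a * q b} := ⟨⟨⊥, h0⟩⟩
  rw [projSeminorm, Seminorm.sSup_apply (bddAbove_projSeminorm p q)]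
  exact ciSup_le fun s => s.2 a b

theorem le_projSeminorm {p : Seminorm 𝕜 E} {q : Seminorm 𝕜 F} {s : Seminorm 𝕜 (ProjTensor 𝕜 E F)}
    {K : ℝ} (hK : 0 ≤ K) (hs : ∀ a b, s (toProjTensor 𝕜 E F (a ⊗ₜ[𝕜] b)) ≤ K * (p a * q b))
    (t : ProjTensor 𝕜 E F) : s t ≤ K * projSeminorm p q t := by
  -- Dividing by `K + ε` puts `s` into the family whose supremum is taken; `K` itself may be zero.
  have key : ∀ ε > 0, s t ≤ (K + ε) * projSeminorm p q t := by
    intro ε hε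
    have hKε : 0 < K + ε := by linarith
    have h1 : (K + ε).toNNReal⁻¹ • s ≤ projSeminorm p q := by
      refine le_csSup (bddAbove_projSeminorm p q) fun a b => ?_
      change ((K + ε).toNNReal⁻¹ : ℝ≥0) * s _ ≤ _
      rw [NNReal.coe_inv, Real.coe_toNNReal _ hKε.le, inv_mul_le_iff₀ hKε]
      refine (hs a b).trans (mul_le_mul_of_nonneg_right (by linarith) ?_)
      exact mul_nonneg (apply_nonneg p a) (apply_nonneg q b)
    have h2 : ((K + ε).toNNReal⁻¹ : ℝ≥0) * s t ≤ projSeminorm p q t := h1 t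
    rwa [NNReal.coe_inv, Real.coe_toNNReal _ hKε.le, inv_mul_le_iff₀ hKε] at h2
  have ht : Filter.Tendsto (fun ε : ℝ => (K + ε) * projSeminorm p q t) (𝓝[>] 0)
      (𝓝 ((K + 0) * projSeminorm p q t)) := by
    refine Filter.Tendsto.mono_left ?_ nhdsWithin_le_nhds
    exact Continuous.tendsto (by fun_prop) 0
  rw [add_zero] at ht
  exact ge_of_tendsto ht (Filter.eventually_of_mem self_mem_nhdsWithin key)

theorem continuous_projSeminorm [PolynormableSpace 𝕜 E] [PolynormableSpace 𝕜 F] {p : Seminorm 𝕜 E}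
    {q : Seminorm 𝕜 F} (hp : Continuous p) (hq : Continuous q) : Continuous (projSeminorm p q) := by
  have := (PolynormableSpace.withSeminorms 𝕜 E).topologicalAddGroup
  have := (PolynormableSpace.withSeminorms 𝕜 F).topologicalAddGroup
  exact continuous_projTensor_seminorm (continuous_seminorm_bilin (projSeminorm p q)
    ((TensorProduct.mk 𝕜 E F).compr₂ (toProjTensor 𝕜 E F).toLinearMap) hp hq
    (projSeminorm_tmul_le p q))

end Tensor

/-! ### Associator and interchange of completed tensor factors. -/

section Rearrangement

variable {𝕜 : Type*} [RCLike 𝕜]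
variable {E : Type*} [AddCommGroup E] [Module 𝕜 E] [TopologicalSpace E] [PolynormableSpace 𝕜 E]
variable {F : Type*} [AddCommGroup F] [Module 𝕜 F] [TopologicalSpace F] [PolynormableSpace 𝕜 F]
variable {G : Type*} [AddCommGroup G] [Module 𝕜 G] [TopologicalSpace G] [PolynormableSpace 𝕜 G]
variable {L : Type*} [AddCommGroup L] [Module 𝕜 L] [TopologicalSpace L] [PolynormableSpace 𝕜 L]

theorem exists_seminorm_ctmul_le (s : Seminorm 𝕜 (CTensor 𝕜 E F)) (hs : Continuous s) :
    ∃ (p : Seminorm 𝕜 E) (q : Seminorm 𝕜 F), Continuous p ∧ Continuous q ∧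
      ∀ a b, s (ctmul 𝕜 a b) ≤ p a * q b :=
  exists_seminorm_bilin_le (ctmulBilin 𝕜 E F) s (hs.comp continuous_ctmul)

/-- The associator of completed projective tensor products. -/
theorem exists_ctAssoc :
    ∃ α : CTensor 𝕜 (CTensor 𝕜 E F) G →L[𝕜] CTensor 𝕜 E (CTensor 𝕜 F G),
      ∀ t : (E ⊗[𝕜] F) ⊗[𝕜] G,
        α (toCTensor 𝕜 _ _ (TensorProduct.map (toCTensor 𝕜 E F) LinearMap.id t)) =
          toCTensor 𝕜 _ _ (TensorProduct.map LinearMap.id (toCTensor 𝕜 F G)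
            (TensorProduct.assoc 𝕜 E F G t)) := by
  have := (PolynormableSpace.withSeminorms 𝕜 G).topologicalAddGroup
  have := (PolynormableSpace.withSeminorms 𝕜 G).continuousSMul
  -- The map is first defined on the uncompleted inner tensor product, where projective seminorms
  -- reduce its continuity to elementary tensors. Then `exists_extend_bilin` completes the inner
  -- tensor product and `ctLift` the outer one.
  let b : ProjTensor 𝕜 E F →ₗ[𝕜] G →ₗ[𝕜] CTensor 𝕜 E (CTensor 𝕜 F G) :=
    ((TensorProduct.mk 𝕜 (E ⊗[𝕜] F) G).compr₂ (toCTensor 𝕜 _ _ ∘ₗ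
      TensorProduct.map LinearMap.id (toCTensor 𝕜 F G) ∘ₗ
        (TensorProduct.assoc 𝕜 E F G).toLinearMap)) ∘ₗ (toProjTensor 𝕜 E F).symm.toLinearMap
  have hb : Continuous fun x : ProjTensor 𝕜 E F × G => b x.1 x.2 := by
    refine continuous_bilin_of_seminorm_le (PolynormableSpace.withSeminorms 𝕜 _) b fun s => ?_
    obtain ⟨p, r, hp, hr, h1⟩ := exists_seminorm_ctmul_le s.1 s.2
    obtain ⟨q, r, hq, hr, h2⟩ := exists_seminorm_ctmul_le r hr
    refine ⟨projSeminorm p q, r, continuous_projSeminorm hp hq, hr, fun t c => ?_⟩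
    rw [mul_comm]
    refine le_projSeminorm (s := s.1.comp (b.flip c)) (apply_nonneg r c) (fun x y => ?_) t
    calc s.1 (ctmul 𝕜 x (ctmul 𝕜 y c)) ≤ p x * (q y * r c) :=
          (h1 _ _).trans (mul_le_mul_of_nonneg_left (h2 _ _) (apply_nonneg p x))
      _ = _ := by ring
  obtain ⟨b', hb', hbb'⟩ := exists_extend_bilin
    (e := toCTensor 𝕜 E F ∘ₗ (toProjTensor 𝕜 E F).symm.toLinearMap)
    (f := (LinearMap.id : G →ₗ[𝕜] G))
    isDenseInducing_toCTensor ⟨.id, denseRange_id⟩ b hb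
  refine ⟨ctLift b' hb', fun t => ?_⟩
  rw [ctLift_toCTensor]
  induction t using TensorProduct.induction_on with
  | zero => simp only [map_zero]
  | tmul t c =>
    rw [TensorProduct.map_tmul, TensorProduct.lift.tmul]
    exact hbb' (toProjTensor 𝕜 E F t) c
  | add t t' h h' => simp only [map_add, h, h']

/-- The exchange of the inner factors of completed projective tensor products. -/
theorem exists_ctTensorComm :
    ∃ τ : CTensor 𝕜 (CTensor 𝕜 E F) (CTensor 𝕜 G L) →L[𝕜]
        CTensor 𝕜 (CTensor 𝕜 E G) (CTensor 𝕜 F L),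
      ∀ t : (E ⊗[𝕜] F) ⊗[𝕜] (G ⊗[𝕜] L),
        τ (toCTensor 𝕜 _ _ (TensorProduct.map (toCTensor 𝕜 E F) (toCTensor 𝕜 G L) t)) =
          toCTensor 𝕜 _ _ (TensorProduct.map (toCTensor 𝕜 E G) (toCTensor 𝕜 F L)
            (TensorProduct.tensorTensorTensorComm 𝕜 E F G L t)) := by
  let b : ProjTensor 𝕜 E F →ₗ[𝕜] ProjTensor 𝕜 G L →ₗ[𝕜]
      CTensor 𝕜 (CTensor 𝕜 E G) (CTensor 𝕜 F L) :=
    ((TensorProduct.mk 𝕜 (E ⊗[𝕜] F) (G ⊗[𝕜] L)).compr₂ (toCTensor 𝕜 _ _ ∘ₗ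
      TensorProduct.map (toCTensor 𝕜 E G) (toCTensor 𝕜 F L) ∘ₗ
        (TensorProduct.tensorTensorTensorComm 𝕜 E F G L).toLinearMap)).compl₁₂
          (toProjTensor 𝕜 E F).symm.toLinearMap (toProjTensor 𝕜 G L).symm.toLinearMap
  have hb : Continuous fun x : ProjTensor 𝕜 E F × ProjTensor 𝕜 G L => b x.1 x.2 := by
    refine continuous_bilin_of_seminorm_le (PolynormableSpace.withSeminorms 𝕜 _) b fun s => ?_
    obtain ⟨P, Q, hP, hQ, h⟩ := exists_seminorm_ctmul_le s.1 s.2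
    obtain ⟨p₁, p₃, hp₁, hp₃, h1⟩ := exists_seminorm_ctmul_le P hP
    obtain ⟨p₂, p₄, hp₂, hp₄, h2⟩ := exists_seminorm_ctmul_le Q hQ
    refine ⟨projSeminorm p₁ p₂, projSeminorm p₃ p₄, continuous_projSeminorm hp₁ hp₂,
      continuous_projSeminorm hp₃ hp₄, fun t u => ?_⟩
    refine le_projSeminorm (s := s.1.comp (b t)) (apply_nonneg _ t) (fun x y => ?_) u
    rw [mul_comm]
    refine le_projSeminorm (s := s.1.comp (b.flip (toProjTensor 𝕜 G L (x ⊗ₜ y))))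
      (mul_nonneg (apply_nonneg p₃ x) (apply_nonneg p₄ y)) (fun v w => ?_) t
    calc s.1 (ctmul 𝕜 (ctmul 𝕜 v x) (ctmul 𝕜 w y)) ≤ (p₁ v * p₃ x) * (p₂ w * p₄ y) :=
          (h _ _).trans (mul_le_mul (h1 _ _) (h2 _ _) (apply_nonneg Q _)
            (mul_nonneg (apply_nonneg p₁ v) (apply_nonneg p₃ x)))
      _ = _ := by ring
  obtain ⟨b', hb', hbb'⟩ := exists_extend_bilin
    (e := toCTensor 𝕜 E F ∘ₗ (toProjTensor 𝕜 E F).symm.toLinearMap)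
    (f := toCTensor 𝕜 G L ∘ₗ (toProjTensor 𝕜 G L).symm.toLinearMap)
    isDenseInducing_toCTensor isDenseInducing_toCTensor b hb
  refine ⟨ctLift b' hb', fun t => ?_⟩
  rw [ctLift_toCTensor]
  induction t using TensorProduct.induction_on with
  | zero => simp only [map_zero]
  | tmul t u =>
    rw [TensorProduct.map_tmul, TensorProduct.lift.tmul]
    exact hbb' (toProjTensor 𝕜 E F t) (toProjTensor 𝕜 G L u)
  | add t t' h h' => simp only [map_add, h, h']

end Rearrangement

/-! ### Seminorm estimates for the undeformed structure maps. -/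

section StructureMapEstimates

variable {𝕜 : Type*} [RCLike 𝕜] {V : Type*} [AddCommGroup V] [Module 𝕜 V]

theorem symSeminorm_mono {p q : Seminorm 𝕜 V} (hpq : p ≤ q) {R R' : ℝ} (hR : R ≤ R')
    (x : SymAlg 𝕜 V) : symSeminorm p R x ≤ symSeminorm q R' x :=
  (tensorSeminorm_mono p hR _).trans (tensorSeminorm_mono_seminorm hpq R' _)

theorem smul_seminorm_mono (q : Seminorm 𝕜 V) {a b : ℝ≥0}
    (hab : a ≤ b) : a • q ≤ b • q := fun x =>
  mul_le_mul_of_nonneg_right (NNReal.coe_le_coe.2 hab) (apply_nonneg q x)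

theorem symSeminorm_le_mul_of_le {p q : Seminorm 𝕜 V} {R R' : ℝ} {x y w : SymAlg 𝕜 V} {a b : ℝ≥0}
    (h : symSeminorm p R w ≤ symSeminorm (a • q) R' x * symSeminorm (a • q) R' y) (hab : a ≤ b) :
    symSeminorm p R w ≤ symSeminorm (b • q) R' x * symSeminorm (b • q) R' y :=
  h.trans (mul_le_mul (symSeminorm_mono (smul_seminorm_mono q hab) le_rfl x)
    (symSeminorm_mono (smul_seminorm_mono q hab) le_rfl y) (apply_nonneg _ _) (apply_nonneg _ _))

theorem symSeminorm_symMap_le {W : Type*} [AddCommGroup W] [Module 𝕜 W] (f : V →ₗ[𝕜] W)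
    (q : Seminorm 𝕜 W) (R : ℝ) (x : SymAlg 𝕜 V) :
    symSeminorm q R (symMap 𝕜 f x) ≤ symSeminorm (q.comp f) R x := by
  refine (tensorSeminorm_symmetrizer_le q R _).trans ?_
  rw [symSeminorm_apply, ← one_mul (tensorSeminorm (q.comp f) R _)]
  refine seminorm_le_mul_tensorSeminorm (q.comp f) R ((tensorSeminorm q R).comp
    (TensorAlgebra.lift 𝕜 (TensorAlgebra.ι 𝕜 ∘ₗ f)).toLinearMap) zero_le_one (fun n v => ?_) _
  have h : TensorAlgebra.lift 𝕜 (TensorAlgebra.ι 𝕜 ∘ₗ f) (TensorAlgebra.tprod 𝕜 V n v) =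
      TensorAlgebra.tprod 𝕜 W n (f ∘ v) := by
    simp [TensorAlgebra.tprod_apply, map_list_prod, List.map_ofFn, Function.comp_def]
  rw [one_mul, Seminorm.comp_apply, AlgHom.toLinearMap_apply, h]
  exact tensorSeminorm_tprod_le q R _

theorem symAntipode_eq_symMap : symAntipode 𝕜 V = symMap 𝕜 (-LinearMap.id) := by
  rw [symAntipode, symMap, LinearMap.comp_neg, LinearMap.comp_id]

theorem symSeminorm_symAntipode_le (p : Seminorm 𝕜 V) (R : ℝ) (x : SymAlg 𝕜 V) :
    symSeminorm p R (symAntipode 𝕜 V x) ≤ symSeminorm p R x := by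
  rw [symAntipode_eq_symMap]
  refine (symSeminorm_symMap_le _ p R x).trans (symSeminorm_mono (fun v => ?_) le_rfl x)
  simp

theorem norm_symCounit_le (p : Seminorm 𝕜 V) (R : ℝ) (x : SymAlg 𝕜 V) :
    ‖symCounit 𝕜 V x‖ ≤ symSeminorm p R x := by
  rw [← one_mul (symSeminorm p R x)]
  refine seminorm_le_mul_symSeminorm p R ((normSeminorm 𝕜 𝕜).comp (symCounit 𝕜 V)) zero_le_one
    (fun n v => ?_) x
  rw [Seminorm.comp_apply, coe_normSeminorm]
  rcases eq_or_ne n 0 with rfl | hn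
  · rw [sym_tprod_zero, symCounit_symOne]
    simp
  · rw [symCounit_sym_tprod hn, norm_zero]
    exact mul_nonneg zero_le_one (mul_nonneg (by positivity)
      (Finset.prod_nonneg fun i _ => apply_nonneg _ _))

variable (𝕜) in
/-- The product of the elements of a list in the tensor algebra. -/
def listTensor (l : List V) : TensorAlgebra 𝕜 V := (l.map (TensorAlgebra.ι 𝕜)).prod

theorem listTensor_eq_tprod (l : List V) :
    listTensor 𝕜 l = TensorAlgebra.tprod 𝕜 V l.length l.get := by
  rw [TensorAlgebra.tprod_apply, listTensor]
  congr 1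
  conv_lhs => rw [← List.ofFn_get l, List.map_ofFn]
  rfl

theorem symSeminorm_sym_listTensor_le (p : Seminorm 𝕜 V) (R : ℝ) (l : List V) :
    symSeminorm p R (sym 𝕜 V (listTensor 𝕜 l)) ≤ ((l.length ! : ℕ) : ℝ) ^ R * (l.map p).prod := by
  rw [listTensor_eq_tprod]
  refine (symSeminorm_sym_tprod_le p R _).trans (le_of_eq ?_)
  conv_rhs => rw [← List.ofFn_get l, List.map_ofFn, List.prod_ofFn]
  simp

/-- Splittings of tensors of degree `n` into two tensors, and the corresponding products of `p`. -/
def IsSplitting (p : Seminorm 𝕜 V) (n : ℕ) (c : ℝ) (t : TensorAlgebra 𝕜 V ⊗[𝕜] TensorAlgebra 𝕜 V) :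
    Prop :=
  ∃ l l' : List V, l.length + l'.length = n ∧ c = (l.map p).prod * (l'.map p).prod ∧
    t = listTensor 𝕜 l ⊗ₜ listTensor 𝕜 l'

/-- Each letter goes to the left or to the right factor, which gives `2 ^ n` splittings of equal
weight. -/
theorem tensorComul_listTensor_hull (p : Seminorm 𝕜 V) (l : List V) :
    Hull (𝕜 := 𝕜) (IsSplitting p l.length) (2 ^ l.length * (l.map p).prod)
      (tensorComul 𝕜 V (listTensor 𝕜 l)) := by
  induction l with
  | nil =>
    refine .of ⟨[], [], rfl, by simp, ?_⟩
    simp [listTensor, Algebra.TensorProduct.one_def]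
  | cons ξ l ih =>
    have h1 : listTensor 𝕜 (ξ :: l) = TensorAlgebra.ι 𝕜 ξ * listTensor 𝕜 l := by simp [listTensor]
    have h2 : tensorComul 𝕜 V (TensorAlgebra.ι 𝕜 ξ) =
        TensorAlgebra.ι 𝕜 ξ ⊗ₜ 1 + 1 ⊗ₜ TensorAlgebra.ι 𝕜 ξ := by
      simp [tensorComul]
    rw [h1, map_mul, h2, add_mul]
    have h3 := Hull.map (G' := IsSplitting p (l.length + 1))
      (LinearMap.mulLeft 𝕜 (TensorAlgebra.ι 𝕜 ξ ⊗ₜ[𝕜] (1 : TensorAlgebra 𝕜 V)))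
      (p ξ) (apply_nonneg p ξ) (by
        rintro _ _ ⟨a, b, hab, rfl, rfl⟩
        refine .of ⟨ξ :: a, b, by simp [← hab]; omega, by simp [mul_assoc], ?_⟩
        simp [listTensor]) ih
    have h4 := Hull.map (G' := IsSplitting p (l.length + 1))
      (LinearMap.mulLeft 𝕜 ((1 : TensorAlgebra 𝕜 V) ⊗ₜ[𝕜] TensorAlgebra.ι 𝕜 ξ))
      (p ξ) (apply_nonneg p ξ) (by
        rintro _ _ ⟨a, b, hab, rfl, rfl⟩
        refine .of ⟨a, ξ :: b, by simp [← hab]; omega, by simp; ring, ?_⟩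
        simp [listTensor]) ih
    refine (h3.add h4).mono (le_of_eq ?_)
    simp only [List.length_cons, List.map_cons, List.prod_cons]
    ring

/-- The number `2 ^ n` of splittings is absorbed into `2 • p`. The factorials are handled by `i! j!
≤ (i + j)!`, which survives the `R`-th power because `R ≥ 0`. -/
theorem seminorm_symComul_le (p : Seminorm 𝕜 V) {R : ℝ} (hR : 0 ≤ R)
    (s : Seminorm 𝕜 (SymAlg 𝕜 V ⊗[𝕜] SymAlg 𝕜 V)) {K : ℝ} (hK : 0 ≤ K)
    (hs : ∀ x y, s (x ⊗ₜ y) ≤ K * (symSeminorm p R x * symSeminorm p R y)) (x : SymAlg 𝕜 V) :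
    s (symComul 𝕜 V x) ≤ K * symSeminorm ((2 : ℝ≥0) • p) R x := by
  refine seminorm_le_mul_tensorSeminorm ((2 : ℝ≥0) • p) R (s.comp
    (TensorProduct.map (sym 𝕜 V) (sym 𝕜 V) ∘ₗ (tensorComul 𝕜 V).toLinearMap)) hK (fun n v => ?_) x
  have hv : TensorAlgebra.tprod 𝕜 V n v = listTensor 𝕜 (List.ofFn v) := by
    rw [TensorAlgebra.tprod_apply, listTensor, List.map_ofFn]
    rfl
  have h := Hull.seminorm_le (s.comp (TensorProduct.map (sym 𝕜 V) (sym 𝕜 V)))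
    (K * ((n ! : ℕ) : ℝ) ^ R) (by positivity) (fun c t => ?_)
    (tensorComul_listTensor_hull p (List.ofFn v))
  · rw [Seminorm.comp_apply] at h
    rw [Seminorm.comp_apply, LinearMap.comp_apply, AlgHom.toLinearMap_apply, hv]
    refine h.trans (le_of_eq ?_)
    rw [prod_smul_seminorm, List.map_ofFn, List.prod_ofFn, List.length_ofFn]
    simp only [Function.comp_apply, NNReal.coe_ofNat]
    ring
  · rintro ⟨l, l', hl, rfl, rfl⟩
    rw [List.length_ofFn] at hl
    rw [Seminorm.comp_apply, TensorProduct.map_tmul, mul_assoc]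
    refine (hs _ _).trans (mul_le_mul_of_nonneg_left ?_ hK)
    have hp : ∀ l : List V, 0 ≤ (l.map p).prod := fun l => by
      refine List.prod_nonneg fun x hx => ?_
      obtain ⟨w, -, rfl⟩ := List.mem_map.1 hx
      exact apply_nonneg p w
    refine (mul_le_mul (symSeminorm_sym_listTensor_le p R l) (symSeminorm_sym_listTensor_le p R l')
      (apply_nonneg _ _) (mul_nonneg (by positivity) (hp l))).trans ?_
    rw [mul_mul_mul_comm]
    refine mul_le_mul_of_nonneg_right ?_ (mul_nonneg (hp l) (hp l'))
    rw [← Real.mul_rpow (by positivity) (by positivity), ← hl]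
    refine Real.rpow_le_rpow (by positivity) ?_ hR
    exact_mod_cast Nat.le_of_dvd (Nat.factorial_pos _)
      (Nat.factorial_mul_factorial_dvd_factorial_add _ _)

end StructureMapEstimates

/-! ### Continuity on the topologized symmetric algebra. -/

section SymT

variable {𝕜 : Type*} [RCLike 𝕜] {I : Set ℝ}
variable {V : Type*} [AddCommGroup V] [Module 𝕜 V] [TopologicalSpace V]
variable {W : Type*} [AddCommGroup W] [Module 𝕜 W] [TopologicalSpace W]

instance : PolynormableSpace 𝕜 (SymT 𝕜 I V) :=
  (withSeminorms_seminorm (symTSeminorms 𝕜 I V)).toPolynormableSpace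

theorem continuous_symTSeminorm {R : ℝ} (hR : R ∈ I) {p : Seminorm 𝕜 V} (hp : Continuous p) :
    Continuous ((symSeminorm p R).comp (toSymT 𝕜 I V).symm.toLinearMap) :=
  (withSeminorms_seminorm (symTSeminorms 𝕜 I V)).continuous_seminorm (⟨R, hR⟩, ⟨p, hp⟩)

theorem seminorm_le_add_left {E : Type*} [AddCommGroup E] [Module 𝕜 E] (p q : Seminorm 𝕜 E) :
    p ≤ p + q := fun x => le_add_of_nonneg_right (apply_nonneg q x)

theorem seminorm_le_add_right {E : Type*} [AddCommGroup E] [Module 𝕜 E] (p q : Seminorm 𝕜 E) :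
    q ≤ p + q := fun x => le_add_of_nonneg_left (apply_nonneg p x)

theorem max_mem_of_mem {R R' : ℝ} (hR : R ∈ I) (hR' : R' ∈ I) : max R R' ∈ I := by
  rcases max_choice R R' with h | h <;> rwa [h]

/-- The defining family is directed: two members are dominated by the sum of the seminorms together
with the larger exponent, which again lies in `I`. -/
theorem exists_symSeminorm_bound (hI : I.Nonempty) (s : Seminorm 𝕜 (SymT 𝕜 I V))
    (hs : Continuous s) : ∃ (p : Seminorm 𝕜 V) (R : ℝ) (C : ℝ≥0), Continuous p ∧ R ∈ I ∧
      ∀ x, s (toSymT 𝕜 I V x) ≤ C * symSeminorm p R x := by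
  classical
  obtain ⟨t, C, -, hC⟩ :=
    Seminorm.bound_of_continuous (withSeminorms_seminorm (symTSeminorms 𝕜 I V)) s hs
  suffices h : ∀ t : Finset (I × {p : Seminorm 𝕜 V // Continuous p}),
      ∃ (p : Seminorm 𝕜 V) (R : ℝ), Continuous p ∧ R ∈ I ∧
        t.sup (symTSeminorms 𝕜 I V) ≤ (symSeminorm p R).comp (toSymT 𝕜 I V).symm.toLinearMap by
    obtain ⟨p, R, hp, hR, h⟩ := h t
    exact ⟨p, R, C, hp, hR, fun x => (hC _).trans (mul_le_mul_of_nonneg_left (h _) C.coe_nonneg)⟩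
  intro t
  induction t using Finset.induction_on with
  | empty =>
    obtain ⟨R, hR⟩ := hI
    refine ⟨0, R, continuous_const, hR, ?_⟩
    rw [Finset.sup_empty]
    exact bot_le
  | insert i t hi ih =>
    obtain ⟨p, R, hp, hR, h⟩ := ih
    refine ⟨i.2.1 + p, max i.1 R, i.2.2.add hp, max_mem_of_mem i.1.2 hR, ?_⟩
    rw [Finset.sup_insert]
    refine sup_le (fun x => symSeminorm_mono (seminorm_le_add_left _ _) (le_max_left _ _) _)
      (h.trans fun x => symSeminorm_mono (seminorm_le_add_right _ _) (le_max_right _ _) _)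

theorem continuous_symT_linear {E : Type*} [AddCommGroup E] [Module 𝕜 E] [TopologicalSpace E]
    {ι : Type*} {q : SeminormFamily 𝕜 E ι} (hq : WithSeminorms q) (f : SymT 𝕜 I V →ₗ[𝕜] E)
    (hf : ∀ i, ∃ (p : Seminorm 𝕜 V) (R : ℝ) (C : ℝ≥0), Continuous p ∧ R ∈ I ∧
      ∀ x, q i (f (toSymT 𝕜 I V x)) ≤ C * symSeminorm p R x) : Continuous f := by
  refine hq.continuous_of_continuous_comp f fun i => ?_
  obtain ⟨p, R, C, hp, hR, h⟩ := hf i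
  refine Seminorm.continuous_of_le (q := C • (symSeminorm p R).comp (toSymT 𝕜 I V).symm.toLinearMap)
    ?_ fun x => h ((toSymT 𝕜 I V).symm x)
  exact continuous_const.mul (continuous_symTSeminorm hR hp)

/-- A linear map between symmetric algebras, as a map between topologized symmetric algebras. -/
def symTLinear (I : Set ℝ) (f : SymAlg 𝕜 V →ₗ[𝕜] SymAlg 𝕜 W) : SymT 𝕜 I V →ₗ[𝕜] SymT 𝕜 I W :=
  (toSymT 𝕜 I W).toLinearMap ∘ₗ f ∘ₗ (toSymT 𝕜 I V).symm.toLinearMap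

theorem continuous_symTLinear {f : SymAlg 𝕜 V →ₗ[𝕜] SymAlg 𝕜 W}
    (hf : ∀ (q : Seminorm 𝕜 W) (R : ℝ), Continuous q → R ∈ I →
      ∃ p : Seminorm 𝕜 V, Continuous p ∧ ∀ x, symSeminorm q R (f x) ≤ symSeminorm p R x) :
    Continuous (symTLinear I f) := by
  refine continuous_symT_linear (withSeminorms_seminorm (symTSeminorms 𝕜 I W)) _ fun i => ?_
  obtain ⟨p, hp, h⟩ := hf i.2.1 i.1 i.2.2 i.1.2
  exact ⟨p, i.1, 1, hp, i.1.2, fun x => by rw [NNReal.coe_one, one_mul]; exact h x⟩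

/-- A bilinear map on the symmetric algebra, as a map on the topologized symmetric algebra. -/
def symTBilin (I : Set ℝ) (b : SymAlg 𝕜 V →ₗ[𝕜] SymAlg 𝕜 V →ₗ[𝕜] SymAlg 𝕜 V) :
    SymT 𝕜 I V →ₗ[𝕜] SymT 𝕜 I V →ₗ[𝕜] SymT 𝕜 I V :=
  (b.compr₂ (toSymT 𝕜 I V).toLinearMap).compl₁₂ (toSymT 𝕜 I V).symm.toLinearMap
    (toSymT 𝕜 I V).symm.toLinearMap

theorem continuous_symTBilin {b : SymAlg 𝕜 V →ₗ[𝕜] SymAlg 𝕜 V →ₗ[𝕜] SymAlg 𝕜 V}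
    (hb : ∀ (p : Seminorm 𝕜 V) (R : ℝ), Continuous p → R ∈ I →
      ∃ (q : Seminorm 𝕜 V) (R' : ℝ) (C : ℝ≥0), Continuous q ∧ R' ∈ I ∧ ∀ x y,
        symSeminorm p R (b x y) ≤ C * (symSeminorm q R' x * symSeminorm q R' y)) :
    Continuous fun x : SymT 𝕜 I V × SymT 𝕜 I V => symTBilin I b x.1 x.2 := by
  refine continuous_bilin_of_seminorm_le (withSeminorms_seminorm (symTSeminorms 𝕜 I V)) _ fun i => ?_
  obtain ⟨q, R', C, hq, hR', h⟩ := hb i.2.1 i.1 i.2.2 i.1.2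
  refine ⟨C • (symSeminorm q R').comp (toSymT 𝕜 I V).symm.toLinearMap,
    (symSeminorm q R').comp (toSymT 𝕜 I V).symm.toLinearMap,
    continuous_const.mul (continuous_symTSeminorm hR' hq), continuous_symTSeminorm hR' hq,
    fun x y => (h _ _).trans (le_of_eq (mul_assoc _ _ _).symm)⟩

theorem continuous_symTLinear_symMap {f : V →ₗ[𝕜] W} (hf : Continuous f) :
    Continuous (symTLinear I (symMap 𝕜 f)) :=
  continuous_symTLinear fun q R hq _ => ⟨q.comp f, hq.comp hf, symSeminorm_symMap_le f q R⟩

theorem continuous_symTLinear_symAntipode : Continuous (symTLinear I (symAntipode 𝕜 V)) :=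
  continuous_symTLinear fun p R hp _ => ⟨p, hp, symSeminorm_symAntipode_le p R⟩

theorem continuous_symT_symCounit (hI : I.Nonempty) :
    Continuous (symCounit 𝕜 V ∘ₗ (toSymT 𝕜 I V).symm.toLinearMap) := by
  obtain ⟨R, hR⟩ := hI
  refine continuous_symT_linear (norm_withSeminorms 𝕜 𝕜) _ fun _ =>
    ⟨0, R, 1, continuous_const, hR, fun x => ?_⟩
  rw [NNReal.coe_one, one_mul]
  exact norm_symCounit_le 0 R x

/-- The coproduct estimate requires a nonnegative exponent, so exponents are raised to `max R 0`;
`hI0` keeps them in the family. -/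
theorem continuous_symT_symComul (hI : I.Nonempty) (hI0 : ∀ R ∈ I, max R 0 ∈ I) :
    Continuous (toCTensor 𝕜 (SymHat 𝕜 I V) (SymHat 𝕜 I V) ∘ₗ
      TensorProduct.map (toSymHat 𝕜 I V) (toSymHat 𝕜 I V) ∘ₗ symComul 𝕜 V ∘ₗ
        (toSymT 𝕜 I V).symm.toLinearMap) := by
  refine continuous_symT_linear (PolynormableSpace.withSeminorms 𝕜 _) _ fun s => ?_
  obtain ⟨P, Q, hP, hQ, h⟩ := exists_seminorm_ctmul_le s.1 s.2
  let i : SymT 𝕜 I V →ₗ[𝕜] SymHat 𝕜 I V := toSymHat 𝕜 I V ∘ₗ (toSymT 𝕜 I V).symm.toLinearMap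
  have hi : Continuous i := Completion.continuous_coe _
  obtain ⟨p, R, C, hp, hR, hPp⟩ := exists_symSeminorm_bound hI (P.comp i) (hP.comp hi)
  obtain ⟨q, R', C', hq, hR', hQq⟩ := exists_symSeminorm_bound hI (Q.comp i) (hQ.comp hi)
  refine ⟨(2 : ℝ≥0) • (p + q), max (max R R') 0, C * C', continuous_const.mul (hp.add hq),
    hI0 _ (max_mem_of_mem hR hR'), fun x => ?_⟩
  refine seminorm_symComul_le (p + q) (le_max_right _ _) (s.1.comp
    (toCTensor 𝕜 (SymHat 𝕜 I V) (SymHat 𝕜 I V) ∘ₗ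
      TensorProduct.map (toSymHat 𝕜 I V) (toSymHat 𝕜 I V))) (C * C').coe_nonneg (fun u w => ?_) x
  calc s.1 (ctmul 𝕜 (toSymHat 𝕜 I V u) (toSymHat 𝕜 I V w))
      ≤ (C * symSeminorm p R u) * (C' * symSeminorm q R' w) :=
        (h _ _).trans (mul_le_mul (hPp u) (hQq w) (apply_nonneg Q _)
          (mul_nonneg C.coe_nonneg (apply_nonneg _ _)))
    _ ≤ (C * symSeminorm (p + q) (max (max R R') 0) u) *
          (C' * symSeminorm (p + q) (max (max R R') 0) w) := by
        gcongr
        · exact symSeminorm_mono (seminorm_le_add_left _ _) (by simp) u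
        · exact symSeminorm_mono (seminorm_le_add_right _ _) (by simp) w
    _ = _ := by
        rw [NNReal.coe_mul]
        ring

end SymT

/-! ### Extension to the completed symmetric algebra. -/

section SymHat

variable {𝕜 : Type*} [RCLike 𝕜] {I : Set ℝ}
variable {V : Type*} [AddCommGroup V] [Module 𝕜 V] [TopologicalSpace V]
variable {W : Type*} [AddCommGroup W] [Module 𝕜 W] [TopologicalSpace W]

theorem symHat_induction {P : SymHat 𝕜 I V → Prop} (hP : IsClosed {x | P x})
    (h : ∀ x : SymAlg 𝕜 V, P (toSymHat 𝕜 I V x)) (x : SymHat 𝕜 I V) : P x :=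
  Completion.induction_on x hP fun x => h ((toSymT 𝕜 I V).symm x)

theorem symHat_induction₂ {P : SymHat 𝕜 I V → SymHat 𝕜 I V → Prop}
    (hP : IsClosed {x : SymHat 𝕜 I V × SymHat 𝕜 I V | P x.1 x.2})
    (h : ∀ x y : SymAlg 𝕜 V, P (toSymHat 𝕜 I V x) (toSymHat 𝕜 I V y)) (x y : SymHat 𝕜 I V) : P x y :=
  Completion.induction_on₂ x y hP fun x y => h ((toSymT 𝕜 I V).symm x) ((toSymT 𝕜 I V).symm y)

theorem symHat_induction₃ {P : SymHat 𝕜 I V → SymHat 𝕜 I V → SymHat 𝕜 I V → Prop}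
    (hP : IsClosed {x : SymHat 𝕜 I V × SymHat 𝕜 I V × SymHat 𝕜 I V | P x.1 x.2.1 x.2.2})
    (h : ∀ x y z : SymAlg 𝕜 V, P (toSymHat 𝕜 I V x) (toSymHat 𝕜 I V y) (toSymHat 𝕜 I V z))
    (x y z : SymHat 𝕜 I V) : P x y z :=
  Completion.induction_on₃ x y z hP fun x y z =>
    h ((toSymT 𝕜 I V).symm x) ((toSymT 𝕜 I V).symm y) ((toSymT 𝕜 I V).symm z)

@[fun_prop]
theorem continuous_ctmul_comp {X E F : Type*} [TopologicalSpace X] [AddCommGroup E] [Module 𝕜 E]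
    [TopologicalSpace E] [AddCommGroup F] [Module 𝕜 F] [TopologicalSpace F] [PolynormableSpace 𝕜 E]
    [PolynormableSpace 𝕜 F] {f : X → E} {g : X → F} (hf : Continuous f) (hg : Continuous g) :
    Continuous fun x => ctmul 𝕜 (f x) (g x) :=
  continuous_ctmul.comp (hf.prodMk hg)

theorem exists_symHatBilin {b : SymAlg 𝕜 V →ₗ[𝕜] SymAlg 𝕜 V →ₗ[𝕜] SymAlg 𝕜 V}
    (hb : Continuous fun x : SymT 𝕜 I V × SymT 𝕜 I V => symTBilin I b x.1 x.2) :
    ∃ B : SymHat 𝕜 I V →ₗ[𝕜] SymHat 𝕜 I V →ₗ[𝕜] SymHat 𝕜 I V,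
      (Continuous fun x : SymHat 𝕜 I V × SymHat 𝕜 I V => B x.1 x.2) ∧
      ∀ x y, B (toSymHat 𝕜 I V x) (toSymHat 𝕜 I V y) = toSymHat 𝕜 I V (b x y) := by
  let e : SymT 𝕜 I V →ₗ[𝕜] SymHat 𝕜 I V := toSymHat 𝕜 I V ∘ₗ (toSymT 𝕜 I V).symm.toLinearMap
  have he : IsDenseInducing e := Completion.isDenseInducing_coe
  obtain ⟨B, hB, h⟩ := exists_extend_bilin he he ((symTBilin I b).compr₂ e) (he.continuous.comp hb)
  exact ⟨B, hB, fun x y => h (toSymT 𝕜 I V x) (toSymT 𝕜 I V y)⟩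

/-- The extension of a linear map to the completed symmetric algebras. -/
def symHatLinear (f : SymAlg 𝕜 V →ₗ[𝕜] SymAlg 𝕜 W) (hf : Continuous (symTLinear I f)) :
    SymHat 𝕜 I V →L[𝕜] SymHat 𝕜 I W :=
  (⟨symTLinear I f, hf⟩ : SymT 𝕜 I V →L[𝕜] SymT 𝕜 I W).completion

theorem symHatLinear_toSymHat (f : SymAlg 𝕜 V →ₗ[𝕜] SymAlg 𝕜 W) (hf : Continuous (symTLinear I f))
    (x : SymAlg 𝕜 V) : symHatLinear f hf (toSymHat 𝕜 I V x) = toSymHat 𝕜 I W (f x) :=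
  ContinuousLinearMap.completion_apply_coe _ _

theorem exists_symHat_linear {G : Type*} [AddCommGroup G] [Module 𝕜 G] [UniformSpace G]
    [IsUniformAddGroup G] [UniformContinuousConstSMul 𝕜 G] [T2Space G] [CompleteSpace G]
    (f : SymAlg 𝕜 V →ₗ[𝕜] G) (hf : Continuous (f ∘ₗ (toSymT 𝕜 I V).symm.toLinearMap)) :
    ∃ F : SymHat 𝕜 I V →L[𝕜] G, ∀ x, F (toSymHat 𝕜 I V x) = f x :=
  ⟨ContinuousLinearMap.fromCompletion ⟨f ∘ₗ (toSymT 𝕜 I V).symm.toLinearMap, hf⟩,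
    fun x => ContinuousLinearMap.fromCompletion_apply_coe _ (toSymT 𝕜 I V x)⟩

end SymHat

section TensorIdentity

theorem map_map_tensorTensorTensorComm {R A H : Type*} [CommRing R] [AddCommGroup A] [Module R A]
    [AddCommGroup H] [Module R H] (i : A →ₗ[R] H) (b : A →ₗ[R] A →ₗ[R] A) (m : H ⊗[R] H →ₗ[R] H)
    (hm : ∀ x y, m (i x ⊗ₜ i y) = i (b x y)) (t u : A ⊗[R] A) :
    TensorProduct.map m m (TensorProduct.tensorTensorTensorComm R _ _ _ _
        (TensorProduct.map i i t ⊗ₜ TensorProduct.map i i u)) =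
      TensorProduct.map i i (TensorProduct.map (TensorProduct.lift b) (TensorProduct.lift b)
        (TensorProduct.tensorTensorTensorComm R _ _ _ _ (t ⊗ₜ u))) := by
  induction t using TensorProduct.induction_on with
  | zero => simp only [map_zero, TensorProduct.zero_tmul]
  | tmul x y =>
    induction u using TensorProduct.induction_on with
    | zero => simp only [map_zero, TensorProduct.tmul_zero]
    | tmul x' y' =>
      simp only [TensorProduct.map_tmul, TensorProduct.tensorTensorTensorComm_tmul,
        TensorProduct.lift.tmul, hm]
    | add t t' h h' => simp only [map_add, TensorProduct.tmul_add, h, h']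
  | add t t' h h' => simp only [map_add, TensorProduct.add_tmul, h, h']

end TensorIdentity

/-! ### The completed Hopf algebra and its homomorphisms. -/

section HopfStructure

variable {𝕜 : Type*} [RCLike 𝕜] {I : Set ℝ} {𝔤 : Type*} [LieRing 𝔤] [LieAlgebra 𝕜 𝔤]
  [TopologicalSpace 𝔤]

set_option maxHeartbeats 800000 in
theorem exists_extendsGutt (hI : I.Nonempty) (hI0 : ∀ R ∈ I, max R 0 ∈ I) (z : 𝕜)
    (hz : Continuous fun x : SymT 𝕜 I 𝔤 × SymT 𝕜 I 𝔤 => symTBilin I (starProd 𝔤 z) x.1 x.2) :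
    ∃ A : LCHopfAlgebra 𝕜 (SymHat 𝕜 I 𝔤), ExtendsGutt z A := by
  set i := toSymHat 𝕜 I 𝔤 with hi
  obtain ⟨B, hB, hBi⟩ := exists_symHatBilin hz
  obtain ⟨comul, hcomul⟩ := exists_symHat_linear
    (toCTensor 𝕜 (SymHat 𝕜 I 𝔤) (SymHat 𝕜 I 𝔤) ∘ₗ TensorProduct.map i i ∘ₗ symComul 𝕜 𝔤)
    (continuous_symT_symComul hI hI0)
  obtain ⟨counit, hcounit⟩ := exists_symHat_linear _ (continuous_symT_symCounit (𝕜 := 𝕜) (V := 𝔤) hI)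
  let S := symHatLinear (I := I) (symAntipode 𝕜 𝔤) continuous_symTLinear_symAntipode
  have hS : ∀ x, S (i x) = i (symAntipode 𝕜 𝔤 x) := symHatLinear_toSymHat _ _
  let mul := ctLift B hB
  have hmul : ∀ x y, mul (ctmul 𝕜 (i x) (i y)) = i (starProd 𝔤 z x y) := fun x y => by
    rw [ctLift_ctmul, hBi]
  have hmul' : ∀ x y, mul (ctmul 𝕜 (i x) (i y)) = i (guttStar z x y) := fun x y => by
    rw [hmul, guttStar_eq_starProd]
  have := (PolynormableSpace.withSeminorms 𝕜 (SymHat 𝕜 I 𝔤)).continuousSMul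
  replace hcomul : ∀ x, comul (i x) =
    toCTensor 𝕜 _ _ (TensorProduct.map i i (symComul 𝕜 𝔤 x)) := hcomul
  replace hcounit : ∀ x, counit (i x) = symCounit 𝕜 𝔤 x := hcounit
  obtain ⟨α, hα⟩ := exists_ctAssoc (𝕜 := 𝕜) (E := SymHat 𝕜 I 𝔤) (F := SymHat 𝕜 I 𝔤) (G := SymHat 𝕜 I 𝔤)
  obtain ⟨τ, hτ⟩ := exists_ctTensorComm (𝕜 := 𝕜) (E := SymHat 𝕜 I 𝔤) (F := SymHat 𝕜 I 𝔤)
    (G := SymHat 𝕜 I 𝔤) (L := SymHat 𝕜 I 𝔤)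
  refine ⟨{
    complete := inferInstance
    hausdorff := inferInstance
    locallyConvex := inferInstance
    mul := mul
    one := i (symOne 𝕜 𝔤)
    comul := comul
    counit := counit
    antipode := S
    mul_assoc := ?_
    one_mul := ?_
    mul_one := ?_
    coassoc := ⟨α, fun a b c => hα ((a ⊗ₜ b) ⊗ₜ c), ?_⟩
    counit_comul := ?_
    comul_counit := ?_
    comul_mul := ⟨τ, fun a b c d => hτ ((a ⊗ₜ b) ⊗ₜ (c ⊗ₜ d)), ?_⟩
    comul_one := ?_
    counit_mul := ?_
    counit_one := ?_
    antipode_left := ?_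
    antipode_right := ?_ }, ?_⟩
  -- Each axiom quantified over the completion is a closed condition, so it reduces to the
  -- corresponding identity on the dense algebraic part.
  · refine symHat_induction₃ (isClosed_eq (by fun_prop) (by fun_prop)) fun x y w => ?_
    rw [hmul, hmul, hmul, hmul, starProd_assoc]
  · refine symHat_induction (isClosed_eq (by fun_prop) (by fun_prop)) fun x => ?_
    rw [hmul, symOne_starProd]
  · refine symHat_induction (isClosed_eq (by fun_prop) (by fun_prop)) fun x => ?_
    rw [hmul, starProd_symOne]
  · refine symHat_induction (isClosed_eq (by fun_prop) (by fun_prop)) fun x => ?_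
    have h1 : ∀ t : SymAlg 𝕜 𝔤 ⊗[𝕜] SymAlg 𝕜 𝔤,
        TensorProduct.map comul.toLinearMap LinearMap.id (TensorProduct.map i i t) =
          TensorProduct.map (toCTensor 𝕜 _ _) LinearMap.id
            (TensorProduct.map (TensorProduct.map i i) i
              (TensorProduct.map (symComul 𝕜 𝔤) LinearMap.id t)) := fun t => by
      induction t using TensorProduct.induction_on with
      | zero => simp only [map_zero]
      | tmul x y => simp [hcomul]
      | add t t' h h' => simp only [map_add, h, h']
    have h2 : ∀ t : SymAlg 𝕜 𝔤 ⊗[𝕜] SymAlg 𝕜 𝔤,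
        TensorProduct.map LinearMap.id comul.toLinearMap (TensorProduct.map i i t) =
          TensorProduct.map LinearMap.id (toCTensor 𝕜 _ _)
            (TensorProduct.map i (TensorProduct.map i i)
              (TensorProduct.map LinearMap.id (symComul 𝕜 𝔤) t)) := fun t => by
      induction t using TensorProduct.induction_on with
      | zero => simp only [map_zero]
      | tmul x y => simp [hcomul]
      | add t t' h h' => simp only [map_add, h, h']
    have h3 : ∀ t : (SymAlg 𝕜 𝔤 ⊗[𝕜] SymAlg 𝕜 𝔤) ⊗[𝕜] SymAlg 𝕜 𝔤,
        TensorProduct.assoc 𝕜 _ _ _ (TensorProduct.map (TensorProduct.map i i) i t) =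
          TensorProduct.map i (TensorProduct.map i i) (TensorProduct.assoc 𝕜 _ _ _ t) := fun t =>
      congr($(TensorProduct.map_map_comp_assoc_eq i i i) t).symm
    rw [hcomul, ctMap_toCTensor, ctMap_toCTensor, ContinuousLinearMap.coe_id, h1, hα, h3,
      symComul_coassoc, h2]
  · refine symHat_induction (isClosed_eq (by fun_prop) (by fun_prop)) fun x => ?_
    have h1 : ∀ t : SymAlg 𝕜 𝔤 ⊗[𝕜] SymAlg 𝕜 𝔤,
        TensorProduct.map counit.toLinearMap LinearMap.id (TensorProduct.map i i t) =
          TensorProduct.map LinearMap.id i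
            (TensorProduct.map (symCounit 𝕜 𝔤) LinearMap.id t) := fun t => by
      induction t using TensorProduct.induction_on with
      | zero => simp only [map_zero]
      | tmul x y => simp [hcounit]
      | add t t' h h' => simp only [map_add, h, h']
    rw [hcomul, ctMap_toCTensor, ContinuousLinearMap.coe_id, h1, symCounit_symComul,
      TensorProduct.map_tmul]
    rfl
  · refine symHat_induction (isClosed_eq (by fun_prop) (by fun_prop)) fun x => ?_
    have h1 : ∀ t : SymAlg 𝕜 𝔤 ⊗[𝕜] SymAlg 𝕜 𝔤,
        TensorProduct.map LinearMap.id counit.toLinearMap (TensorProduct.map i i t) =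
          TensorProduct.map i LinearMap.id
            (TensorProduct.map LinearMap.id (symCounit 𝕜 𝔤) t) := fun t => by
      induction t using TensorProduct.induction_on with
      | zero => simp only [map_zero]
      | tmul x y => simp [hcounit]
      | add t t' h h' => simp only [map_add, h, h']
    rw [hcomul, ctMap_toCTensor, ContinuousLinearMap.coe_id, h1, symComul_symCounit,
      TensorProduct.map_tmul]
    rfl
  · refine symHat_induction₂ (isClosed_eq (by fun_prop) (by fun_prop)) fun x y => ?_
    have h2 : ∀ t u : SymHat 𝕜 I 𝔤 ⊗[𝕜] SymHat 𝕜 I 𝔤, ctmul 𝕜 (toCTensor 𝕜 _ _ t) (toCTensor 𝕜 _ _ u) =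
        toCTensor 𝕜 _ _ (TensorProduct.map (toCTensor 𝕜 _ _) (toCTensor 𝕜 _ _) (t ⊗ₜ u)) :=
      fun t u => rfl
    rw [hmul, hcomul, hcomul, hcomul, symComul_starProd, h2, hτ, ctMap_toCTensor,
      ← map_map_tensorTensorTensorComm i (starProd 𝔤 z) (mul.toLinearMap ∘ₗ toCTensor 𝕜 _ _) hmul,
      TensorProduct.map_comp, LinearMap.comp_apply]
  · rw [hcomul, symComul_symOne, TensorProduct.map_tmul]
    rfl
  · refine symHat_induction₂ (isClosed_eq (by fun_prop) (by fun_prop)) fun x y => ?_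
    rw [hmul, hcounit, hcounit, hcounit, symCounit_starProd]
  · rw [hcounit, symCounit_symOne]
  · refine symHat_induction (isClosed_eq (by fun_prop) (by fun_prop)) fun x => ?_
    have h1 : ∀ t : SymAlg 𝕜 𝔤 ⊗[𝕜] SymAlg 𝕜 𝔤,
        mul (toCTensor 𝕜 _ _ (TensorProduct.map S.toLinearMap LinearMap.id (TensorProduct.map i i t))) =
          i (TensorProduct.lift (starProd 𝔤 z)
            (TensorProduct.map (symAntipode 𝕜 𝔤) LinearMap.id t)) := fun t => by
      induction t using TensorProduct.induction_on with
      | zero => simp only [map_zero]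
      | tmul x y =>
        simp only [TensorProduct.map_tmul, TensorProduct.lift.tmul, ContinuousLinearMap.coe_coe, hS]
        exact hmul _ _
      | add t t' h h' => simp only [map_add, h, h']
    rw [hcomul, ctMap_toCTensor, ContinuousLinearMap.coe_id, h1, starProd_symAntipode_left, map_smul,
      hcounit]
  · refine symHat_induction (isClosed_eq (by fun_prop) (by fun_prop)) fun x => ?_
    have h1 : ∀ t : SymAlg 𝕜 𝔤 ⊗[𝕜] SymAlg 𝕜 𝔤,
        mul (toCTensor 𝕜 _ _ (TensorProduct.map LinearMap.id S.toLinearMap (TensorProduct.map i i t))) =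
          i (TensorProduct.lift (starProd 𝔤 z)
            (TensorProduct.map LinearMap.id (symAntipode 𝕜 𝔤) t)) := fun t => by
      induction t using TensorProduct.induction_on with
      | zero => simp only [map_zero]
      | tmul x y =>
        simp only [TensorProduct.map_tmul, TensorProduct.lift.tmul, ContinuousLinearMap.coe_coe, hS]
        exact hmul _ _
      | add t t' h h' => simp only [map_add, h, h']
    rw [hcomul, ctMap_toCTensor, ContinuousLinearMap.coe_id, h1, starProd_symAntipode_right, map_smul,
      hcounit]
  · exact ⟨hmul', rfl, hcomul, hcounit, hS⟩

theorem isHopfHom_of_extendsGutt {𝔥 : Type*} [LieRing 𝔥] [LieAlgebra 𝕜 𝔥] [TopologicalSpace 𝔥]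
    (f : 𝔤 →ₗ⁅𝕜⁆ 𝔥) (Φ : SymHat 𝕜 I 𝔤 →L[𝕜] SymHat 𝕜 I 𝔥)
    (hΦ : ∀ x, Φ (toSymHat 𝕜 I 𝔤 x) = toSymHat 𝕜 I 𝔥 (symMap 𝕜 f.toLinearMap x)) {z : 𝕜}
    {A : LCHopfAlgebra 𝕜 (SymHat 𝕜 I 𝔤)} {B : LCHopfAlgebra 𝕜 (SymHat 𝕜 I 𝔥)}
    (hA : ExtendsGutt z A) (hB : ExtendsGutt z B) : IsHopfHom A B Φ where
  map_mul := by
    refine symHat_induction₂ (isClosed_eq (by fun_prop) (by fun_prop)) fun x y => ?_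
    rw [hA.mul, hΦ, hΦ, hΦ, hB.mul, guttStar_eq_starProd, guttStar_eq_starProd, symMap_starProd]
  map_one := by rw [hA.one, hB.one, hΦ, symMap_symOne]
  map_comul := by
    refine symHat_induction (isClosed_eq (by fun_prop) (by fun_prop)) fun x => ?_
    have h1 : ∀ t : SymAlg 𝕜 𝔤 ⊗[𝕜] SymAlg 𝕜 𝔤,
        TensorProduct.map Φ.toLinearMap Φ.toLinearMap
          (TensorProduct.map (toSymHat 𝕜 I 𝔤) (toSymHat 𝕜 I 𝔤) t) =
        TensorProduct.map (toSymHat 𝕜 I 𝔥) (toSymHat 𝕜 I 𝔥)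
          (TensorProduct.map (symMap 𝕜 f.toLinearMap) (symMap 𝕜 f.toLinearMap) t) := fun t => by
      induction t using TensorProduct.induction_on with
      | zero => simp only [map_zero]
      | tmul x y => simp [hΦ]
      | add t t' h h' => simp only [map_add, h, h']
    rw [hΦ, hA.comul, hB.comul, ctMap_toCTensor, h1, symComul_symMap]
  map_counit := by
    refine symHat_induction (isClosed_eq (by fun_prop) (by fun_prop)) fun x => ?_
    rw [hΦ, hA.counit, hB.counit, symCounit_symMap]
  map_antipode := by
    refine symHat_induction (isClosed_eq (by fun_prop) (by fun_prop)) fun x => ?_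
    rw [hΦ, hA.antipode, hB.antipode, hΦ, symAntipode_symMap]

end HopfStructure

/-! ### Geometric bounds, continuity and convergence of the series in `z`. -/

section Continuity

variable {𝕜 : Type*} [RCLike 𝕜] {I : Set ℝ} {𝔤 : Type*} [LieRing 𝔤] [LieAlgebra 𝕜 𝔤]
  [TopologicalSpace 𝔤]

variable (𝕜 I 𝔤) in
/-- Every seminorm that defines the topology of `SymT 𝕜 I 𝔤` has a geometric bound for the values of
the operators `Cₙ`, in terms of another such seminorm. -/
def HasGuttBounds : Prop :=
  ∀ (p : Seminorm 𝕜 𝔤) (R : ℝ), Continuous p → R ∈ I → ∃ (q : Seminorm 𝕜 𝔤) (R' : ℝ) (a : ℝ≥0),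
    Continuous q ∧ R' ∈ I ∧ GuttBound p R q R' a

theorem hasGuttBounds [PolynormableSpace 𝕜 𝔤] (hbracket : Continuous fun x : 𝔤 × 𝔤 => ⁅x.1, x.2⁆)
    {N : ℕ} (hN : 1 ≤ N) (hnil : LieModule.lowerCentralSeries 𝕜 𝔤 𝔤 N = ⊥)
    (hI : (∃ R : ℝ, 1 ≤ R ∧ I = {R}) ∨ I = Set.Iio 1) : HasGuttBounds 𝕜 I 𝔤 := by
  intro p R hp hR
  obtain ⟨q, hq, hpq⟩ := exists_isAsymptoticEstimate hbracket hnil p hp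
  rcases hI with ⟨R₁, hR₁, rfl⟩ | rfl
  · obtain rfl := Set.mem_singleton_iff.1 hR
    exact ⟨q, R, ⟨2 * 2 ^ R, by positivity⟩, hq, rfl, guttBound_of_one_le hpq hR₁⟩
  -- A negative exponent is first raised to `0`, since the estimate needs `0 ≤ R`. The new exponent
  -- is still below `1` because `(N - 1) / N < 1`.
  · have hR1 : max R 0 < 1 := max_lt hR one_pos
    refine ⟨q, max R 0 + ((N : ℝ) - 1) / N * (1 - max R 0), ⟨4 * Real.exp 1, by positivity⟩, hq, ?_,
      fun n k l v w => (symSeminorm_mono le_rfl (le_max_left R 0) _).trans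
        (guttBound_of_nilpotent hN hnil hpq (le_max_right _ _) hR1 n k l v w)⟩
    have h1 : ((N : ℝ) - 1) / N < 1 := by
      rw [div_lt_one (by exact_mod_cast hN)]
      linarith
    rw [Set.mem_Iio]
    nlinarith

theorem HasGuttBounds.continuous_starProd (h : HasGuttBounds 𝕜 I 𝔤) (z : 𝕜) :
    Continuous fun x : SymT 𝕜 I 𝔤 × SymT 𝕜 I 𝔤 => symTBilin I (starProd 𝔤 z) x.1 x.2 := by
  refine continuous_symTBilin fun p R hp hR => ?_
  obtain ⟨q, R', a, hq, hR', hb⟩ := h p R hp hR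
  refine ⟨(a * (‖z‖₊ + 1)) • q, R', 1, continuous_const.mul hq, hR', fun x y => ?_⟩
  rw [NNReal.coe_one, one_mul]
  exact hb.starProd_le z x y

theorem HasGuttBounds.continuous_guttBilin (h : HasGuttBounds 𝕜 I 𝔤) (n : ℕ) :
    Continuous fun x : SymT 𝕜 I 𝔤 × SymT 𝕜 I 𝔤 => symTBilin I (guttBilin 𝕜 𝔤 n) x.1 x.2 := by
  refine continuous_symTBilin fun p R hp hR => ?_
  obtain ⟨q, R', a, hq, hR', hb⟩ := h p R hp hR
  refine ⟨(a * (1 + 1)) • q, R', 1, continuous_const.mul hq, hR', fun x y => ?_⟩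
  have := hb.pow_mul_guttC_le 1 n x y
  rw [NNReal.coe_one, one_pow] at this
  rw [NNReal.coe_one, guttBilin_apply]
  rwa [one_mul] at this ⊢

theorem continuous_guttBilin_of_le_one [PolynormableSpace 𝕜 𝔤]
    (hbracket : Continuous fun x : 𝔤 × 𝔤 => ⁅x.1, x.2⁆) {N : ℕ}
    (hnil : LieModule.lowerCentralSeries 𝕜 𝔤 𝔤 N = ⊥) {R : ℝ} (hR0 : 0 ≤ R) (hR1 : R ≤ 1) (n : ℕ) :
    Continuous fun x : SymT 𝕜 {R} 𝔤 × SymT 𝕜 {R} 𝔤 => symTBilin {R} (guttBilin 𝕜 𝔤 n) x.1 x.2 := by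
  refine continuous_symTBilin fun p R' hp hR' => ?_
  obtain rfl := Set.mem_singleton_iff.1 hR'
  obtain ⟨q, hq, hpq⟩ := exists_isAsymptoticEstimate hbracket hnil p hp
  exact ⟨(8 : ℝ≥0) • q, R', n !, continuous_const.mul hq, rfl, fun x y => by
    rw [NNReal.coe_natCast]
    exact symSeminorm_guttC_le_of_le_one hpq hR0 hR1 n x y⟩

theorem HasGuttBounds.exists_bilin (h : HasGuttBounds 𝕜 I 𝔤) :
    ∃ C : ℕ → SymHat 𝕜 I 𝔤 →ₗ[𝕜] SymHat 𝕜 I 𝔤 →ₗ[𝕜] SymHat 𝕜 I 𝔤,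
      (∀ n, Continuous fun x : SymHat 𝕜 I 𝔤 × SymHat 𝕜 I 𝔤 => C n x.1 x.2) ∧
      ∀ (n : ℕ) (x y : SymAlg 𝕜 𝔤),
        C n (toSymHat 𝕜 I 𝔤 x) (toSymHat 𝕜 I 𝔤 y) = toSymHat 𝕜 I 𝔤 (guttC 𝕜 n x y) := by
  choose C hC hC' using fun n => exists_symHatBilin (h.continuous_guttBilin n)
  exact ⟨C, hC, hC'⟩

theorem HasGuttBounds.exists_seminorm_bound (h : HasGuttBounds 𝕜 I 𝔤) (hI : I.Nonempty)
    {C : ℕ → SymHat 𝕜 I 𝔤 →ₗ[𝕜] SymHat 𝕜 I 𝔤 →ₗ[𝕜] SymHat 𝕜 I 𝔤}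
    (hC : ∀ n, Continuous fun x : SymHat 𝕜 I 𝔤 × SymHat 𝕜 I 𝔤 => C n x.1 x.2)
    (hC' : ∀ (n : ℕ) (x y : SymAlg 𝕜 𝔤),
      C n (toSymHat 𝕜 I 𝔤 x) (toSymHat 𝕜 I 𝔤 y) = toSymHat 𝕜 I 𝔤 (guttC 𝕜 n x y))
    {s : Seminorm 𝕜 (SymHat 𝕜 I 𝔤)} (hs : Continuous s) (M : ℝ≥0) :
    ∃ P : Seminorm 𝕜 (SymHat 𝕜 I 𝔤), Continuous P ∧ ∃ K : ℝ≥0,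
      ∀ n x y, M ^ n * s (C n x y) ≤ K * (P x * P y) := by
  let i : SymT 𝕜 I 𝔤 →ₗ[𝕜] SymHat 𝕜 I 𝔤 := toSymHat 𝕜 I 𝔤 ∘ₗ (toSymT 𝕜 I 𝔤).symm.toLinearMap
  have hi : Continuous i := Completion.continuous_coe _
  obtain ⟨p, R, K, hp, hR, hs'⟩ := exists_symSeminorm_bound hI (s.comp i) (hs.comp hi)
  obtain ⟨q, R', a, hq, hR', hb⟩ := h p R hp hR
  have hQ := continuous_symTSeminorm (𝕜 := 𝕜) (I := I) hR'
    (p := (a * (M + 1)) • q) (continuous_const.mul hq)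
  refine ⟨completionSeminorm _ hQ, continuous_completionSeminorm _ hQ, K, fun n => ?_⟩
  have hP := continuous_completionSeminorm _ hQ
  refine symHat_induction₂ (isClosed_le (continuous_const.mul (hs.comp (hC n)))
    (continuous_const.mul ((hP.comp continuous_fst).mul (hP.comp continuous_snd)))) fun x y => ?_
  rw [hC']
  calc (M : ℝ) ^ n * s (toSymHat 𝕜 I 𝔤 (guttC 𝕜 n x y))
      ≤ M ^ n * (K * symSeminorm p R (guttC 𝕜 n x y)) :=
        mul_le_mul_of_nonneg_left (hs' _) (by positivity)
    _ = K * (M ^ n * symSeminorm p R (guttC 𝕜 n x y)) := mul_left_comm _ _ _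
    _ ≤ K * (symSeminorm ((a * (M + 1)) • q) R' x * symSeminorm ((a * (M + 1)) • q) R' y) :=
        mul_le_mul_of_nonneg_left (hb.pow_mul_guttC_le M n x y) K.coe_nonneg
    _ = _ := congrArg₂ (fun u v : ℝ => (K : ℝ) * (u * v))
        (completionSeminorm_coe _ hQ (toSymT 𝕜 I 𝔤 x)).symm
        (completionSeminorm_coe _ hQ (toSymT 𝕜 I 𝔤 y)).symm

/-- If `(2 (‖z‖ + 1))ⁿ cₙ` is bounded by `K`, then `‖z‖ⁿ cₙ` is bounded by a geometric sequence. -/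
theorem norm_pow_mul_le_of_pow_mul_le {z : 𝕜} {n : ℕ} {c K : ℝ} (hc : 0 ≤ c)
    (h : ((2 * (‖z‖₊ + 1) : ℝ≥0) : ℝ) ^ n * c ≤ K) : ‖z‖ ^ n * c ≤ (1 / 2) ^ n * K := by
  refine le_trans ?_ (mul_le_mul_of_nonneg_left h (by positivity))
  rw [← mul_assoc, ← mul_pow]
  refine mul_le_mul_of_nonneg_right (pow_le_pow_left₀ (norm_nonneg z) ?_ n) hc
  simp

theorem HasGuttBounds.summable_and_hasSum (h : HasGuttBounds 𝕜 I 𝔤) (hI : I.Nonempty)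
    {C : ℕ → SymHat 𝕜 I 𝔤 →ₗ[𝕜] SymHat 𝕜 I 𝔤 →ₗ[𝕜] SymHat 𝕜 I 𝔤}
    (hC : ∀ n, Continuous fun x : SymHat 𝕜 I 𝔤 × SymHat 𝕜 I 𝔤 => C n x.1 x.2)
    (hC' : ∀ (n : ℕ) (x y : SymAlg 𝕜 𝔤),
      C n (toSymHat 𝕜 I 𝔤 x) (toSymHat 𝕜 I 𝔤 y) = toSymHat 𝕜 I 𝔤 (guttC 𝕜 n x y))
    {z : 𝕜} {A : LCHopfAlgebra 𝕜 (SymHat 𝕜 I 𝔤)} (hA : ExtendsGutt z A) (x y : SymHat 𝕜 I 𝔤) :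
    (∀ s : Seminorm 𝕜 (SymHat 𝕜 I 𝔤), Continuous s → Summable fun n : ℕ => ‖z‖ ^ n * s (C n x y)) ∧
      HasSum (fun n : ℕ => z ^ n • C n x y) (A.mul (ctmul 𝕜 x y)) := by
  have key : ∀ {s : Seminorm 𝕜 (SymHat 𝕜 I 𝔤)}, Continuous s →
      ∃ P : Seminorm 𝕜 (SymHat 𝕜 I 𝔤), Continuous P ∧ ∃ K : ℝ≥0,
        ∀ n x y, ‖z‖ ^ n * s (C n x y) ≤ (1 / 2) ^ n * (K * (P x * P y)) := fun hs => by
    -- A bound for `(2 (‖z‖ + 1)) ^ n` times the terms leaves a geometric series of ratio `1 / 2`;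
    -- such a bound exists for every `z`.
    obtain ⟨P, hP, K, hK⟩ := h.exists_seminorm_bound hI hC hC' hs (2 * (‖z‖₊ + 1))
    exact ⟨P, hP, K, fun n x y => norm_pow_mul_le_of_pow_mul_le (apply_nonneg _ _) (hK n x y)⟩
  constructor
  · intro s hs
    obtain ⟨P, hP, K, hK⟩ := key hs
    exact Summable.of_nonneg_of_le (fun n => mul_nonneg (by positivity) (apply_nonneg s _))
      (fun n => hK n x y) (summable_geometric_two.mul_right _)
  · refine ((PolynormableSpace.withSeminorms 𝕜 (SymHat 𝕜 I 𝔤)).tendsto_nhds _ _).2 fun s ε hε => ?_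
    obtain ⟨P, hP, K, hK⟩ := key s.2
    -- The tail estimate is a closed condition in `(x, y)`. On the dense part the star product is a
    -- finite sum, and the difference consists of its terms outside `F`, whose weights sum to at
    -- most `2` minus the weight of `F`.
    have htail : ∀ (F : Finset ℕ) (x y : SymHat 𝕜 I 𝔤),
        s.1 (∑ n ∈ F, z ^ n • C n x y - A.mul (ctmul 𝕜 x y)) ≤
          (2 - ∑ n ∈ F, (1 / 2 : ℝ) ^ n) * (K * (P x * P y)) := fun F => by
      refine symHat_induction₂ (isClosed_le (s.2.comp (Continuous.sub
        (continuous_finsetSum _ fun n _ => (hC n).const_smul (z ^ n)) (by fun_prop)))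
        (by fun_prop)) fun x y => ?_
      obtain ⟨M, hM⟩ := exists_guttC_eq_zero x y
      obtain ⟨m, hm⟩ := F.exists_nat_subset_range
      have hF : F ⊆ Finset.range (max M m) :=
        hm.trans (Finset.range_subset_range.2 (le_max_right _ _))
      have h1 : A.mul (ctmul 𝕜 (toSymHat 𝕜 I 𝔤 x) (toSymHat 𝕜 I 𝔤 y)) =
          ∑ n ∈ Finset.range (max M m), z ^ n • C n (toSymHat 𝕜 I 𝔤 x) (toSymHat 𝕜 I 𝔤 y) := by
        rw [hA.mul, guttStar_eq_sum z x y (M := max M m) fun n hn => hM n ((le_max_left _ _).trans hn), map_sum]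
        simp only [map_smul, hC']
      rw [h1, ← Finset.sum_sdiff hF, ← sub_sub, sub_right_comm, sub_self, zero_sub, map_neg_eq_map]
      refine (seminorm_sum_le s.1 _ _).trans ?_
      refine (Finset.sum_le_sum fun n _ => ?_).trans (b := ∑ n ∈ Finset.range (max M m) \ F,
        (1 / 2 : ℝ) ^ n * (K * (P (toSymHat 𝕜 I 𝔤 x) * P (toSymHat 𝕜 I 𝔤 y)))) ?_
      · rw [map_smul_eq_mul, norm_pow]
        exact hK n _ _
      · rw [← Finset.sum_mul]
        refine mul_le_mul_of_nonneg_right ?_ (mul_nonneg K.coe_nonneg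
          (mul_nonneg (apply_nonneg P _) (apply_nonneg P _)))
        rw [le_sub_iff_add_le, Finset.sum_sdiff hF]
        exact sum_le_hasSum _ (fun n _ => by positivity) hasSum_geometric_two
    have hlim : Filter.Tendsto (fun F : Finset ℕ => (2 - ∑ n ∈ F, (1 / 2 : ℝ) ^ n) * (K * (P x * P y)))
        Filter.atTop (𝓝 ((2 - 2) * (K * (P x * P y)))) :=
      (tendsto_const_nhds.sub hasSum_geometric_two).mul_const _
    rw [sub_self, zero_mul] at hlim
    filter_upwards [hlim.eventually (gt_mem_nhds hε)] with F hF
    exact (htail F x y).trans_lt hF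

end Continuity

/-! ### Induced maps between completions. -/

section Functoriality

variable {𝕜 : Type*} [RCLike 𝕜] {I : Set ℝ} {𝔤 : Type*} [LieRing 𝔤] [LieAlgebra 𝕜 𝔤]
  [TopologicalSpace 𝔤] {𝔥 : Type*} [LieRing 𝔥] [LieAlgebra 𝕜 𝔥] [TopologicalSpace 𝔥]
  {𝔨 : Type*} [LieRing 𝔨] [LieAlgebra 𝕜 𝔨] [TopologicalSpace 𝔨]

theorem coe_symHatLinear_symMap (f : 𝔤 →ₗ⁅𝕜⁆ 𝔥) (hf : Continuous f) :
    ⇑(symHatLinear (symMap 𝕜 f.toLinearMap)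
      (continuous_symTLinear_symMap (I := I) (f := f.toLinearMap) hf)) = symHatMap I f := rfl

theorem symHatMap_id : symHatMap I (LieHom.id : 𝔤 →ₗ⁅𝕜⁆ 𝔤) = id := by
  have h : (fun x : SymT 𝕜 I 𝔤 => toSymT 𝕜 I 𝔤
      (symMap 𝕜 (LieHom.id : 𝔤 →ₗ⁅𝕜⁆ 𝔤).toLinearMap ((toSymT 𝕜 I 𝔤).symm x))) = id := by
    funext x
    rw [show (LieHom.id : 𝔤 →ₗ⁅𝕜⁆ 𝔤).toLinearMap = LinearMap.id from rfl, symMap_id]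
    rfl
  rw [symHatMap, h, Completion.map_id]

theorem uniformContinuous_symTLinear_symMap (f : 𝔤 →ₗ⁅𝕜⁆ 𝔥) (hf : Continuous f) :
    UniformContinuous fun x : SymT 𝕜 I 𝔤 =>
      toSymT 𝕜 I 𝔥 (symMap 𝕜 f.toLinearMap ((toSymT 𝕜 I 𝔤).symm x)) :=
  (⟨_, continuous_symTLinear_symMap (I := I) (f := f.toLinearMap) hf⟩ :
    SymT 𝕜 I 𝔤 →L[𝕜] SymT 𝕜 I 𝔥).uniformContinuous

theorem symHatMap_comp (f : 𝔤 →ₗ⁅𝕜⁆ 𝔥) (g : 𝔥 →ₗ⁅𝕜⁆ 𝔨) (hf : Continuous f) (hg : Continuous g) :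
    symHatMap I (g.comp f) = symHatMap I g ∘ symHatMap I f := by
  rw [symHatMap, symHatMap, symHatMap, Completion.map_comp (uniformContinuous_symTLinear_symMap g hg)
    (uniformContinuous_symTLinear_symMap f hf)]
  congr 1
  funext x
  rw [show (g.comp f).toLinearMap = g.toLinearMap ∘ₗ f.toLinearMap from rfl, symMap_comp]
  rfl

end Functoriality

end GuttStar

end

/-! ### The main theorem. -/

theorem theorem2 {𝕜 : Type*} [RCLike 𝕜]
    {𝔤 : Type*} [LieRing 𝔤] [LieAlgebra 𝕜 𝔤] [TopologicalSpace 𝔤] [PolynormableSpace 𝕜 𝔤]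
    (hbracket : Continuous fun x : 𝔤 × 𝔤 => ⁅x.1, x.2⁆)
    (N : ℕ) (hN : 1 ≤ N) (hnil : LieModule.lowerCentralSeries 𝕜 𝔤 𝔤 N = ⊥) :
    -- the star product is well-defined, and `𝔤` is an asymptotic estimate algebra
    Function.Bijective (pbw 𝕜 𝔤) ∧
    (∀ p : Seminorm 𝕜 𝔤, Continuous p →
      ∃ q : Seminorm 𝕜 𝔤, Continuous q ∧ IsAsymptoticEstimate p q) ∧
    -- continuity of the operators `Cₙ` for `0 ≤ R < 1`
    (∀ (R : ℝ) (n : ℕ), 0 ≤ R → R < 1 →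
      Continuous fun x : SymT 𝕜 {R} 𝔤 × SymT 𝕜 {R} 𝔤 =>
        toSymT 𝕜 {R} 𝔤 (guttC 𝕜 n ((toSymT 𝕜 {R} 𝔤).symm x.1) ((toSymT 𝕜 {R} 𝔤).symm x.2))) ∧
    -- the estimates for `Cₙ` and for the star product
    (∀ (R : ℝ) (p q : Seminorm 𝕜 𝔤), 0 ≤ R → R < 1 → Continuous p → Continuous q →
      IsAsymptoticEstimate p q → ∀ ε : ℝ, ε = ((N : ℝ) - 1) / N * (1 - R) →
      (∀ (n : ℕ) (x y : SymAlg 𝕜 𝔤), (n ≠ 0 ∨ symCounit 𝕜 𝔤 x = 0 ∨ symCounit 𝕜 𝔤 y = 0) →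
        symSeminorm p R (guttC 𝕜 n x y) ≤ 1 / (2 * 8 ^ n) *
          (symSeminorm (Real.toNNReal (32 * Real.exp 1) • q) (R + ε) x *
            symSeminorm (Real.toNNReal (32 * Real.exp 1) • q) (R + ε) y)) ∧
      (∀ x y : SymAlg 𝕜 𝔤,
        symSeminorm p R (guttC 𝕜 0 x y) ≤
          symSeminorm (Real.toNNReal (32 * Real.exp 1) • q) (R + ε) x *
            symSeminorm (Real.toNNReal (32 * Real.exp 1) • q) (R + ε) y) ∧
      (∀ (z : 𝕜) (x y : SymAlg 𝕜 𝔤),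
        symSeminorm p R (guttStar z x y) ≤
          symSeminorm (Real.toNNReal (32 * Real.exp 1 * (‖z‖ + 1)) • q) (R + ε) x *
            symSeminorm (Real.toNNReal (32 * Real.exp 1 * (‖z‖ + 1)) • q) (R + ε) y)) ∧
    -- the conclusions for the `Sym_R`-topologies with `R ≥ 1` and for the `Sym_{1⁻}`-topology
    (∀ I : Set ℝ, ((∃ R : ℝ, 1 ≤ R ∧ I = {R}) ∨ I = Set.Iio 1) →
      -- continuity of the Gutt star product
      (∀ z : 𝕜, Continuous fun x : SymT 𝕜 I 𝔤 × SymT 𝕜 I 𝔤 =>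
        toSymT 𝕜 I 𝔤 (guttStar z ((toSymT 𝕜 I 𝔤).symm x.1) ((toSymT 𝕜 I 𝔤).symm x.2))) ∧
      -- the completion is a locally convex Hopf algebra
      (∀ z : 𝕜, ∃ A : LCHopfAlgebra 𝕜 (SymHat 𝕜 I 𝔤), ExtendsGutt z A) ∧
      -- convergence of the Gutt star product as a series in `z`
      (∃ C : ℕ → SymHat 𝕜 I 𝔤 →ₗ[𝕜] SymHat 𝕜 I 𝔤 →ₗ[𝕜] SymHat 𝕜 I 𝔤,
        (∀ n, Continuous fun x : SymHat 𝕜 I 𝔤 × SymHat 𝕜 I 𝔤 => C n x.1 x.2) ∧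
        (∀ (n : ℕ) (x y : SymAlg 𝕜 𝔤),
          C n (toSymHat 𝕜 I 𝔤 x) (toSymHat 𝕜 I 𝔤 y) = toSymHat 𝕜 I 𝔤 (guttC 𝕜 n x y)) ∧
        ∀ (z : 𝕜) (A : LCHopfAlgebra 𝕜 (SymHat 𝕜 I 𝔤)), ExtendsGutt z A →
          ∀ x y : SymHat 𝕜 I 𝔤,
            (∀ s : Seminorm 𝕜 (SymHat 𝕜 I 𝔤), Continuous s →
              Summable fun n : ℕ => ‖z‖ ^ n * s (C n x y)) ∧
            HasSum (fun n : ℕ => z ^ n • C n x y) (A.mul (ctmul 𝕜 x y))) ∧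
      -- functoriality
      (∀ (𝔥 : Type*) [LieRing 𝔥] [LieAlgebra 𝕜 𝔥] [TopologicalSpace 𝔥] [PolynormableSpace 𝕜 𝔥]
        [LieRing.IsNilpotent 𝔥], (Continuous fun x : 𝔥 × 𝔥 => ⁅x.1, x.2⁆) →
        ∀ f : 𝔤 →ₗ⁅𝕜⁆ 𝔥, Continuous f →
          (∀ (z : 𝕜) (x y : SymAlg 𝕜 𝔤), symMap 𝕜 f.toLinearMap (guttStar z x y) =
            guttStar z (symMap 𝕜 f.toLinearMap x) (symMap 𝕜 f.toLinearMap y)) ∧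
          (Continuous fun x : SymT 𝕜 I 𝔤 =>
            toSymT 𝕜 I 𝔥 (symMap 𝕜 f.toLinearMap ((toSymT 𝕜 I 𝔤).symm x))) ∧
          ∃ Φ : SymHat 𝕜 I 𝔤 →L[𝕜] SymHat 𝕜 I 𝔥, ⇑Φ = symHatMap I f ∧
            (∀ x : SymAlg 𝕜 𝔤,
              Φ (toSymHat 𝕜 I 𝔤 x) = toSymHat 𝕜 I 𝔥 (symMap 𝕜 f.toLinearMap x)) ∧
            (∀ ξ : 𝔤, Φ (toSymHat 𝕜 I 𝔤 (symι 𝕜 𝔤 ξ)) = toSymHat 𝕜 I 𝔥 (symι 𝕜 𝔥 (f ξ))) ∧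
            ∀ (z : 𝕜) (A : LCHopfAlgebra 𝕜 (SymHat 𝕜 I 𝔤)) (B : LCHopfAlgebra 𝕜 (SymHat 𝕜 I 𝔥)),
              ExtendsGutt z A → ExtendsGutt z B → IsHopfHom A B Φ) ∧
      symHatMap I (LieHom.id : 𝔤 →ₗ⁅𝕜⁆ 𝔤) = id ∧
      (∀ (𝔥 : Type*) [LieRing 𝔥] [LieAlgebra 𝕜 𝔥] [TopologicalSpace 𝔥] [PolynormableSpace 𝕜 𝔥]
        [LieRing.IsNilpotent 𝔥] (𝔨 : Type*) [LieRing 𝔨] [LieAlgebra 𝕜 𝔨] [TopologicalSpace 𝔨]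
        [PolynormableSpace 𝕜 𝔨] [LieRing.IsNilpotent 𝔨],
        (Continuous fun x : 𝔥 × 𝔥 => ⁅x.1, x.2⁆) → (Continuous fun x : 𝔨 × 𝔨 => ⁅x.1, x.2⁆) →
        ∀ (f : 𝔤 →ₗ⁅𝕜⁆ 𝔥) (g : 𝔥 →ₗ⁅𝕜⁆ 𝔨), Continuous f → Continuous g →
          symHatMap I (g.comp f) = symHatMap I g ∘ symHatMap I f)) := by
  refine ⟨pbw_bijective 𝕜 𝔤, exists_isAsymptoticEstimate hbracket hnil, ?_, ?_, ?_⟩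
  · intro R n hR0 hR1
    exact continuous_guttBilin_of_le_one hbracket hnil hR0 hR1.le n
  · rintro R p q hR0 hR1 - - hpq _ rfl
    have hb : GuttBound p R q (R + ((N : ℝ) - 1) / N * (1 - R)) (Real.toNNReal (4 * Real.exp 1)) := by
      rw [Real.coe_toNNReal _ (by positivity)]
      exact guttBound_of_nilpotent hN hnil hpq hR0 hR1
    have h32 : Real.toNNReal (32 * Real.exp 1) = 8 * Real.toNNReal (4 * Real.exp 1) := by
      rw [← Real.toNNReal_ofNat 8, ← Real.toNNReal_mul (by norm_num)]
      ring_nf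
    refine ⟨fun n x y hnxy => ?_, fun x y => ?_, fun z x y => ?_⟩
    · rw [h32]
      exact hb.guttC_le hnil n x y hnxy
    -- With `M = 0` and `n = 0` the power `0 ^ 0` is `1`, so the bound holds with the constant `4
    -- e`, which is then enlarged to `32 e`.
    · have h := hb.pow_mul_guttC_le 0 0 x y
      rw [pow_zero, one_mul, zero_add, mul_one] at h
      refine symSeminorm_le_mul_of_le h ?_
      rw [h32]
      exact le_mul_of_one_le_left' (by norm_num)
    · rw [guttStar_eq_starProd]
      refine symSeminorm_le_mul_of_le (hb.starProd_le z x y) ?_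
      rw [Real.toNNReal_mul (p := 32 * Real.exp 1) (by positivity), h32,
        Real.toNNReal_add (norm_nonneg z) zero_le_one,
        norm_toNNReal, Real.toNNReal_one]
      exact mul_le_mul_left (le_mul_of_one_le_left' (by norm_num)) _
  · intro I hI
    have hb : HasGuttBounds 𝕜 I 𝔤 := hasGuttBounds hbracket hN hnil hI
    have hne : I.Nonempty := by
      rcases hI with ⟨R, -, rfl⟩ | rfl
      · exact Set.singleton_nonempty R
      · exact Set.nonempty_Iio
    -- For a single `R ≥ 1` the maximum is `R`; for the family of all `R < 1` it is again below `1`.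
    have hI0 : ∀ R ∈ I, max R 0 ∈ I := by
      rcases hI with ⟨R, hR, rfl⟩ | rfl
      · rintro _ rfl
        exact max_eq_left (zero_le_one.trans hR)
      · exact fun R hR => Set.mem_Iio.2 (max_lt hR one_pos)
    refine ⟨fun z => ?_, fun z => exists_extendsGutt hne hI0 z (hb.continuous_starProd z), ?_, ?_,
      symHatMap_id, ?_⟩
    · simp only [guttStar_eq_starProd]
      exact hb.continuous_starProd z
    · obtain ⟨C, hC, hC'⟩ := hb.exists_bilin
      exact ⟨C, hC, hC', fun z A hA => hb.summable_and_hasSum hne hC hC' hA⟩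
    · intro 𝔥 _ _ _ _ _ _ f hf
      have hΦ := symHatLinear_toSymHat (symMap 𝕜 f.toLinearMap)
        (continuous_symTLinear_symMap (I := I) (f := f.toLinearMap) hf)
      refine ⟨fun z x y => ?_, continuous_symTLinear_symMap (f := f.toLinearMap) hf, _,
        coe_symHatLinear_symMap f hf, hΦ, fun ξ => ?_,
        fun z A B hA hB => isHopfHom_of_extendsGutt f _ hΦ hA hB⟩
      · rw [guttStar_eq_starProd, guttStar_eq_starProd, symMap_starProd]
      · rw [hΦ, symMap_symι]
        rfl
    · intro 𝔥 _ _ _ _ _ 𝔨 _ _ _ _ _ _ _ f g hf hg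
      exact symHatMap_comp f g hf hg
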